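/- **Setting.** Let $y_t=\mathbf B G_t+\mathbf\Lambda F_t+u_t\in\mathbb R^p$, $t=1,\dots,T$, be a multi-level factor model with $J$ known groups of sizes $p_1,\dots,p_J$ ($p=\sum_j p_j$), a fixed number $k$ of global factors $G_t$, and $r_j$ local factors $f^j_t$ in group $j$ (the $r_j$ are bounded), $F_t=(f_t^{1\prime},\dots,f_t^{J\prime})'$, $\mathbf\Lambda=\mathrm{diag}(\Lambda^1,\dots,\Lambda^J)$. Global factors, local factors and errors are mutually uncorrelated, $\mathrm{cov}(G_t)=\mathbf I$, $\mathrm{cov}(F_t)=\mathbf I$, $\mathrm{cov}(u_t)=\mathbf\Sigma_u=(\sigma_{u,ij})$, and $\mathbf B'\mathbf B$, $\Lambda^{j\prime}\Lambda^j$ are diagonal; so $\mathbf\Sigma=\mathrm{cov}(y_t)=\mathbf B\mathbf B'+\mathbf\Lambda\mathbf\Lambda'+\mathbf\Sigma_u$. Let $\mathbf\Sigma^j$, $\mathbf\Sigma_u^j$ be the $j$-th diagonal blocks, $B^j$ the rows of $\mathbf B$ of group $j$, and, for $q\in[0,1)$ and with $0^0=0$, $m_p=\max_{i}\sum_{l}|\sigma_{u,il}|^q$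 and $m_{p_j}$ the same quantity for $\mathbf\Sigma_u^j$. Norms: $\|A\|_{\max}=\max|a_{il}|$, $\|A\|_2$ the operator norm, $\|A\|_{\Sigma^j}=p_j^{-1/2}\|(\Sigma^{j})^{-1/2}A(\Sigma^{j})^{-1/2}\|_F$. **Estimator.** Let $\widehat{\mathbf\Sigma}=T^{-1}\sum_t(y_t-\bar y)(y_t-\bar y)'$, let $P$ be the sum of its first $k$ principal components $\widehat\delta_i\widehat v_i\widehat v_i'$, let $Q^j$ be the sum of the first $r_j$ principal components of the $j$-th diagonal block of $\widehat{\mathbf\Sigma}-P$, $Q=\mathrm{diag}(Q^1,\dots,Q^J)$ and $\widehat{\mathbf\Sigma}_u=\widehat{\mathbf\Sigma}-P-Q=(\widehat\sigma_{u,il})$. The Double-POET estimator is $\widehat{\mathbf\Sigma}^{\mathcal D}=P+Q+\widehat{\mathbf\Sigma}_u^{\mathcal D}$, where $\widehat{\mathbf\Sigma}_u^{\mathcal D}$ keeps the diagonal of $\widehat{\mathbf\Sigma}_u$ and replaces $\widehat\sigma_{u,il}$, $i\ne l$, by $s_{il}(\widehat\sigma_{u,il})\,I(|\widehat\sigma_{u,il}|\ge\tau_{il})$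 with $\tau_{il}=\tau(\widehat\sigma_{u,ii}\widehat\sigma_{u,ll})^{1/2}$ and shrinkage functions $s_{il}=s_{li}$ such that $|s_{il}(z)|\le|z|$ and $|s_{il}(z)-z|\le\tau_{il}$ for $|z|\ge\tau_{il}$ (e.g. hard or soft thresholding). **Assumptions** (as $p,T\to\infty$; constants do not depend on $p,T$ or the group). For constants $c\in(0,1]$, $a_1\in(\frac{3+2c}5,1]$, $a_2\in(\frac35,1]$ with $a_1\ge ca_2$: the eigenvalues of $\mathbf B'\mathbf B/p^{a_1}$ and $\Lambda^{j\prime}\Lambda^j/p_j^{a_2}$ are bounded away from $0$; if $a_1=ca_2$, then $\lambda_{\min}(\mathbf B'\mathbf B)-\lambda_{\max}(\mathbf\Lambda'\mathbf\Lambda)$ is bounded below by a positive constant; the entries of $\mathbf B,\mathbf\Lambda$ are bounded; $\lambda_{\min}(\mathbf\Sigma_u)>d_1>0$, $\|\mathbf\Sigma_u\|_1\le d_2m_p$, and the variances $\sigma_{u,ii}$ are bounded; $\|\widehat{\mathbf\Sigma}-\mathbf\Sigma\|_{\max}=O_P(\sqrt{\log p/T})$; $\mathbf B'\mathbf\Lambda=0$;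 $p_j\asymp p^c$ uniformly in $j$; $m_p=o(\min\{p^{(5a_1-3)/2},p^{c(5a_2-3)/2}\})$. Let $$\omega_{T,2}=p^{\frac52(1-a_1)+\frac52c(1-a_2)}\sqrt{\tfrac{\log p}T}+\frac{m_p}{\sqrt{p^{c(5a_2-3)}}}+\frac{m_p}{\sqrt{p^{5a_1-3-5c(1-a_2)}}},$$ and let $j$ be a group (it may vary with $p$) with $m_{p_j}\omega_{T,2}^{1-q}=o(1)$. **Theorem.** Let $(\widehat{\mathbf\Sigma}^{\mathcal D})^j$ be the $j$-th diagonal block of the Double-POET estimator. 1. If $\tau\asymp\omega_{T,2}$, then $\|(\widehat{\mathbf\Sigma}^{\mathcal D})^j-\mathbf\Sigma^j\|_{\max}=O_P(\omega_{T,2})$. 2. For every $K>0$ there is $C_0>0$ such that for all $\tau\asymp\omega_{T,2}$ with $\tau\ge C_0\,\omega_{T,2}$ the following holds for all events $A_T$ with $\Pr(A_T\cap\{\|\widehat{\mathbf\Sigma}-\mathbf\Sigma\|_{\max}>K\sqrt{\log p/T}\})\to0$. (The events $\{\|\widehat{\mathbf\Sigma}-\mathbf\Sigma\|_{\max}\le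 K\sqrt{\log p/T}\}$, whose probability is eventually as close to one as desired if $K$ is large, are admissible; so is the whole space, and then the rates are ordinary $O_P$ rates, if $\|\widehat{\mathbf\Sigma}-\mathbf\Sigma\|_{\max}\le K\sqrt{\log p/T}$ with probability tending to one. Here $X_T=O_P(\rho_T)$ on $A_T$ means: for every $\delta>0$ there is $C$ with $\Pr(A_T\cap\{X_T>C\rho_T\})\le\delta$ eventually.) (a) If the global factors are pervasive in group $j$ in proportion to its size, i.e. the eigenvalues of $B^{j\prime}B^j/(p_jp^{a_1-1})$ are bounded away from $0$, then $\Pr(A_T\cap\{(\widehat{\mathbf\Sigma}^{\mathcal D})^j\text{ is singular}\})\to0$ and, on $A_T$, $$\|((\widehat{\mathbf\Sigma}^{\mathcal D})^j)^{-1}-(\mathbf\Sigma^j)^{-1}\|_2=O_P(m_{p_j}\omega_{T,2}^{1-q}).$$ (b) If $a_1>\frac34$ and $a_2>\frac34$, then, on $A_T$, $$\|(\widehat{\mathbf\Sigma}^{\mathcal D})^j-\mathbf\Sigma^j\|_{\Sigma^j}=O_P\Big(m_{p_j}\omega_{T,2}^{1-q}+p^{5(1-a_1)+c(\frac{11}2-5a_2)}\frac{\log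 p}T+\frac{m_p^2}{p^{5a_1-3+c(5a_2-\frac{11}2)}}+\frac{m_p^2}{p^{c(5a_2-\frac72)}}\Big).$$ -/

import Mathlib

open MeasureTheory ProbabilityTheory Filter Topology
open scoped Matrix

namespace DoublePOET

noncomputable section

/-! ### Matrix norms -/

/-- Elementwise maximum norm `max_{i,j} |a_{ij}|`. -/
def maxNorm {ι κ : Type*} (A : Matrix ι κ ℝ) : ℝ := ⨆ i, ⨆ j, |A i j|

/-- Operator norm with respect to the Euclidean norm. -/
def opNorm {ι : Type*} [Fintype ι] [DecidableEq ι] (A : Matrix ι ι ℝ) : ℝ :=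
  ‖Matrix.toEuclideanCLM (n := ι) (𝕜 := ℝ) A‖

/-- Frobenius norm `tr(A'A)^{1/2}`. -/
def frobNorm {ι : Type*} [Fintype ι] (A : Matrix ι ι ℝ) : ℝ := √(Aᵀ * A).trace

/-- The inverse square root `S^{-1/2}` of a symmetric positive definite matrix. -/
def invSqrt {ι : Type*} [Fintype ι] [DecidableEq ι] (S : Matrix ι ι ℝ) : Matrix ι ι ℝ :=
  cfc (fun x : ℝ => (√x)⁻¹) S

/-- Relative Frobenius norm `‖A‖_S = d^{-1/2} ‖S^{-1/2} A S^{-1/2}‖_F`, `d` the dimension. -/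
def relFrobNorm {ι : Type*} [Fintype ι] [DecidableEq ι] (S A : Matrix ι ι ℝ) : ℝ :=
  (√(Fintype.card ι : ℝ))⁻¹ * frobNorm (invSqrt S * A * invSqrt S)

/-- The sparsity level `max_i ∑_j |s_{ij}|^q`, where `0^0 = 0` (so that for `q = 0` it is the
maximal number of nonzero entries in a row). -/
def sparsity {ι : Type*} [Fintype ι] (q : ℝ) (S : Matrix ι ι ℝ) : ℝ :=
  ⨆ i, ∑ j, if S i j = 0 then 0 else |S i j| ^ q

/-! ### The multi-level factor model -/

/-- A multi-level factor model `y_t = B G_t + Λ F_t + u_t`, `t = 1, …, T`, with `k` global factors,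
`J` groups, `size j` individuals and `rank j` local factors in group `j`, and
`Λ = diag(Λ^1, …, Λ^J)`.  An individual is a pair (group, position in the group).
The normalization is `cov(G_t) = I`, `cov(F_t) = I`, and `B'B`, `Λ^j'Λ^j` are diagonal; global
factors, local factors and idiosyncratic errors are mutually uncorrelated. No assumption is made
on the dependence over time. -/
structure Model {Ω : Type*} [MeasurableSpace Ω] (μ : Measure Ω) (k : ℕ) where
  /-- number of observations -/
  T : ℕ
  /-- number of groups -/
  J : ℕ
  /-- group sizes -/
  size : Fin J → ℕ
  /-- numbers of local factors -/
  rank : Fin J → ℕ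
  /-- global loadings -/
  B : Matrix (Σ j, Fin (size j)) (Fin k) ℝ
  /-- local loadings of each group -/
  L : ∀ j, Matrix (Fin (size j)) (Fin (rank j)) ℝ
  /-- idiosyncratic covariance matrix -/
  Su : Matrix (Σ j, Fin (size j)) (Σ j, Fin (size j)) ℝ
  /-- global factors -/
  G : Fin T → Fin k → Ω → ℝ
  /-- local factors -/
  F : Fin T → (Σ j, Fin (rank j)) → Ω → ℝ
  /-- idiosyncratic errors -/
  u : Fin T → (Σ j, Fin (size j)) → Ω → ℝ
  memLp_G : ∀ t a, MemLp (G t a) 2 μ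
  memLp_F : ∀ t a, MemLp (F t a) 2 μ
  memLp_u : ∀ t i, MemLp (u t i) 2 μ
  cov_G : ∀ t a b, cov[G t a, G t b; μ] = (1 : Matrix (Fin k) (Fin k) ℝ) a b
  cov_F : ∀ t a b, cov[F t a, F t b; μ] =
    (1 : Matrix (Σ j, Fin (rank j)) (Σ j, Fin (rank j)) ℝ) a b
  cov_u : ∀ t i j, cov[u t i, u t j; μ] = Su i j
  cov_G_F : ∀ t a b, cov[G t a, F t b; μ] = 0
  cov_G_u : ∀ t a i, cov[G t a, u t i; μ] = 0
  cov_F_u : ∀ t a i, cov[F t a, u t i; μ] = 0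
  diag_B : (Bᵀ * B).IsDiag
  diag_L : ∀ j, ((L j)ᵀ * L j).IsDiag

namespace Model

variable {Ω : Type*} [MeasurableSpace Ω] {μ : Measure Ω} {k : ℕ}

/-- The individuals. -/
abbrev Ind (M : Model μ k) : Type := Σ j, Fin (M.size j)

/-- The total number `p = ∑_j p_j` of individuals. -/
def p (M : Model μ k) : ℕ := ∑ j, M.size j

/-- The block diagonal matrix `Λ` of all local loadings. -/
def Lam (M : Model μ k) : Matrix M.Ind (Σ j, Fin (M.rank j)) ℝ := Matrix.blockDiagonal' M.L

/-- The global loadings `B^j` of group `j`. -/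
def Bgroup (M : Model μ k) (j : Fin M.J) : Matrix (Fin (M.size j)) (Fin k) ℝ :=
  M.B.submatrix (fun i => ⟨j, i⟩) id

/-- The observations `y_t`. -/
def y (M : Model μ k) (t : Fin M.T) (i : M.Ind) (x : Ω) : ℝ :=
  ∑ a, M.B i a * M.G t a x + ∑ a, M.Lam i a * M.F t a x + M.u t i x

/-- The covariance matrix `Σ` of `y_t`, see `cov_y`. -/
def Sig (M : Model μ k) : Matrix M.Ind M.Ind ℝ := M.B * M.Bᵀ + M.Lam * M.Lamᵀ + M.Su

/-- The sample covariance matrix `T^{-1} ∑_t (y_t - ȳ)(y_t - ȳ)'`. -/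
def sampleCov (M : Model μ k) (x : Ω) : Matrix M.Ind M.Ind ℝ := fun i j =>
  (M.T : ℝ)⁻¹ * ∑ t, (M.y t i x - (M.T : ℝ)⁻¹ * ∑ s, M.y s i x) *
    (M.y t j x - (M.T : ℝ)⁻¹ * ∑ s, M.y s j x)

/-- The sparsity level `m_p` of the idiosyncratic covariance matrix. -/
def m (M : Model μ k) (q : ℝ) : ℝ := sparsity q M.Su

/-- The sparsity level `m_{p_j}` of the idiosyncratic covariance matrix of group `j`. -/
def mgroup (M : Model μ k) (q : ℝ) (j : Fin M.J) : ℝ := sparsity q (M.Su.blockDiag' j)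

/-- The rate `√(log p / T)`. -/
def eps (M : Model μ k) : ℝ := √(Real.log M.p / M.T)

/-- The rate `ω_{T,2}`. -/
def omega (M : Model μ k) (c a₁ a₂ q : ℝ) : ℝ :=
  (M.p : ℝ) ^ (5 / 2 * (1 - a₁) + 5 / 2 * c * (1 - a₂)) * √(Real.log M.p / M.T)
    + M.m q / √((M.p : ℝ) ^ (c * (5 * a₂ - 3)))
    + M.m q / √((M.p : ℝ) ^ (5 * a₁ - 3 - 5 * c * (1 - a₂)))

/-- The rate of convergence in relative Frobenius norm for group `j`. -/
def relRate (M : Model μ k) (c a₁ a₂ q : ℝ) (j : Fin M.J) : ℝ :=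
  M.mgroup q j * M.omega c a₁ a₂ q ^ (1 - q)
    + (M.p : ℝ) ^ (5 * (1 - a₁) + c * (11 / 2 - 5 * a₂)) * (Real.log M.p / M.T)
    + M.m q ^ 2 / (M.p : ℝ) ^ (5 * a₁ - 3 + c * (5 * a₂ - 11 / 2))
    + M.m q ^ 2 / (M.p : ℝ) ^ (c * (5 * a₂ - 7 / 2))

theorem cov_y [IsProbabilityMeasure μ] (M : Model μ k) (t : Fin M.T) (i j : M.Ind) :
    cov[M.y t i, M.y t j; μ] = M.Sig i j := by
  have hG' : ∀ i a, MemLp (fun x => M.B i a * M.G t a x) 2 μ := fun i a =>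
    (M.memLp_G t a).const_mul _
  have hF' : ∀ i a, MemLp (fun x => M.Lam i a * M.F t a x) 2 μ := fun i a =>
    (M.memLp_F t a).const_mul _
  have hG : ∀ i, MemLp (fun x => ∑ a, M.B i a * M.G t a x) 2 μ := fun i =>
    memLp_finsetSum _ fun a _ => hG' i a
  have hF : ∀ i, MemLp (fun x => ∑ a, M.Lam i a * M.F t a x) 2 μ := fun i =>
    memLp_finsetSum _ fun a _ => hF' i a
  have hu := M.memLp_u t
  have hy : ∀ i, M.y t i = (fun x => ∑ a, M.B i a * M.G t a x) +
      ((fun x => ∑ a, M.Lam i a * M.F t a x) + M.u t i) := fun i => by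
    funext x; simp [y, add_assoc]
  have hFG : ∀ b a, cov[M.F t b, M.G t a; μ] = 0 := fun b a => by
    rw [covariance_comm, M.cov_G_F]
  have huG : ∀ i a, cov[M.u t i, M.G t a; μ] = 0 := fun i a => by
    rw [covariance_comm, M.cov_G_u]
  have huF : ∀ i a, cov[M.u t i, M.F t a; μ] = 0 := fun i a => by
    rw [covariance_comm, M.cov_F_u]
  rw [hy, hy, covariance_add_left (hG i) ((hF i).add (hu i)) ((hG j).add ((hF j).add (hu j))),
    covariance_add_left (hF i) (hu i) ((hG j).add ((hF j).add (hu j))),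
    covariance_add_right (hG i) (hG j) ((hF j).add (hu j)),
    covariance_add_right (hG i) (hF j) (hu j),
    covariance_add_right (hF i) (hG j) ((hF j).add (hu j)),
    covariance_add_right (hF i) (hF j) (hu j),
    covariance_add_right (hu i) (hG j) ((hF j).add (hu j)),
    covariance_add_right (hu i) (hF j) (hu j),
    covariance_fun_sum_fun_sum (hG' i) (hG' j), covariance_fun_sum_fun_sum (hG' i) (hF' j),
    covariance_fun_sum_fun_sum (hF' i) (hG' j), covariance_fun_sum_fun_sum (hF' i) (hF' j),
    covariance_fun_sum_left (hG' i) (hu j), covariance_fun_sum_left (hF' i) (hu j),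
    covariance_fun_sum_right (hG' j) (hu i), covariance_fun_sum_right (hF' j) (hu i)]
  simp only [covariance_const_mul_left, covariance_const_mul_right, M.cov_G, M.cov_F, M.cov_u,
    M.cov_G_F, M.cov_G_u, M.cov_F_u, hFG, huG, huF, Matrix.one_apply, Sig, Matrix.add_apply,
    Matrix.mul_apply, Matrix.transpose_apply]
  simp [add_assoc, mul_comm]

end Model

/-! ### The Double-POET estimator -/

/-- `P = ∑_{i ≤ m} δ_i v_i v_i'`, where `δ_1 ≥ δ_2 ≥ …` are the eigenvalues of `A` and
`v_1, v_2, …` are corresponding orthonormal eigenvectors. -/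
def IsPrincipalPart {ι : Type*} [Fintype ι] [DecidableEq ι] (A : Matrix ι ι ℝ) (m : ℕ)
    (P : Matrix ι ι ℝ) : Prop :=
  ∃ (δ : Fin (Fintype.card ι) → ℝ)
    (v : OrthonormalBasis (Fin (Fintype.card ι)) ℝ (EuclideanSpace ℝ ι)),
    Antitone δ ∧ (∀ i, A *ᵥ (v i).ofLp = δ i • (v i).ofLp) ∧
      P = ∑ i ∈ Finset.univ.filter (fun i : Fin (Fintype.card ι) => i.val < m),
        δ i • Matrix.vecMulVec (v i).ofLp (v i).ofLp

/-- A generalized shrinkage rule: `s t` is the shrinkage function with threshold `t ≥ 0`. Its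
values below the threshold do not matter, since the estimator multiplies them by
`I(|z| ≥ t) = 0`. Hard and soft thresholding are examples. -/
def IsShrinkage (s : ℝ → ℝ → ℝ) : Prop :=
  ∀ t z, 0 ≤ t → t ≤ |z| → |s t z| ≤ |z| ∧ |s t z - z| ≤ t

open Classical in
/-- Adaptive thresholding of `A` with entry-dependent thresholds `τ (a_{ii} a_{jj})^{1/2}`. -/
def adaptiveThreshold {ι : Type*} (s : ι → ι → ℝ → ℝ → ℝ) (τ : ℝ) (A : Matrix ι ι ℝ) :
    Matrix ι ι ℝ := fun i j =>
  if i = j then A i j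
  else if τ * √(A i i * A j j) ≤ |A i j| then s i j (τ * √(A i i * A j j)) (A i j) else 0

/-- `D` is the Double-POET estimator computed from the symmetric matrix `S` (the sample covariance
matrix) with `k` global factors and `r j` local factors in group `j`, thresholding constant `τ`
and shrinkage functions `s`: remove the first `k` principal components of `S`, then the first
`r j` principal components of each diagonal block of the remainder, threshold the rest, and add
the three parts. -/
def IsDoublePOET {J : ℕ} {size : Fin J → ℕ} (S : Matrix (Σ j, Fin (size j)) (Σ j, Fin (size j)) ℝ)
    (k : ℕ) (r : Fin J → ℕ)
    (s : (Σ j, Fin (size j)) → (Σ j, Fin (size j)) → ℝ → ℝ → ℝ) (τ : ℝ)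
    (D : Matrix (Σ j, Fin (size j)) (Σ j, Fin (size j)) ℝ) : Prop :=
  ∃ (P : Matrix (Σ j, Fin (size j)) (Σ j, Fin (size j)) ℝ)
    (Q : ∀ j, Matrix (Fin (size j)) (Fin (size j)) ℝ),
    IsPrincipalPart S k P ∧
    (∀ j, IsPrincipalPart ((S - P).blockDiag' j) (r j) (Q j)) ∧
    D = P + Matrix.blockDiagonal' Q +
      adaptiveThreshold s τ (S - P - Matrix.blockDiagonal' Q)

/-! ### Stochastic orders -/

/-- `X_n = O_P(r_n)` on the events `A_n`. -/
def IsBigOPOn {Ω : ℕ → Type*} [∀ n, MeasurableSpace (Ω n)] (μ : ∀ n, Measure (Ω n))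
    (A : ∀ n, Set (Ω n)) (X : ∀ n, Ω n → ℝ) (r : ℕ → ℝ) : Prop :=
  ∀ δ : ℝ, 0 < δ → ∃ C : ℝ, ∀ᶠ n in atTop,
    μ n {x | x ∈ A n ∧ C * r n < X n x} ≤ ENNReal.ofReal δ

/-- `X_n = O_P(r_n)`. -/
def IsBigOP {Ω : ℕ → Type*} [∀ n, MeasurableSpace (Ω n)] (μ : ∀ n, Measure (Ω n))
    (X : ∀ n, Ω n → ℝ) (r : ℕ → ℝ) : Prop :=
  IsBigOPOn μ (fun _ => Set.univ) X r

/-- `f ≍ g` for nonnegative sequences. -/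
def Comparable (f g : ℕ → ℝ) : Prop :=
  ∃ a b : ℝ, 0 < a ∧ 0 < b ∧ ∀ᶠ n in atTop, a * g n ≤ f n ∧ f n ≤ b * g n

/-! ### Assumptions on a sequence of models -/

section Assumptions

variable {Ω : ℕ → Type*} [∀ n, MeasurableSpace (Ω n)] {μ : ∀ n, Measure (Ω n)} {k : ℕ}

/-- The asymptotic regime: `p, T → ∞`, the numbers of local factors are bounded, and
`p_j ≍ p^c` uniformly in the groups. -/
structure Regime (M : ∀ n, Model (μ n) k) (c : ℝ) : Prop where
  p_tendsto : Tendsto (fun n => (M n).p) atTop atTop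
  T_tendsto : Tendsto (fun n => (M n).T) atTop atTop
  rank_le : ∃ R : ℕ, ∀ n j, (M n).rank j ≤ R
  size_comparable : ∃ b₁ b₂ : ℝ, 0 < b₁ ∧ 0 < b₂ ∧ ∀ᶠ n in atTop, ∀ j,
    b₁ * ((M n).p : ℝ) ^ c ≤ ((M n).size j : ℝ) ∧ ((M n).size j : ℝ) ≤ b₂ * ((M n).p : ℝ) ^ c

/-- Pervasiveness of the global and the local factors, and boundedness of the loadings. -/
structure Pervasive (M : ∀ n, Model (μ n) k) (c a₁ a₂ : ℝ) : Prop where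
  global : ∃ b : ℝ, 0 < b ∧ ∀ᶠ n in atTop, ∀ e ∈ spectrum ℝ ((M n).Bᵀ * (M n).B),
    b * ((M n).p : ℝ) ^ a₁ ≤ e
  locals : ∃ b : ℝ, 0 < b ∧ ∀ᶠ n in atTop, ∀ j, ∀ e ∈ spectrum ℝ (((M n).L j)ᵀ * (M n).L j),
    b * ((M n).size j : ℝ) ^ a₂ ≤ e
  separated : a₁ = c * a₂ → ∃ b : ℝ, 0 < b ∧ ∀ᶠ n in atTop,
    ∀ e ∈ spectrum ℝ ((M n).Bᵀ * (M n).B), ∀ e' ∈ spectrum ℝ ((M n).Lamᵀ * (M n).Lam),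
      b ≤ e - e'
  bounded : ∃ d : ℝ, ∀ᶠ n in atTop, (∀ i a, |(M n).B i a| ≤ d) ∧ ∀ i a, |(M n).Lam i a| ≤ d

/-- Conditions on the idiosyncratic covariance matrix: its smallest eigenvalue is bounded away
from zero, its `ℓ₁`-norm is of order `m_p`, and the idiosyncratic variances are bounded. -/
structure Idiosyncratic (M : ∀ n, Model (μ n) k) (q : ℝ) : Prop where
  eigenvalue : ∃ d : ℝ, 0 < d ∧ ∀ᶠ n in atTop, ∀ e ∈ spectrum ℝ (M n).Su, d < e
  l1_norm : ∃ d : ℝ, 0 < d ∧ ∀ᶠ n in atTop, ∀ j, ∑ i, |(M n).Su i j| ≤ d * (M n).m q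
  variance : ∃ d : ℝ, ∀ᶠ n in atTop, ∀ i, (M n).Su i i ≤ d

/-- Group `j_n` carries at least a share of the strength `p^{a₁}` of the global factors that is
proportional to its size: the eigenvalues of `B^j'B^j` are at least of order `(p_j / p) p^{a₁}`. -/
def PervasiveInGroup (M : ∀ n, Model (μ n) k) (a₁ : ℝ) (j : ∀ n, Fin (M n).J) : Prop :=
  ∃ b : ℝ, 0 < b ∧ ∀ᶠ n in atTop,
    ∀ e ∈ spectrum ℝ (((M n).Bgroup (j n))ᵀ * (M n).Bgroup (j n)),
      b * (((M n).size (j n) : ℝ) / (M n).p * ((M n).p : ℝ) ^ a₁) ≤ e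

end Assumptions

end

end DoublePOET

/-!
The argument is deterministic: on the event `‖Σ̂ - Σ‖_max ≤ K √(log p / T)` every error is bounded
by explicit constants times the rates, and the stochastic statements follow by inclusion of
events.

*Principal components.* Let `S = B Bᵀ + R + N + E` with `R B = 0`, `‖R‖` small compared to the
strength `φ` of the factors `B`, `N` sparse and `E` entrywise small. The first `k` principal
components `P` of `S` are compared with `B Bᵀ` without eigenvalue gaps between the factors. A
Weyl-type bound (`weyl_low_rank`) shows that the `k` leading eigenvalues are at least of order
`φ`. Writing `P` through the image of `B` (`nystrom_identity`) gives `P = (B + G) A (B + G)ᵀ`,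
where `A` is close to the identity and `G` is small row by row, both in absolute terms and
relative to the strength of the factors (`principalPart_expansion`). Only the row sums of `|N|`
and the entries of `E` enter, which yields entrywise errors. With `R = Λ Λᵀ` this applies to the
global components; as `c < a₁`, the local factors are of smaller order than the global ones. The
entrywise error of the global step is then the input `E` of the same expansion in each group, with
`R = 0`. All errors are `O(ω)` (`Model.IsRegular.exists_groupExpansion`).

*Thresholding.* As `m_{p_j}` is bounded below, `m_{p_j} ω^{1-q} → 0` forces `ω → 0`. The residual
matrix is then entrywise `O(ω)`-close to `Σ_u`, and adaptive thresholding at a sufficiently large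
multiple of `ω` is `O(m_{p_j} ω^{1-q})`-close in operator norm (`norm_adaptiveThreshold_sub_le`).

*Inverse.* After rescaling the loadings by the square roots of their strengths, an energy estimate
bounds `Y (...)⁻¹` for the stacked loadings `Y`, which makes the contribution of the perturbed
loadings to the error of the inverse harmless (`norm_inv_sub_inv_le_of_two_factors`). This uses
that the global and the local loadings of the group are orthogonal and pervasive in the group.

*Relative Frobenius norm.* Since `‖Σ^{-1/2} B‖ ≤ 1`, an error `B Gᵀ` costs no more than the
Frobenius norm of `G` divided by `√p_j`, which is `O(ω)`, and only the quadratic error `G Gᵀ`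
produces the larger term `√p_j ω²` (`relFrobNorm_le`).
-/

set_option linter.unusedSectionVars false

namespace DoublePOET

/-! ### Operator norms of real matrices -/

section MatrixTools

open scoped Matrix.Norms.L2Operator

variable {m n l : Type*} [Fintype m] [Fintype n] [Fintype l] [DecidableEq m] [DecidableEq n]
  [DecidableEq l]

theorem norm_toLp_sq (x : n → ℝ) : ‖WithLp.toLp 2 x‖ ^ 2 = x ⬝ᵥ x := by
  rw [EuclideanSpace.norm_sq_eq]
  simp [dotProduct, sq]

theorem dotProduct_self_nonneg' (x : n → ℝ) : 0 ≤ x ⬝ᵥ x := by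
  rw [← norm_toLp_sq]; positivity

theorem mulVec_dotProduct_self_le (A : Matrix m n ℝ) (x : n → ℝ) :
    (A *ᵥ x) ⬝ᵥ (A *ᵥ x) ≤ ‖A‖ ^ 2 * (x ⬝ᵥ x) := by
  have h := A.l2_opNorm_mulVec (WithLp.toLp 2 x)
  have h' : ‖WithLp.toLp 2 (A *ᵥ x)‖ ≤ ‖A‖ * ‖WithLp.toLp 2 x‖ := h
  rw [← norm_toLp_sq, ← norm_toLp_sq, ← mul_pow]
  exact pow_le_pow_left₀ (norm_nonneg _) h' 2

theorem norm_le_of_mulVec {A : Matrix m n ℝ} {c : ℝ} (hc : 0 ≤ c)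
    (h : ∀ x, (A *ᵥ x) ⬝ᵥ (A *ᵥ x) ≤ c ^ 2 * (x ⬝ᵥ x)) : ‖A‖ ≤ c := by
  rw [Matrix.l2_opNorm_def]
  refine ContinuousLinearMap.opNorm_le_bound _ hc fun x => ?_
  have h1 := h x.ofLp
  rw [← norm_toLp_sq, ← norm_toLp_sq, ← mul_pow] at h1
  exact (sq_le_sq₀ (norm_nonneg _) (by positivity)).1 h1

theorem abs_dotProduct_le (x y : n → ℝ) : |x ⬝ᵥ y| ≤ √(x ⬝ᵥ x) * √(y ⬝ᵥ y) := by
  rw [← Real.sqrt_mul (dotProduct_self_nonneg' x)]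
  refine Real.abs_le_sqrt ?_
  simpa [dotProduct, sq] using Finset.sum_mul_sq_le_sq_mul_sq Finset.univ x y

theorem abs_dotProduct_mulVec_le (A : Matrix n n ℝ) (x : n → ℝ) :
    |x ⬝ᵥ A *ᵥ x| ≤ ‖A‖ * (x ⬝ᵥ x) := by
  refine (abs_dotProduct_le _ _).trans ?_
  have h : √((A *ᵥ x) ⬝ᵥ (A *ᵥ x)) ≤ ‖A‖ * √(x ⬝ᵥ x) := by
    refine (Real.sqrt_le_sqrt (mulVec_dotProduct_self_le A x)).trans ?_
    rw [Real.sqrt_mul (by positivity), Real.sqrt_sq (norm_nonneg _)]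
  calc _ ≤ √(x ⬝ᵥ x) * (‖A‖ * √(x ⬝ᵥ x)) := by gcongr
    _ = ‖A‖ * (√(x ⬝ᵥ x) * √(x ⬝ᵥ x)) := by ring
    _ = _ := by rw [Real.mul_self_sqrt (dotProduct_self_nonneg' x)]

theorem norm_transpose (A : Matrix m n ℝ) : ‖Aᵀ‖ = ‖A‖ := by
  rw [← Matrix.l2_opNorm_conjTranspose A, Matrix.conjTranspose_eq_transpose_of_trivial]

theorem norm_transpose_mul_self (A : Matrix m n ℝ) : ‖Aᵀ * A‖ = ‖A‖ ^ 2 := by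
  rw [sq, ← Matrix.l2_opNorm_conjTranspose_mul_self A,
    Matrix.conjTranspose_eq_transpose_of_trivial]

theorem norm_one_le : ‖(1 : Matrix n n ℝ)‖ ≤ 1 :=
  norm_le_of_mulVec zero_le_one fun x => by simp

/-- The `i`-th row of a matrix, as a matrix with one row. -/
def row (i : m) (A : Matrix m n ℝ) : Matrix Unit n ℝ := A.submatrix (fun _ => i) id

theorem row_mul (i : m) (A : Matrix m n ℝ) (B : Matrix n l ℝ) : row i (A * B) = row i A * B := rfl

theorem row_add (i : m) (A B : Matrix m n ℝ) : row i (A + B) = row i A + row i B := rfl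

theorem row_sub (i : m) (A B : Matrix m n ℝ) : row i (A - B) = row i A - row i B := rfl

theorem sum_row_mulVec_sq (A : Matrix m n ℝ) (x : n → ℝ) :
    (A *ᵥ x) ⬝ᵥ (A *ᵥ x) = ∑ i, (row i A *ᵥ x) ⬝ᵥ (row i A *ᵥ x) := by
  simp [dotProduct, row, Matrix.mulVec]

theorem norm_le_sqrt_card_mul {A : Matrix m n ℝ} {b : ℝ} (hb : 0 ≤ b)
    (h : ∀ i, ‖row i A‖ ≤ b) : ‖A‖ ≤ √(Fintype.card m) * b := by
  refine norm_le_of_mulVec (by positivity) fun x => ?_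
  rw [sum_row_mulVec_sq, mul_pow, Real.sq_sqrt (by positivity)]
  calc _ ≤ ∑ _i : m, b ^ 2 * (x ⬝ᵥ x) := Finset.sum_le_sum fun i _ => by
        refine (mulVec_dotProduct_self_le _ x).trans ?_
        have := dotProduct_self_nonneg' x
        gcongr
        exact h i
    _ = _ := by simp [mul_assoc]

theorem norm_row_le {A : Matrix m n ℝ} {b : ℝ} (hb : 0 ≤ b) (i : m) (h : ∀ j, |A i j| ≤ b) :
    ‖row i A‖ ≤ √(Fintype.card n) * b := by
  rw [← norm_transpose]
  refine norm_le_sqrt_card_mul hb fun j => norm_le_of_mulVec hb fun x => ?_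
  have h2 : A i j ^ 2 ≤ b ^ 2 := sq_le_sq' (abs_le.1 (h j)).1 (abs_le.1 (h j)).2
  simp only [row, Matrix.mulVec, dotProduct, Matrix.submatrix_apply, Matrix.transpose_apply]
  simp only [Finset.univ_unique, Finset.sum_singleton, id]
  nlinarith [mul_le_mul_of_nonneg_right h2 (mul_self_nonneg (x default))]

theorem abs_apply_le_norm_row (A : Matrix m n ℝ) (i : m) (j : n) : |A i j| ≤ ‖row i A‖ := by
  have h := mulVec_dotProduct_self_le (row i A) (Pi.single j 1)
  simp only [Matrix.mulVec_single_one, dotProduct_single_one] at h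
  simp only [row, dotProduct, Finset.univ_unique, Finset.sum_singleton, Matrix.col_apply,
    Matrix.submatrix_apply, id, Pi.single_eq_same, mul_one] at h
  exact abs_le_of_sq_le_sq (by rw [sq (A i j)]; exact h) (norm_nonneg _)

theorem norm_row_le_norm (A : Matrix m n ℝ) (i : m) : ‖row i A‖ ≤ ‖A‖ := by
  refine norm_le_of_mulVec (norm_nonneg _) fun x => ?_
  refine le_trans ?_ (mulVec_dotProduct_self_le A x)
  rw [sum_row_mulVec_sq A]
  exact Finset.single_le_sum (f := fun i => (row i A *ᵥ x) ⬝ᵥ (row i A *ᵥ x))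
    (fun i _ => dotProduct_self_nonneg' _) (Finset.mem_univ i)

theorem abs_apply_le_norm (A : Matrix m n ℝ) (i : m) (j : n) : |A i j| ≤ ‖A‖ :=
  (abs_apply_le_norm_row A i j).trans (norm_row_le_norm A i)

/-- An entry of `X M Yᵀ` is bounded by the norms of the corresponding rows of `X` and `Y`. -/
theorem abs_mul_mul_transpose_apply_le {κ : Type*} [Fintype κ] [DecidableEq κ]
    (X : Matrix m κ ℝ) (M : Matrix κ κ ℝ) (Y : Matrix n κ ℝ) (i : m) (j : n) :
    |(X * M * Yᵀ) i j| ≤ ‖row i X‖ * ‖M‖ * ‖row j Y‖ := by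
  have h : (X * M * Yᵀ) i j = (row i X * M * (row j Y)ᵀ) () () := rfl
  rw [h]
  refine (abs_apply_le_norm _ _ _).trans ?_
  refine (Matrix.l2_opNorm_mul _ _).trans ?_
  rw [norm_transpose]
  gcongr
  exact Matrix.l2_opNorm_mul _ _

/-- Schur's test. -/
theorem norm_le_of_sum_abs_le {A : Matrix n n ℝ} {s : ℝ} (hs : 0 ≤ s)
    (hr : ∀ i, ∑ j, |A i j| ≤ s) (hc : ∀ j, ∑ i, |A i j| ≤ s) : ‖A‖ ≤ s := by
  refine norm_le_of_mulVec hs fun x => ?_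
  have h1 : ∀ i, (A *ᵥ x) i ^ 2 ≤ s * ∑ j, |A i j| * x j ^ 2 := fun i => by
    have h2 := Finset.sum_mul_sq_le_sq_mul_sq Finset.univ (fun j => √|A i j|)
      (fun j => √|A i j| * |x j|)
    have h3 : (A *ᵥ x) i ^ 2 ≤ (∑ j, √|A i j| * (√|A i j| * |x j|)) ^ 2 := by
      rw [← sq_abs]
      refine pow_le_pow_left₀ (abs_nonneg _) ?_ 2
      refine (Finset.abs_sum_le_sum_abs _ _).trans (le_of_eq (Finset.sum_congr rfl fun j _ => ?_))
      rw [← mul_assoc, Real.mul_self_sqrt (abs_nonneg _), abs_mul]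
    refine h3.trans (h2.trans ?_)
    simp only [mul_pow, Real.sq_sqrt (abs_nonneg _), sq_abs]
    exact mul_le_mul_of_nonneg_right (hr i)
      (Finset.sum_nonneg fun j _ => mul_nonneg (abs_nonneg _) (sq_nonneg _))
  calc (A *ᵥ x) ⬝ᵥ (A *ᵥ x) = ∑ i, (A *ᵥ x) i ^ 2 := by simp [dotProduct, sq]
    _ ≤ ∑ i, s * ∑ j, |A i j| * x j ^ 2 := Finset.sum_le_sum fun i _ => h1 i
    _ = s * ∑ j, (∑ i, |A i j|) * x j ^ 2 := by
        rw [← Finset.mul_sum, Finset.sum_comm]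
        simp only [Finset.sum_mul]
    _ ≤ s * ∑ j, s * x j ^ 2 := by
        gcongr with j
        exact hc j
    _ = s ^ 2 * (x ⬝ᵥ x) := by
        rw [← Finset.mul_sum]
        simp only [dotProduct, ← sq]
        ring

theorem norm_row_mul_le_of_sum_abs_le {N : Matrix m n ℝ} {Y : Matrix n l ℝ} {s b : ℝ}
    (hb : 0 ≤ b) (i : m) (hN : ∑ j, |N i j| ≤ s) (hY : ∀ j, ‖row j Y‖ ≤ b) :
    ‖row i (N * Y)‖ ≤ s * b := by
  have h : row i (N * Y) = ∑ j, N i j • row j Y := by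
    ext a c
    simp [row, Matrix.mul_apply, Matrix.sum_apply]
  rw [h]
  calc _ ≤ ∑ j, ‖N i j • row j Y‖ := norm_sum_le _ _
    _ ≤ ∑ j, |N i j| * b := Finset.sum_le_sum fun j _ => by
        rw [norm_smul, Real.norm_eq_abs]
        exact mul_le_mul_of_nonneg_left (hY j) (abs_nonneg _)
    _ ≤ s * b := by
        rw [← Finset.sum_mul]
        exact mul_le_mul_of_nonneg_right hN hb

theorem dotProduct_transpose_mul_self_mulVec (F : Matrix m n ℝ) (x : n → ℝ) :
    x ⬝ᵥ (Fᵀ * F) *ᵥ x = (F *ᵥ x) ⬝ᵥ (F *ᵥ x) := by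
  rw [← Matrix.mulVec_mulVec, Matrix.dotProduct_mulVec, Matrix.vecMul_transpose]

/-- Coercivity bounds for the inverse of a matrix that need not be symmetric. -/
theorem inv_bounds_of_coercive {X : Matrix n n ℝ} {F : Matrix n l ℝ} {a h : ℝ} (ha : 0 < a)
    (hh : 0 < h)
    (hX : ∀ x, a * (x ⬝ᵥ x) + h * ((Fᵀ *ᵥ x) ⬝ᵥ (Fᵀ *ᵥ x)) ≤ x ⬝ᵥ X *ᵥ x) :
    IsUnit X.det ∧ ‖X⁻¹‖ ≤ a⁻¹ ∧ ‖Fᵀ * X⁻¹‖ ≤ (√(a * h))⁻¹ := by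
  have hdet : IsUnit X.det := by
    rw [isUnit_iff_ne_zero]
    intro h0
    obtain ⟨v, hv, hv0⟩ := Matrix.exists_mulVec_eq_zero_iff.2 h0
    have h1 := hX v
    rw [hv0, dotProduct_zero] at h1
    have h2 := dotProduct_self_nonneg' (Fᵀ *ᵥ v)
    have h3 : 0 < v ⬝ᵥ v := lt_of_le_of_ne (dotProduct_self_nonneg' v)
      fun h => hv (dotProduct_self_eq_zero.1 h.symm)
    nlinarith [mul_pos ha h3, mul_nonneg hh.le h2]
  have key : ∀ z : n → ℝ, (X⁻¹ *ᵥ z) ⬝ᵥ (X⁻¹ *ᵥ z) ≤ a⁻¹ ^ 2 * (z ⬝ᵥ z) ∧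
      ((Fᵀ * X⁻¹) *ᵥ z) ⬝ᵥ ((Fᵀ * X⁻¹) *ᵥ z) ≤ ((√(a * h))⁻¹) ^ 2 * (z ⬝ᵥ z) := fun z => by
    have h1 := hX (X⁻¹ *ᵥ z)
    rw [Matrix.mulVec_mulVec _ X, Matrix.mul_nonsing_inv _ hdet, Matrix.one_mulVec,
      Matrix.mulVec_mulVec] at h1
    set x := X⁻¹ *ᵥ z
    set f := ((Fᵀ * X⁻¹) *ᵥ z) ⬝ᵥ ((Fᵀ * X⁻¹) *ᵥ z)
    have hf : 0 ≤ f := dotProduct_self_nonneg' _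
    have hx := dotProduct_self_nonneg' x
    have hz := dotProduct_self_nonneg' z
    -- Young's inequality `2 x·z ≤ a |x|² + |z|² / a`
    have h2 : 2 * (x ⬝ᵥ z) ≤ a * (x ⬝ᵥ x) + a⁻¹ * (z ⬝ᵥ z) := by
      have h3 := dotProduct_self_nonneg' (a • x - z)
      simp only [sub_dotProduct, dotProduct_sub, smul_dotProduct, dotProduct_smul,
        smul_eq_mul, dotProduct_comm z x] at h3
      have h4 : 0 ≤ a⁻¹ * (a * (a * (x ⬝ᵥ x)) - a * (x ⬝ᵥ z) - (a * (x ⬝ᵥ z) - z ⬝ᵥ z)) :=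
        mul_nonneg (by positivity) (by linarith)
      have h5 : a⁻¹ * (a * (a * (x ⬝ᵥ x)) - a * (x ⬝ᵥ z) - (a * (x ⬝ᵥ z) - z ⬝ᵥ z)) =
        a * (x ⬝ᵥ x) - 2 * (x ⬝ᵥ z) + a⁻¹ * (z ⬝ᵥ z) := by field_simp; ring
      linarith
    constructor
    · have h6 : a * (x ⬝ᵥ x) ≤ a⁻¹ * (z ⬝ᵥ z) := by nlinarith [mul_nonneg hh.le hf]
      calc x ⬝ᵥ x = a⁻¹ * (a * (x ⬝ᵥ x)) := by field_simp
        _ ≤ a⁻¹ * (a⁻¹ * (z ⬝ᵥ z)) := by gcongr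
        _ = _ := by ring
    · have h6 : h * f ≤ a⁻¹ * (z ⬝ᵥ z) := by nlinarith [mul_nonneg ha.le hx]
      rw [inv_pow, Real.sq_sqrt (by positivity)]
      calc f = h⁻¹ * (h * f) := by field_simp
        _ ≤ h⁻¹ * (a⁻¹ * (z ⬝ᵥ z)) := by gcongr
        _ = _ := by rw [mul_inv]; ring
  exact ⟨hdet, norm_le_of_mulVec (by positivity) fun z => (key z).1,
    norm_le_of_mulVec (by positivity) fun z => (key z).2⟩

theorem inv_norm_le_of_coercive {X : Matrix n n ℝ} {a : ℝ} (ha : 0 < a)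
    (hX : ∀ x, a * (x ⬝ᵥ x) ≤ x ⬝ᵥ X *ᵥ x) : IsUnit X.det ∧ ‖X⁻¹‖ ≤ a⁻¹ := by
  have h := inv_bounds_of_coercive (F := (0 : Matrix n n ℝ)) ha one_pos (X := X)
    (fun x => by simpa using hX x)
  exact ⟨h.1, h.2.1⟩

theorem isUnit_det_one_add {A : Matrix n n ℝ} (hA : ‖A‖ ≤ 1 / 2) :
    IsUnit (1 + A).det ∧ ‖(1 + A)⁻¹‖ ≤ 2 ∧ ‖(1 + A)⁻¹ - 1‖ ≤ 2 * ‖A‖ := by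
  have h := inv_norm_le_of_coercive (X := 1 + A) (a := 1 / 2) (by norm_num) fun x => by
    rw [Matrix.add_mulVec, Matrix.one_mulVec, dotProduct_add]
    have h1 := (abs_le.1 (abs_dotProduct_mulVec_le A x)).1
    nlinarith [mul_le_mul_of_nonneg_right hA (dotProduct_self_nonneg' x)]
  have h2 : ‖(1 + A)⁻¹‖ ≤ 2 := h.2.trans (by norm_num)
  refine ⟨h.1, h2, ?_⟩
  have h3 : (1 + A)⁻¹ - 1 = -((1 + A)⁻¹ * A) := by
    have := Matrix.nonsing_inv_mul _ h.1
    rw [mul_add, mul_one] at this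
    rw [sub_eq_iff_eq_add, neg_add_eq_sub]
    exact eq_sub_of_add_eq this
  rw [h3, norm_neg]
  exact (Matrix.l2_opNorm_mul _ _).trans (by gcongr)

/-- A matrix `B` with `BᵀB ≥ φ` has a left inverse `(BᵀB)⁻¹Bᵀ` of norm at most `φ ^ (-1/2)`. -/
theorem gram_inv_bounds {B : Matrix m n ℝ} {φ : ℝ} (hφ : 0 < φ)
    (hB : ∀ x, φ * (x ⬝ᵥ x) ≤ (B *ᵥ x) ⬝ᵥ (B *ᵥ x)) :
    IsUnit (Bᵀ * B).det ∧ ‖(Bᵀ * B)⁻¹‖ ≤ φ⁻¹ ∧ ‖B * (Bᵀ * B)⁻¹‖ ≤ (√φ)⁻¹ := by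
  have h := inv_norm_le_of_coercive hφ (X := Bᵀ * B) fun x => by
    rw [dotProduct_transpose_mul_self_mulVec]; exact hB x
  refine ⟨h.1, h.2, ?_⟩
  have h1 : (B * (Bᵀ * B)⁻¹)ᵀ * (B * (Bᵀ * B)⁻¹) = (Bᵀ * B)⁻¹ := by
    rw [Matrix.transpose_mul, Matrix.transpose_nonsing_inv, Matrix.transpose_mul,
      Matrix.transpose_transpose, Matrix.mul_assoc, ← Matrix.mul_assoc Bᵀ,
      Matrix.mul_nonsing_inv _ h.1, Matrix.mul_one]
  refine abs_le_of_sq_le_sq' ?_ (by positivity) |>.2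
  rw [← norm_transpose_mul_self, h1, inv_pow, Real.sq_sqrt hφ.le]
  exact h.2

/-- Spectral lower bounds are lower bounds of the quadratic form. -/
theorem le_dotProduct_mulVec_of_spectrum {A : Matrix n n ℝ} (hA : A.IsSymm) {φ : ℝ}
    (h : ∀ e ∈ spectrum ℝ A, φ ≤ e) (x : n → ℝ) : φ * (x ⬝ᵥ x) ≤ x ⬝ᵥ A *ᵥ x := by
  have hH : (A - φ • (1 : Matrix n n ℝ)).IsHermitian := by
    rw [Matrix.IsHermitian, Matrix.conjTranspose_eq_transpose_of_trivial]
    simp [hA.eq]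
  have hP : (A - φ • (1 : Matrix n n ℝ)).PosSemidef := by
    rw [Matrix.posSemidef_iff_isHermitian_and_spectrum_nonneg]
    refine ⟨hH, fun e he => ?_⟩
    have h1 : e + φ ∈ spectrum ℝ A := by
      have h2 := spectrum.sub_singleton_eq A φ
      have h3 : algebraMap ℝ (Matrix n n ℝ) φ = φ • 1 := Algebra.algebraMap_eq_smul_one φ
      rw [h3] at h2
      rw [← h2] at he
      obtain ⟨a, ha, b, hb, hab⟩ := Set.mem_sub.1 he
      rw [Set.mem_singleton_iff] at hb
      have : e + φ = a := by linarith
      rwa [this]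
    have := h _ h1
    simp only [Set.mem_ofPred_eq]
    linarith
  have h4 := hP.dotProduct_mulVec_nonneg x
  simp only [star_trivial, Matrix.sub_mulVec, Matrix.smul_mulVec, Matrix.one_mulVec,
    dotProduct_sub, dotProduct_smul, smul_eq_mul] at h4
  linarith

end MatrixTools

/-! ### Principal components of a perturbed low-rank matrix -/

section Principal

open scoped Matrix.Norms.L2Operator

variable {ι : Type*} [Fintype ι] [DecidableEq ι]

theorem exists_ne_zero_mulVec_eq_zero {m n : Type*} [Fintype m] [Fintype n]
    (A : Matrix m n ℝ) (h : Fintype.card m < Fintype.card n) : ∃ c : n → ℝ, c ≠ 0 ∧ A *ᵥ c = 0 := by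
  have h1 : LinearMap.ker A.mulVecLin ≠ ⊥ := LinearMap.ker_ne_bot_of_finrank_lt (by simpa using h)
  obtain ⟨c, hc, hc0⟩ := (Submodule.ne_bot_iff _).1 h1
  exact ⟨c, hc0, hc⟩

theorem dotProduct_self_pos {n : Type*} [Fintype n] [DecidableEq n] {c : n → ℝ} (hc : c ≠ 0) :
    0 < c ⬝ᵥ c :=
  lt_of_le_of_ne (dotProduct_self_nonneg' c) fun h => hc (dotProduct_self_eq_zero.1 h.symm)

theorem dotProduct_diagonal_mulVec {n : Type*} [Fintype n] [DecidableEq n] (f c : n → ℝ) :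
    c ⬝ᵥ Matrix.diagonal f *ᵥ c = ∑ a, f a * c a ^ 2 := by
  simp only [dotProduct, Matrix.mulVec_diagonal]
  exact Finset.sum_congr rfl fun a _ => by ring

/-- Weyl's inequalities for the eigenvalues of `B Bᵀ + X`: the first `k` are at least `φ - ‖X‖`,
the others at most `‖X‖` in absolute value. -/
theorem weyl_low_rank {k N : ℕ} {S X : Matrix ι ι ℝ} {B : Matrix ι (Fin k) ℝ}
    {V : Matrix ι (Fin N) ℝ} {δ : Fin N → ℝ} {φ x : ℝ} (hφ : 0 < φ)
    (hB : ∀ c, φ * (c ⬝ᵥ c) ≤ (B *ᵥ c) ⬝ᵥ (B *ᵥ c))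
    (hS : S = B * Bᵀ + X) (hX : ‖X‖ ≤ x) (hδ : Antitone δ) (hV : Vᵀ * V = 1) (hV' : V * Vᵀ = 1)
    (hSV : S = V * Matrix.diagonal δ * Vᵀ) :
    (∀ i : Fin N, i.val < k → φ - x ≤ δ i) ∧ ∀ i : Fin N, k ≤ i.val → |δ i| ≤ x := by
  have hquad : ∀ z : ι → ℝ, z ⬝ᵥ S *ᵥ z = (Bᵀ *ᵥ z) ⬝ᵥ (Bᵀ *ᵥ z) + z ⬝ᵥ X *ᵥ z := fun z => by
    have h := dotProduct_transpose_mul_self_mulVec Bᵀ z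
    rw [Matrix.transpose_transpose] at h
    rw [hS, Matrix.add_mulVec, dotProduct_add, h]
  have hquad' : ∀ z : ι → ℝ, z ⬝ᵥ S *ᵥ z = ∑ a, δ a * (Vᵀ *ᵥ z) a ^ 2 := fun z => by
    rw [hSV, ← dotProduct_diagonal_mulVec, ← Matrix.mulVec_mulVec, ← Matrix.mulVec_mulVec,
      Matrix.dotProduct_mulVec z V, ← Matrix.mulVec_transpose]
  have hiso : ∀ z : ι → ℝ, z ⬝ᵥ z = ∑ a, (Vᵀ *ᵥ z) a ^ 2 := fun z => by
    have h := dotProduct_transpose_mul_self_mulVec Vᵀ z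
    rw [Matrix.transpose_transpose, hV', Matrix.one_mulVec] at h
    rw [h]; simp [dotProduct, sq]
  have hXz : ∀ z : ι → ℝ, |z ⬝ᵥ X *ᵥ z| ≤ x * (z ⬝ᵥ z) := fun z =>
    (abs_dotProduct_mulVec_le X z).trans
      (mul_le_mul_of_nonneg_right hX (dotProduct_self_nonneg' z))
  refine ⟨fun i hi => ?_, fun i hi => abs_le.2 ⟨?_, ?_⟩⟩
  · -- a vector in the range of `B` that is orthogonal to the first `i` eigenvectors
    obtain ⟨c, hc, hc0⟩ := exists_ne_zero_mulVec_eq_zero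
      ((V.submatrix id (Fin.castLE i.2.le))ᵀ * B) (by simpa using hi)
    rw [← Matrix.mulVec_mulVec] at hc0
    set z := B *ᵥ c with hz
    have hzpos : 0 < z ⬝ᵥ z := (mul_pos hφ (dotProduct_self_pos hc)).trans_le (hB c)
    have hw : ∀ a : Fin N, a < i → (Vᵀ *ᵥ z) a = 0 := fun a ha => by
      have := congrFun hc0 ⟨a.val, ha⟩
      simpa [Matrix.mulVec, dotProduct] using this
    have h1 : z ⬝ᵥ S *ᵥ z ≤ δ i * (z ⬝ᵥ z) := by
      rw [hquad', hiso, Finset.mul_sum]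
      refine Finset.sum_le_sum fun a _ => ?_
      rcases lt_or_ge a i with h | h
      · simp [hw a h]
      · exact mul_le_mul_of_nonneg_right (hδ h) (sq_nonneg _)
    have h2 : φ * (z ⬝ᵥ z) ≤ (Bᵀ *ᵥ z) ⬝ᵥ (Bᵀ *ᵥ z) := by
      have h3 : z ⬝ᵥ z = c ⬝ᵥ Bᵀ *ᵥ z := by
        rw [Matrix.dotProduct_mulVec c, Matrix.vecMul_transpose]
      have h4 : (z ⬝ᵥ z) ^ 2 ≤ (c ⬝ᵥ c) * ((Bᵀ *ᵥ z) ⬝ᵥ (Bᵀ *ᵥ z)) := by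
        rw [h3, ← sq_abs]
        refine (pow_le_pow_left₀ (abs_nonneg _) (abs_dotProduct_le _ _) 2).trans ?_
        rw [mul_pow, Real.sq_sqrt (dotProduct_self_nonneg' _),
          Real.sq_sqrt (dotProduct_self_nonneg' _)]
      have h5 := mul_le_mul_of_nonneg_right (hB c) (dotProduct_self_nonneg' (Bᵀ *ᵥ z))
      rw [← hz] at h5
      have h6 : φ * (z ⬝ᵥ z) * (z ⬝ᵥ z) ≤ ((Bᵀ *ᵥ z) ⬝ᵥ (Bᵀ *ᵥ z)) * (z ⬝ᵥ z) := by
        nlinarith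
      exact le_of_mul_le_mul_right h6 hzpos
    have h7 := (abs_le.1 (hXz z)).1
    have h8 := hquad z
    exact le_of_mul_le_mul_right (by linarith) hzpos
  · have h1 := hquad' (V.col i)
    have h2 : Vᵀ *ᵥ V.col i = Pi.single i 1 := by
      rw [← Matrix.mulVec_single_one, Matrix.mulVec_mulVec, hV, Matrix.one_mulVec]
    have h3 := hiso (V.col i)
    rw [h2] at h1 h3
    simp only [Pi.single_apply, ite_pow, one_pow, ne_eq, OfNat.ofNat_ne_zero, not_false_eq_true,
      zero_pow, mul_ite, mul_one, mul_zero, Finset.sum_ite_eq', Finset.mem_univ, if_true] at h1 h3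
    have h4 := (abs_le.1 (hXz (V.col i))).1
    have h5 := hquad (V.col i)
    have h6 := dotProduct_self_nonneg' (Bᵀ *ᵥ V.col i)
    rw [h3] at h4
    linarith
  · -- a combination of the first `k + 1` eigenvectors in the kernel of `Bᵀ`
    have hk : k + 1 ≤ N := by omega
    set V₁ := V.submatrix id (Fin.castLE hk) with hV₁
    obtain ⟨c, hc, hc0⟩ := exists_ne_zero_mulVec_eq_zero (Bᵀ * V₁) (by simp)
    rw [← Matrix.mulVec_mulVec] at hc0
    have h1 : Vᵀ * V₁ = (1 : Matrix (Fin N) (Fin N) ℝ).submatrix id (Fin.castLE hk) := by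
      rw [← hV]; rfl
    have h2 : V₁ᵀ * V₁ = 1 := by
      have : V₁ᵀ * V₁ = (Vᵀ * V).submatrix (Fin.castLE hk) (Fin.castLE hk) := rfl
      rw [this, hV, Matrix.submatrix_one _ (Fin.castLE_injective hk)]
    have h3 : (V₁ *ᵥ c) ⬝ᵥ (V₁ *ᵥ c) = c ⬝ᵥ c := by
      rw [← dotProduct_transpose_mul_self_mulVec, h2, Matrix.one_mulVec]
    have hS1 : V₁ᵀ * S * V₁ = Matrix.diagonal (δ ∘ Fin.castLE hk) := by
      have h4 : V₁ᵀ * S * V₁ = (Vᵀ * S * V).submatrix (Fin.castLE hk) (Fin.castLE hk) := rfl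
      have h5 : Vᵀ * S * V = Matrix.diagonal δ := by
        rw [hSV, ← Matrix.mul_assoc, ← Matrix.mul_assoc, hV, Matrix.one_mul, Matrix.mul_assoc, hV,
          Matrix.mul_one]
      rw [h4, h5, Matrix.submatrix_diagonal _ _ (Fin.castLE_injective hk)]
    have h6 : (V₁ *ᵥ c) ⬝ᵥ S *ᵥ (V₁ *ᵥ c) = ∑ a, δ (Fin.castLE hk a) * c a ^ 2 := by
      have := dotProduct_diagonal_mulVec (δ ∘ Fin.castLE hk) c
      rw [← hS1, ← Matrix.mulVec_mulVec, ← Matrix.mulVec_mulVec, Matrix.dotProduct_mulVec,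
        Matrix.vecMul_transpose] at this
      exact this
    have h7 : δ i * (c ⬝ᵥ c) ≤ (V₁ *ᵥ c) ⬝ᵥ S *ᵥ (V₁ *ᵥ c) := by
      rw [h6, dotProduct, Finset.mul_sum]
      refine Finset.sum_le_sum fun a _ => ?_
      rw [← sq]
      refine mul_le_mul_of_nonneg_right (hδ ?_) (sq_nonneg _)
      rw [Fin.le_def]
      simp only [Fin.val_castLE]
      omega
    have h8 := hquad (V₁ *ᵥ c)
    rw [hc0, dotProduct_zero, zero_add] at h8
    have h9 := (abs_le.1 (hXz (V₁ *ᵥ c))).2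
    rw [h3] at h9
    exact le_of_mul_le_mul_right (by linarith) (dotProduct_self_pos hc)

/-- The principal part of a perturbation `B Bᵀ + X` of a matrix of rank `k`, in terms of the matrix
`U` of the first `k` eigenvectors. -/
theorem IsPrincipalPart.exists_factor {k : ℕ} {S X P : Matrix ι ι ℝ} {B : Matrix ι (Fin k) ℝ}
    {φ x : ℝ} (hP : IsPrincipalPart S k P) (hφ : 0 < φ)
    (hB : ∀ c, φ * (c ⬝ᵥ c) ≤ (B *ᵥ c) ⬝ᵥ (B *ᵥ c))
    (hS : S = B * Bᵀ + X) (hX : ‖X‖ ≤ x) :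
    ∃ (U : Matrix ι (Fin k) ℝ) (D : Fin k → ℝ), Uᵀ * U = 1 ∧
      P = U * Matrix.diagonal D * Uᵀ ∧ S * U = U * Matrix.diagonal D ∧
      (∀ i, φ - x ≤ D i) ∧ ‖S * (1 - U * Uᵀ)‖ ≤ x ∧ S.IsSymm := by
  have hx : 0 ≤ x := (norm_nonneg _).trans hX
  have hk : k ≤ Fintype.card ι := by
    by_contra hlt
    obtain ⟨c, hc, hc0⟩ := exists_ne_zero_mulVec_eq_zero B (by simpa using hlt)
    have h1 := hB c
    rw [hc0, dotProduct_zero] at h1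
    nlinarith [dotProduct_self_pos hc]
  rw [IsPrincipalPart] at hP
  generalize hN : Fintype.card ι = N at hP hk
  obtain ⟨δ, v, hδ, hev, hPe⟩ := hP
  set V : Matrix ι (Fin N) ℝ := Matrix.of fun i a => v a i with hVdef
  have hVa : ∀ i a, V i a = v a i := fun _ _ => rfl
  have hV : Vᵀ * V = 1 := by
    ext a b
    have h := orthonormal_iff_ite.1 v.orthonormal a b
    rw [PiLp.inner_apply] at h
    simp only [RCLike.inner_apply, conj_trivial] at h
    rw [Matrix.mul_apply, Matrix.one_apply, ← h]
    exact Finset.sum_congr rfl fun i _ => by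
      rw [Matrix.transpose_apply, hVa, hVa, mul_comm]
  have hV' : V * Vᵀ = 1 := (Matrix.mul_eq_one_comm_of_card_eq _ _ _ (by simp [hN])).1 hV
  have hSV' : S * V = V * Matrix.diagonal δ := by
    ext i a
    have h := congrFun (hev a) i
    rw [Matrix.mul_diagonal]
    simpa [Matrix.mul_apply, Matrix.mulVec, dotProduct, hVa, mul_comm] using h
  have hSV : S = V * Matrix.diagonal δ * Vᵀ := by
    rw [← hSV', Matrix.mul_assoc, hV', Matrix.mul_one]
  obtain ⟨hw1, hw2⟩ := weyl_low_rank hφ hB hS hX hδ hV hV' hSV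
  set U := V.submatrix id (Fin.castLE hk) with hU
  have hUf : ∀ f : Fin N → ℝ, U * Matrix.diagonal (f ∘ Fin.castLE hk) * Uᵀ =
      ∑ i ∈ Finset.univ.filter (fun i : Fin N => i.val < k),
        f i • Matrix.vecMulVec (v i).ofLp (v i).ofLp := fun f => by
    ext i l
    rw [Matrix.sum_apply, Matrix.mul_apply]
    refine Finset.sum_bij (fun a _ => Fin.castLE hk a) (fun a _ => by simp)
      (fun a _ b _ h => Fin.castLE_injective hk h)
      (fun a ha => ⟨⟨a.val, (Finset.mem_filter.1 ha).2⟩, Finset.mem_univ _, rfl⟩) fun a _ => ?_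
    rw [Matrix.mul_diagonal]
    simp only [hU, Matrix.submatrix_apply, id, Function.comp, Matrix.transpose_apply,
      Matrix.smul_apply, Matrix.vecMulVec_apply, smul_eq_mul, hVa]
    ring
  have hVf : ∀ f : Fin N → ℝ,
      V * Matrix.diagonal (fun a : Fin N => if a.val < k then f a else 0) * Vᵀ =
      U * Matrix.diagonal (f ∘ Fin.castLE hk) * Uᵀ := fun f => by
    rw [hUf]
    ext i l
    rw [Matrix.sum_apply, Matrix.mul_apply, Finset.sum_filter]
    refine Finset.sum_congr rfl fun a _ => ?_
    rw [Matrix.mul_diagonal]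
    split_ifs
    · simp only [hVa, Matrix.transpose_apply, Matrix.smul_apply, Matrix.vecMulVec_apply,
        smul_eq_mul]
      ring
    · simp
  refine ⟨U, δ ∘ Fin.castLE hk, ?_, ?_, ?_, fun i => hw1 _ i.2, ?_, ?_⟩
  · have : Uᵀ * U = (Vᵀ * V).submatrix (Fin.castLE hk) (Fin.castLE hk) := rfl
    rw [this, hV, Matrix.submatrix_one _ (Fin.castLE_injective hk)]
  · rw [hPe, hUf]
  · have : S * U = (S * V).submatrix id (Fin.castLE hk) := rfl
    rw [this, hSV']
    ext i a
    simp [Matrix.mul_diagonal, hU]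
  · have h1 : U * Uᵀ =
        V * Matrix.diagonal (fun a : Fin N => if a.val < k then (1 : ℝ) else 0) * Vᵀ := by
      rw [hVf (fun _ => 1)]
      have : ((fun _ => 1 : Fin N → ℝ) ∘ Fin.castLE hk) = 1 := rfl
      rw [this, Pi.one_def, Matrix.diagonal_one, Matrix.mul_one]
    have h2 : S * (1 - U * Uᵀ) =
        V * Matrix.diagonal (fun a : Fin N => if a.val < k then 0 else δ a) * Vᵀ := by
      rw [Matrix.mul_sub, Matrix.mul_one, h1, ← Matrix.mul_assoc, ← Matrix.mul_assoc, hSV',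
        Matrix.mul_assoc V, Matrix.diagonal_mul_diagonal]
      nth_rewrite 1 [hSV]
      rw [← Matrix.sub_mul, ← Matrix.mul_sub, Matrix.diagonal_sub]
      congr 3
      ext a
      split_ifs <;> simp
    rw [h2]
    have hVn : ‖V‖ ≤ 1 := norm_le_of_mulVec zero_le_one fun c => by
      rw [← dotProduct_transpose_mul_self_mulVec, hV]; simp
    have hd : ‖Matrix.diagonal (fun a : Fin N => if a.val < k then 0 else δ a)‖ ≤ x := by
      rw [Matrix.l2_opNorm_diagonal]
      refine (pi_norm_le_iff_of_nonneg hx).2 fun a => ?_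
      split_ifs with h
      · simpa using hx
      · exact hw2 a (not_lt.1 h)
    calc _ ≤ ‖V‖ * ‖Matrix.diagonal (fun a : Fin N => if a.val < k then 0 else δ a)‖ * ‖Vᵀ‖ := by
          refine (Matrix.l2_opNorm_mul _ _).trans ?_
          gcongr
          exact Matrix.l2_opNorm_mul _ _
      _ ≤ 1 * x * 1 := by
          rw [norm_transpose]
          gcongr
      _ = x := by ring
  · rw [Matrix.IsSymm, hSV]
    simp [Matrix.transpose_mul, Matrix.mul_assoc]

theorem norm_le_one_of_isIdempotent {Q : Matrix ι ι ℝ} (h : Qᵀ * Q = Q) : ‖Q‖ ≤ 1 := by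
  have h1 := norm_transpose_mul_self Q
  rw [h] at h1
  by_contra hlt
  push Not at hlt
  nlinarith

/-- Nyström's identity: a symmetric matrix `P` of rank at most `k` is recovered from its action on
the columns of `W`, if `Wᵀ P W` is an invertible `k × k` matrix. -/
theorem nystrom_identity {k : ℕ} {U W : Matrix ι (Fin k) ℝ} {D : Fin k → ℝ} {P : Matrix ι ι ℝ}
    (hP : P = U * Matrix.diagonal D * Uᵀ) (hdet : IsUnit (Wᵀ * (P * W)).det) :
    P = P * W * (Wᵀ * (P * W))⁻¹ * (P * W)ᵀ := by
  obtain ⟨Z, hZ⟩ : ∃ Z, Z = Uᵀ * W := ⟨_, rfl⟩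
  have h1 : P * W = U * Matrix.diagonal D * Z := by rw [hP, hZ, Matrix.mul_assoc]
  have h2 : Wᵀ * (P * W) = Zᵀ * (Matrix.diagonal D * Z) := by
    rw [h1, hZ, Matrix.transpose_mul, Matrix.transpose_transpose]
    simp only [Matrix.mul_assoc]
  rw [h2, Matrix.det_mul, Matrix.det_mul, Matrix.det_transpose] at hdet
  have hZu : IsUnit Z.det := isUnit_of_mul_isUnit_left hdet
  have hDu : IsUnit (Matrix.diagonal D).det :=
    isUnit_of_mul_isUnit_left (isUnit_of_mul_isUnit_right hdet)
  have hZu' : IsUnit Zᵀ.det := by rwa [Matrix.det_transpose]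
  rw [h2, h1, Matrix.mul_inv_rev, Matrix.mul_inv_rev, Matrix.transpose_mul, Matrix.transpose_mul,
    Matrix.diagonal_transpose]
  calc P = U * (Matrix.diagonal D * (Z * Z⁻¹)) * ((Matrix.diagonal D)⁻¹ * ((Zᵀ⁻¹ * Zᵀ) *
        (Matrix.diagonal D * Uᵀ))) := by
        rw [Matrix.mul_nonsing_inv _ hZu, Matrix.nonsing_inv_mul _ hZu', Matrix.mul_one,
          Matrix.one_mul, ← Matrix.mul_assoc _ (Matrix.diagonal D), Matrix.nonsing_inv_mul _ hDu,
          Matrix.one_mul, hP]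
    _ = _ := by simp only [Matrix.mul_assoc]

/-- If `S = B Bᵀ + R + N + E`, where `R` is orthogonal to the range of `B` and dominated by
`Bᵀ B ≥ φ`, `N` is sparse and `E` is entrywise small, then the principal part of rank `k` of `S` is
`(B + G) M (B + G)ᵀ` with `M` close to the identity, and with every row of `G` small. No gap between
the eigenvalues of `Bᵀ B` is needed. -/
theorem principalPart_expansion {k : ℕ} {S R N E P : Matrix ι ι ℝ} {B : Matrix ι (Fin k) ℝ}
    {φ d e m : ℝ} (hP : IsPrincipalPart S k P) (hφ : 0 < φ) (hd : 1 ≤ d) (he : 0 ≤ e) (hm : 0 ≤ m)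
    (hB : ∀ c, φ * (c ⬝ᵥ c) ≤ (B *ᵥ c) ⬝ᵥ (B *ᵥ c))
    (hS : S = B * Bᵀ + R + N + E) (hRB : R * B = 0) (hR : ‖R‖ ≤ φ / 8)
    (hSd : ∀ i j, |S i j| ≤ d) (hAd : ∀ i j, |(B * Bᵀ + R) i j| ≤ d) (hE : ∀ i j, |E i j| ≤ e)
    (hNr : ∀ i, ∑ j, |N i j| ≤ m) (hNc : ∀ j, ∑ i, |N i j| ≤ m)
    (hφd : φ ≤ d * Fintype.card ι)
    (hθ : 10 * d * (Fintype.card ι * (Fintype.card ι * e + m) / φ ^ 2) ≤ 1) :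
    ∃ (G : Matrix ι (Fin k) ℝ) (M : Matrix (Fin k) (Fin k) ℝ), P = (B + G) * M * (B + G)ᵀ ∧
      (∀ i, ‖row i G‖ ≤ 5 * d * (√(Fintype.card ι) * (Fintype.card ι * e + m) / (φ * √φ))) ∧
      ‖M - 1‖ ≤ 10 * d * (Fintype.card ι * (Fintype.card ι * e + m) / φ ^ 2) := by
  set n : ℝ := ((Fintype.card ι : ℕ) : ℝ) with hn
  set η := n * e + m with hη
  set θ := n * η / φ ^ 2 with hθdef
  have hn0 : 0 < n := by
    by_contra h
    have : n ≤ 0 := not_lt.1 h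
    nlinarith
  have hη0 : 0 ≤ η := by positivity
  have hθ0 : 0 ≤ θ := by positivity
  have hsφ : 0 < √φ := Real.sqrt_pos.2 hφ
  have hηφ : η ≤ φ / 10 := by
    have h1 : η * n = θ * φ ^ 2 := by rw [hθdef]; field_simp
    have h2 : θ * φ ^ 2 ≤ θ * φ * (d * n) := by
      rw [sq, ← mul_assoc]
      gcongr
    have h3 : η * n ≤ φ / 10 * n := by nlinarith [mul_le_mul_of_nonneg_left hθ (mul_pos hφ hn0).le]
    exact le_of_mul_le_mul_right h3 hn0
  have hEn : ∀ i, ‖row i E‖ ≤ √n * e := fun i => norm_row_le he i (hE i)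
  have hΔ : ‖N + E‖ ≤ η := by
    have h1 : ‖E‖ ≤ n * e := by
      refine (norm_le_sqrt_card_mul (by positivity) hEn).trans (le_of_eq ?_)
      rw [← mul_assoc, Real.mul_self_sqrt hn0.le]
    calc _ ≤ ‖N‖ + ‖E‖ := norm_add_le _ _
      _ ≤ m + n * e := add_le_add (norm_le_of_sum_abs_le hm hNr hNc) h1
      _ = η := by rw [hη, add_comm]
  have hX : ‖R + (N + E)‖ ≤ φ / 4 := (norm_add_le _ _).trans (by linarith)
  obtain ⟨U, D, hU, hPU, hSU, hD, hSc, hSsymm⟩ :=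
    hP.exists_factor hφ hB (X := R + (N + E)) (by rw [hS]; abel) hX
  obtain ⟨hGu, hGi, hWn⟩ := gram_inv_bounds hφ hB
  obtain ⟨W, hW⟩ : ∃ W, W = B * (Bᵀ * B)⁻¹ := ⟨_, rfl⟩
  rw [← hW] at hWn
  have hBW : Bᵀ * W = 1 := by rw [hW, ← Matrix.mul_assoc, Matrix.mul_nonsing_inv _ hGu]
  have hWB : Wᵀ * B = 1 := by
    have h := congrArg Matrix.transpose hBW
    rwa [Matrix.transpose_mul, Matrix.transpose_transpose, Matrix.transpose_one] at h
  have hRW : R * W = 0 := by rw [hW, ← Matrix.mul_assoc, hRB, Matrix.zero_mul]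
  have hAW : (B * Bᵀ + R) * W = B := by
    rw [Matrix.add_mul, hRW, add_zero, Matrix.mul_assoc, hBW, Matrix.mul_one]
  set Q := U * Uᵀ with hQ
  have hQs : Qᵀ = Q := by rw [hQ, Matrix.transpose_mul, Matrix.transpose_transpose]
  have hQQ : Q * Q = Q := by
    rw [hQ, Matrix.mul_assoc, ← Matrix.mul_assoc Uᵀ, hU, Matrix.one_mul]
  have hQc : (1 - Q)ᵀ * (1 - Q) = 1 - Q := by
    rw [Matrix.transpose_sub, Matrix.transpose_one, hQs, Matrix.mul_sub, Matrix.sub_mul,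
      Matrix.sub_mul, hQQ]
    simp
  have hQcc : (1 - Q) * (1 - Q) = 1 - Q := by
    rw [Matrix.transpose_sub, Matrix.transpose_one, hQs] at hQc
    exact hQc
  have hQn : ‖Q‖ ≤ 1 := norm_le_one_of_isIdempotent (by rw [hQs, hQQ])
  have hQcn : ‖1 - Q‖ ≤ 1 := norm_le_one_of_isIdempotent hQc
  have hPs : Pᵀ = P := by
    rw [hPU]
    simp [Matrix.transpose_mul, Matrix.mul_assoc]
  have hPSQ : P = S * Q := by rw [hQ, ← Matrix.mul_assoc, hSU, hPU]
  have hcomm : S * Q = Q * S := by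
    rw [← hPSQ, ← hPs, hPSQ, Matrix.transpose_mul, hQs, hSsymm.eq]
  -- the range of `W` is almost contained in the span of the leading eigenvectors
  have hw : ‖(1 - Q) * W‖ ≤ 2 * (η / (φ * √φ)) := by
    have h1 : (1 - Q) * B = S * (1 - Q) * ((1 - Q) * W) - (1 - Q) * ((N + E) * W) := by
      have h2 : S * (1 - Q) * ((1 - Q) * W) = (1 - Q) * (S * W) := by
        have h3 : S * (1 - Q) = (1 - Q) * S := by
          rw [Matrix.mul_sub, Matrix.sub_mul, Matrix.mul_one, Matrix.one_mul, hcomm]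
        rw [← Matrix.mul_assoc, Matrix.mul_assoc S, hQcc, h3, Matrix.mul_assoc]
      have h3 : S * W = B + (N + E) * W := by
        rw [hS, add_assoc, Matrix.add_mul, hAW]
      rw [h2, h3, Matrix.mul_add, add_sub_cancel_right]
    have h4 : (1 - Q) * W = (1 - Q) * B * (Bᵀ * B)⁻¹ := by rw [hW, Matrix.mul_assoc]
    have h5 : ‖(1 - Q) * B‖ ≤ φ / 4 * ‖(1 - Q) * W‖ + η * (√φ)⁻¹ := by
      rw [h1]
      refine (norm_sub_le _ _).trans (add_le_add ?_ ?_)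
      · exact (Matrix.l2_opNorm_mul _ _).trans (by gcongr)
      · calc _ ≤ ‖1 - Q‖ * (‖N + E‖ * ‖W‖) := (Matrix.l2_opNorm_mul _ _).trans (by
              gcongr; exact Matrix.l2_opNorm_mul _ _)
          _ ≤ 1 * (η * (√φ)⁻¹) := by gcongr
          _ = _ := one_mul _
    have h6 : ‖(1 - Q) * W‖ ≤ (φ / 4 * ‖(1 - Q) * W‖ + η * (√φ)⁻¹) * φ⁻¹ := by
      conv_lhs => rw [h4]
      exact (Matrix.l2_opNorm_mul _ _).trans (by gcongr)
    have h7 : (φ / 4 * ‖(1 - Q) * W‖ + η * (√φ)⁻¹) * φ⁻¹ =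
        ‖(1 - Q) * W‖ / 4 + η / (φ * √φ) := by field_simp
    have h8 : 0 ≤ η / (φ * √φ) := by positivity
    linarith
  -- the leading eigenvectors are delocalized
  have hrowQ : ∀ i, ‖row i Q‖ ≤ √n * d * (2 / φ) := fun i => by
    have hD0 : ∀ a, 0 < D a := fun a => lt_of_lt_of_le (by linarith) (hD a)
    have h1 : Q = S * (U * Matrix.diagonal (fun a => (D a)⁻¹) * Uᵀ) := by
      rw [← Matrix.mul_assoc, ← Matrix.mul_assoc, hSU, Matrix.mul_assoc U,
        Matrix.diagonal_mul_diagonal]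
      have : (fun a => D a * (D a)⁻¹) = 1 := by
        ext a; exact mul_inv_cancel₀ (hD0 a).ne'
      rw [this, Pi.one_def, Matrix.diagonal_one, Matrix.mul_one]
    have hUn : ‖U‖ ≤ 1 := norm_le_of_mulVec zero_le_one fun c => by
      rw [← dotProduct_transpose_mul_self_mulVec, hU]; simp
    have hdn : ‖Matrix.diagonal (fun a => (D a)⁻¹)‖ ≤ 2 / φ := by
      rw [Matrix.l2_opNorm_diagonal]
      refine (pi_norm_le_iff_of_nonneg (by positivity)).2 fun a => ?_
      rw [norm_inv, Real.norm_eq_abs, abs_of_pos (hD0 a), inv_le_comm₀ (hD0 a) (by positivity),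
        inv_div]
      linarith [hD a]
    rw [h1, row_mul]
    refine (Matrix.l2_opNorm_mul _ _).trans ?_
    refine mul_le_mul (norm_row_le (by linarith) i (hSd i)) ?_ (norm_nonneg _) (by positivity)
    calc _ ≤ ‖U‖ * ‖Matrix.diagonal (fun a => (D a)⁻¹)‖ * ‖Uᵀ‖ := by
          refine (Matrix.l2_opNorm_mul _ _).trans ?_
          gcongr
          exact Matrix.l2_opNorm_mul _ _
      _ ≤ 1 * (2 / φ) * 1 := by
          rw [norm_transpose]
          gcongr
      _ = 2 / φ := by ring
  set G := P * W - B with hG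
  have hBG : B + G = P * W := by rw [hG]; abel
  have hGe : G = N * (Q * W) + E * (Q * W) - (B * Bᵀ + R) * ((1 - Q) * W) := by
    have h1 : P * W = (B * Bᵀ + R) * (Q * W) + (N * (Q * W) + E * (Q * W)) := by
      rw [hPSQ, Matrix.mul_assoc]
      nth_rewrite 1 [hS]
      simp only [Matrix.add_mul]
      abel
    rw [hG, h1, Matrix.sub_mul 1 Q W, Matrix.one_mul, Matrix.mul_sub, hAW]
    abel
  have hGrow : ∀ i, ‖row i G‖ ≤ 5 * d * (√n * η / (φ * √φ)) := fun i => by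
    have h1 : ‖row i (N * (Q * W))‖ ≤ m * (√n * d * (2 / φ) * (√φ)⁻¹) :=
      norm_row_mul_le_of_sum_abs_le (by positivity) i (hNr i) fun l => by
        rw [row_mul]
        refine (Matrix.l2_opNorm_mul _ _).trans ?_
        gcongr
        exact hrowQ l
    have h2 : ‖row i (E * (Q * W))‖ ≤ √n * e * (1 * (√φ)⁻¹) := by
      rw [row_mul]
      refine (Matrix.l2_opNorm_mul _ _).trans ?_
      gcongr
      · exact hEn i
      · exact (Matrix.l2_opNorm_mul _ _).trans (by gcongr)
    have h3 : ‖row i ((B * Bᵀ + R) * ((1 - Q) * W))‖ ≤ √n * d * (2 * (η / (φ * √φ))) := by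
      rw [row_mul]
      refine (Matrix.l2_opNorm_mul _ _).trans ?_
      gcongr
      exact norm_row_le (by linarith) i (hAd i)
    have h4 : ‖row i G‖ ≤ m * (√n * d * (2 / φ) * (√φ)⁻¹) + √n * e * (1 * (√φ)⁻¹) +
        √n * d * (2 * (η / (φ * √φ))) := by
      rw [hGe, row_sub, row_add]
      exact (norm_sub_le _ _).trans (add_le_add ((norm_add_le _ _).trans (add_le_add h1 h2)) h3)
    have h5 : m * (√n * d * (2 / φ) * (√φ)⁻¹) + √n * e * (1 * (√φ)⁻¹) +
        √n * d * (2 * (η / (φ * √φ))) = √n / (φ * √φ) * (2 * d * m + e * φ + 2 * d * η) := by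
      field_simp
    have h6 : 2 * d * m + e * φ + 2 * d * η ≤ 5 * d * η := by
      have h7 : e * φ ≤ e * (d * n) := mul_le_mul_of_nonneg_left hφd he
      have h8 : 0 ≤ d * (n * e) := by positivity
      have h10 : 0 ≤ d * m := by positivity
      have h9 : d * η = d * (n * e) + d * m := by rw [hη]; ring
      linarith
    calc _ ≤ _ := h4
      _ = _ := h5
      _ ≤ √n / (φ * √φ) * (5 * d * η) := by gcongr
      _ = _ := by ring
  have hWG : ‖Wᵀ * G‖ ≤ 5 * d * θ := by
    have h1 : ‖G‖ ≤ √n * (5 * d * (√n * η / (φ * √φ))) :=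
      norm_le_sqrt_card_mul (by positivity) hGrow
    have h2 : (√φ)⁻¹ * (√n * (5 * d * (√n * η / (φ * √φ)))) = 5 * d * θ := by
      have e1 : √n * √n = n := Real.mul_self_sqrt hn0.le
      have e2 : √φ * √φ = φ := Real.mul_self_sqrt hφ.le
      calc _ = 5 * d * ((√n * √n) * η / (φ * (√φ * √φ))) := by field_simp
        _ = _ := by rw [e1, e2, hθdef, sq]
    rw [← h2]
    refine (Matrix.l2_opNorm_mul _ _).trans ?_
    rw [norm_transpose]
    gcongr
  have hWPW : Wᵀ * (P * W) = 1 + Wᵀ * G := by rw [← hBG, Matrix.mul_add, hWB]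
  obtain ⟨hdet, -, hMi⟩ := isUnit_det_one_add (A := Wᵀ * G) (by linarith)
  refine ⟨G, (1 + Wᵀ * G)⁻¹, ?_, hGrow, by linarith⟩
  rw [hBG, ← hWPW]
  exact nystrom_identity hPU (by rw [hWPW]; exact hdet)

end Principal

/-! ### Inverses of low-rank plus sparse matrices -/

section Inverse

open scoped Matrix.Norms.L2Operator

variable {n r : Type*} [Fintype n] [DecidableEq n] [Fintype r] [DecidableEq r]

theorem norm_mul_le_of_le {l m o : Type*} [Fintype l] [Fintype m] [Fintype o] [DecidableEq m]
    [DecidableEq o] {A : Matrix l m ℝ} {B : Matrix m o ℝ} {a b : ℝ} (hA : ‖A‖ ≤ a)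
    (hB : ‖B‖ ≤ b) : ‖A * B‖ ≤ a * b :=
  (Matrix.l2_opNorm_mul A B).trans
    (mul_le_mul hA hB (norm_nonneg _) ((norm_nonneg _).trans hA))

theorem dotProduct_mul_mul_transpose_mulVec (F : Matrix n r ℝ) (M : Matrix r r ℝ) (x : n → ℝ) :
    x ⬝ᵥ (F * M * Fᵀ) *ᵥ x = (Fᵀ *ᵥ x) ⬝ᵥ M *ᵥ (Fᵀ *ᵥ x) := by
  rw [← Matrix.mulVec_mulVec, ← Matrix.mulVec_mulVec, Matrix.dotProduct_mulVec,
    ← Matrix.mulVec_transpose]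

theorem dotProduct_mulVec_ge_of_norm_sub_one {M : Matrix r r ℝ} {ζ : ℝ} (hM : ‖M - 1‖ ≤ ζ)
    (x : r → ℝ) : (1 - ζ) * (x ⬝ᵥ x) ≤ x ⬝ᵥ M *ᵥ x := by
  have h1 := (abs_le.1 (abs_dotProduct_mulVec_le (M - 1) x)).1
  rw [Matrix.sub_mulVec, Matrix.one_mulVec, dotProduct_sub] at h1
  nlinarith [mul_le_mul_of_nonneg_right hM (dotProduct_self_nonneg' x)]

/-- Stability of the inverse of `F Fᵀ + N`, `F = Y Φ`, when `F` is perturbed to `(Y + H) Φ`. The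
scale `Φ` may be arbitrarily large (and different in different directions): the bound involves the
relative perturbation `H` only. -/
theorem norm_inv_sub_inv_le {Y H : Matrix n r ℝ} {Φ M : Matrix r r ℝ} {N N' : Matrix n n ℝ}
    {d ζ γ m : ℝ} (hd : 0 < d) (hd1 : d ≤ 1) (hζ : ζ ≤ 1 / 2) (hγ : γ ≤ d / 2)
    (hΦ : Φᵀ = Φ) (hY : ∀ x, x ⬝ᵥ x ≤ (Y *ᵥ x) ⬝ᵥ (Y *ᵥ x)) (hH : ‖H‖ ≤ ζ) (hM : ‖M - 1‖ ≤ ζ)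
    (hN : ∀ x, d * (x ⬝ᵥ x) ≤ x ⬝ᵥ N *ᵥ x) (hNm : ‖N‖ ≤ m) (hNN : ‖N' - N‖ ≤ γ) :
    IsUnit ((Y + H) * Φ * M * ((Y + H) * Φ)ᵀ + N').det ∧
    ‖((Y + H) * Φ * M * ((Y + H) * Φ)ᵀ + N')⁻¹ - (Y * Φ * (Y * Φ)ᵀ + N)⁻¹‖ ≤
      8 * (γ + ζ * (1 + m)) / d ^ 2 := by
  have hm : 0 ≤ m := (norm_nonneg _).trans hNm
  have hζ0 : 0 ≤ ζ := (norm_nonneg _).trans hH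
  have hγ0 : 0 ≤ γ := (norm_nonneg _).trans hNN
  set F := Y * Φ with hF
  set F' := (Y + H) * Φ with hF'
  set X := F * Fᵀ + N with hX
  set X' := F' * M * F'ᵀ + N' with hX'
  -- a priori bounds
  obtain ⟨hXu, hXi, hXF⟩ := inv_bounds_of_coercive (X := X) (F := F) hd one_pos fun x => by
    have h := dotProduct_transpose_mul_self_mulVec Fᵀ x
    rw [Matrix.transpose_transpose] at h
    rw [hX, Matrix.add_mulVec, dotProduct_add, h, one_mul, add_comm]
    exact add_le_add le_rfl (hN x)
  obtain ⟨hXu', hXi', hXF'⟩ := inv_bounds_of_coercive (X := X'ᵀ) (F := F') (a := d / 2)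
      (h := 1 / 2) (by positivity) (by norm_num) fun x => by
    have h1 := dotProduct_mulVec_ge_of_norm_sub_one hM (F'ᵀ *ᵥ x)
    have h2 := hN x
    have h3 := (abs_le.1 (abs_dotProduct_mulVec_le (N' - N) x)).1
    have h4 := dotProduct_self_nonneg' x
    have h5 := dotProduct_self_nonneg' (F'ᵀ *ᵥ x)
    have h6 : x ⬝ᵥ X'ᵀ *ᵥ x = x ⬝ᵥ X' *ᵥ x := by
      rw [Matrix.mulVec_transpose, dotProduct_comm, ← Matrix.dotProduct_mulVec]
    rw [h6, hX', Matrix.add_mulVec, dotProduct_add, dotProduct_mul_mul_transpose_mulVec]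
    rw [Matrix.sub_mulVec, dotProduct_sub] at h3
    nlinarith [mul_le_mul_of_nonneg_right (hNN.trans hγ) h4, mul_le_mul_of_nonneg_right hζ h5]
  rw [Matrix.det_transpose] at hXu'
  rw [← Matrix.transpose_nonsing_inv] at hXi' hXF'
  rw [norm_transpose, inv_div] at hXi'
  have hXF' : ‖X'⁻¹ * F'‖ ≤ 2 / √d := by
    rw [← norm_transpose, Matrix.transpose_mul]
    refine hXF'.trans (le_of_eq ?_)
    have : d / 2 * (1 / 2) = d / 2 ^ 2 := by ring
    rw [this, Real.sqrt_div hd.le, Real.sqrt_sq (by norm_num), inv_div]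
  rw [mul_one] at hXF
  refine ⟨hXu', ?_⟩
  obtain ⟨hYu, -, hYn⟩ := gram_inv_bounds (B := Y) one_pos (by simpa using hY)
  rw [Real.sqrt_one, inv_one] at hYn
  obtain ⟨Z, hZ⟩ : ∃ Z, Z = Y * (Yᵀ * Y)⁻¹ := ⟨_, rfl⟩
  rw [← hZ] at hYn
  have hYZ : Yᵀ * Z = 1 := by rw [hZ, ← Matrix.mul_assoc, Matrix.mul_nonsing_inv _ hYu]
  have hZY : Zᵀ * Y = 1 := by
    have h := congrArg Matrix.transpose hYZ
    rwa [Matrix.transpose_mul, Matrix.transpose_transpose, Matrix.transpose_one] at h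
  -- the factors are almost annihilated by the inverses
  have hα : ‖Φ * (Fᵀ * X⁻¹)‖ ≤ 1 + m / d := by
    have h1 : F * (Fᵀ * X⁻¹) = 1 - N * X⁻¹ := by
      rw [← Matrix.mul_nonsing_inv X hXu, eq_sub_iff_add_eq, ← Matrix.mul_assoc, ← Matrix.add_mul]
    have h2 : Φ * (Fᵀ * X⁻¹) = Zᵀ * (1 - N * X⁻¹) := by
      rw [← h1, hF, ← Matrix.mul_assoc Zᵀ, ← Matrix.mul_assoc Zᵀ, hZY, Matrix.one_mul]
    rw [h2]
    refine (norm_mul_le_of_le (a := 1) (by rwa [norm_transpose])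
      ((norm_sub_le _ _).trans (add_le_add norm_one_le (norm_mul_le_of_le hNm hXi)))).trans
      (le_of_eq ?_)
    ring
  have hβ : ‖X'⁻¹ * F' * M * Φ‖ ≤ (4 + 4 * m) / d := by
    have h1 : X'⁻¹ * (F' * M * F'ᵀ) = 1 - X'⁻¹ * N' := by
      rw [← Matrix.nonsing_inv_mul X' hXu', eq_sub_iff_add_eq, ← Matrix.mul_add]
    obtain ⟨hJu, hJn, -⟩ := isUnit_det_one_add (A := Hᵀ * Z) (by
      refine (norm_mul_le_of_le (a := ζ) (by rwa [norm_transpose]) hYn).trans (by linarith))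
    have h2 : X'⁻¹ * F' * M * Φ * (1 + Hᵀ * Z) = (1 - X'⁻¹ * N') * Z := by
      rw [← h1, hF', Matrix.transpose_mul, hΦ, Matrix.transpose_add]
      have : (1 + Hᵀ * Z) = (Yᵀ + Hᵀ) * Z := by rw [Matrix.add_mul, hYZ]
      rw [this]
      simp only [Matrix.mul_assoc]
    have h3 : X'⁻¹ * F' * M * Φ = (1 - X'⁻¹ * N') * Z * (1 + Hᵀ * Z)⁻¹ := by
      rw [← h2, Matrix.mul_assoc _ (1 + Hᵀ * Z), Matrix.mul_nonsing_inv _ hJu, Matrix.mul_one]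
    have h4 : ‖N'‖ ≤ m + 1 / 2 := by
      have : N' = N + (N' - N) := by abel
      rw [this]
      exact (norm_add_le _ _).trans (by linarith)
    rw [h3]
    refine (norm_mul_le_of_le (norm_mul_le_of_le ((norm_sub_le _ _).trans
      (add_le_add norm_one_le (norm_mul_le_of_le hXi' h4))) hYn) hJn).trans ?_
    rw [le_div_iff₀ hd]
    have : (1 + 2 / d * (m + 1 / 2)) * 1 * 2 * d = 2 * d + 4 * m + 2 := by field_simp; ring
    rw [this]
    linarith
  have hsplit : X'⁻¹ - X⁻¹ = X'⁻¹ * (N - N') * X⁻¹ - X'⁻¹ * H * (Φ * (Fᵀ * X⁻¹)) +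
      X'⁻¹ * F' * (1 - M) * (Fᵀ * X⁻¹) - X'⁻¹ * F' * M * Φ * Hᵀ * X⁻¹ := by
    have h1 : X'⁻¹ - X⁻¹ = X'⁻¹ * (X - X') * X⁻¹ := by
      rw [Matrix.mul_sub, Matrix.sub_mul, Matrix.mul_assoc, Matrix.mul_nonsing_inv X hXu,
        Matrix.nonsing_inv_mul X' hXu', Matrix.mul_one, Matrix.one_mul]
    have h2 : X - X' = (N - N') - H * (Φ * Fᵀ) + F' * (1 - M) * Fᵀ - F' * M * Φ * Hᵀ := by
      have h3 : F' = F + H * Φ := by rw [hF', hF, Matrix.add_mul]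
      have h4 : F'ᵀ = Fᵀ + Φ * Hᵀ := by
        rw [h3, Matrix.transpose_add, Matrix.transpose_mul H, hΦ]
      have h5 : F' * (1 - M) * Fᵀ = F * Fᵀ + H * (Φ * Fᵀ) - F' * M * Fᵀ := by
        rw [Matrix.mul_sub, Matrix.sub_mul, Matrix.mul_one]
        nth_rewrite 1 [h3]
        rw [Matrix.add_mul, Matrix.mul_assoc H]
      rw [hX, hX', h4, Matrix.mul_add, h5, Matrix.mul_assoc (F' * M) Φ]
      abel
    rw [h1, h2]
    simp only [Matrix.mul_sub, Matrix.sub_mul, Matrix.mul_add, Matrix.add_mul, Matrix.mul_assoc]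
  have hsd : 0 < √d := Real.sqrt_pos.2 hd
  have b1 : ‖X'⁻¹ * (N - N') * X⁻¹‖ ≤ 2 / d * γ * d⁻¹ :=
    norm_mul_le_of_le (norm_mul_le_of_le hXi' (by rwa [norm_sub_rev])) hXi
  have b2 : ‖X'⁻¹ * H * (Φ * (Fᵀ * X⁻¹))‖ ≤ 2 / d * ζ * (1 + m / d) :=
    norm_mul_le_of_le (norm_mul_le_of_le hXi' hH) hα
  have b3 : ‖X'⁻¹ * F' * (1 - M) * (Fᵀ * X⁻¹)‖ ≤ 2 / √d * ζ * (√d)⁻¹ :=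
    norm_mul_le_of_le (norm_mul_le_of_le hXF' (by rwa [norm_sub_rev])) hXF
  have b4 : ‖X'⁻¹ * F' * M * Φ * Hᵀ * X⁻¹‖ ≤ (4 + 4 * m) / d * ζ * d⁻¹ :=
    norm_mul_le_of_le (norm_mul_le_of_le hβ (by rwa [norm_transpose])) hXi
  have b3' : 2 / √d * ζ * (√d)⁻¹ = 2 * ζ / d := by
    have : √d * √d = d := Real.mul_self_sqrt hd.le
    calc _ = 2 * ζ / (√d * √d) := by field_simp
      _ = _ := by rw [this]
  rw [hsplit]
  refine (norm_sub_le _ _).trans ((add_le_add ((norm_add_le _ _).trans (add_le_add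
    ((norm_sub_le _ _).trans (add_le_add b1 b2)) b3)) b4).trans ?_)
  rw [b3', le_div_iff₀ (by positivity)]
  have : (2 / d * γ * d⁻¹ + 2 / d * ζ * (1 + m / d) + 2 * ζ / d + (4 + 4 * m) / d * ζ * d⁻¹) *
      d ^ 2 = 2 * γ + 2 * ζ * (d + m) + 2 * ζ * d + (4 + 4 * m) * ζ := by
    field_simp
  rw [this]
  nlinarith [mul_nonneg hζ0 hm, mul_le_mul_of_nonneg_left hd1 hζ0]

theorem norm_fromCols_le {r' : Type*} [Fintype r'] [DecidableEq r'] (A : Matrix n r ℝ)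
    (B : Matrix n r' ℝ) : ‖Matrix.fromCols A B‖ ≤ ‖A‖ + ‖B‖ := by
  have h : Matrix.fromCols A B = A * (Matrix.fromCols 1 0 : Matrix r (r ⊕ r') ℝ) +
      B * (Matrix.fromCols 0 1 : Matrix r' (r ⊕ r') ℝ) := by
    rw [Matrix.mul_fromCols, Matrix.mul_fromCols]
    ext i (j | j) <;> simp
  have h1 : ‖(Matrix.fromCols 1 0 : Matrix r (r ⊕ r') ℝ)‖ ≤ 1 :=
    norm_le_of_mulVec zero_le_one fun x => by
      rw [Matrix.fromCols_mulVec]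
      simpa [dotProduct] using Finset.sum_nonneg fun i _ => mul_self_nonneg _
  have h2 : ‖(Matrix.fromCols 0 1 : Matrix r' (r ⊕ r') ℝ)‖ ≤ 1 :=
    norm_le_of_mulVec zero_le_one fun x => by
      rw [Matrix.fromCols_mulVec]
      simpa [dotProduct] using Finset.sum_nonneg fun i _ => mul_self_nonneg _
  rw [h]
  refine (norm_add_le _ _).trans (add_le_add ?_ ?_)
  · exact (norm_mul_le_of_le (le_refl ‖A‖) h1).trans (mul_one _).le
  · exact (norm_mul_le_of_le (le_refl ‖B‖) h2).trans (mul_one _).le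

theorem norm_fromBlocks_diag_le {r' : Type*} [Fintype r'] [DecidableEq r'] {A : Matrix r r ℝ}
    {B : Matrix r' r' ℝ} {c : ℝ} (hA : ‖A‖ ≤ c) (hB : ‖B‖ ≤ c) :
    ‖Matrix.fromBlocks A 0 0 B‖ ≤ c := by
  refine norm_le_of_mulVec ((norm_nonneg _).trans hA) fun x => ?_
  have h1 := mulVec_dotProduct_self_le A (x ∘ Sum.inl)
  have h2 := mulVec_dotProduct_self_le B (x ∘ Sum.inr)
  have h3 := pow_le_pow_left₀ (norm_nonneg _) hA 2
  have h4 := pow_le_pow_left₀ (norm_nonneg _) hB 2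
  have h5 := dotProduct_self_nonneg' (x ∘ Sum.inl)
  have h6 := dotProduct_self_nonneg' (x ∘ Sum.inr)
  have h7 : x ⬝ᵥ x = (x ∘ Sum.inl) ⬝ᵥ (x ∘ Sum.inl) + (x ∘ Sum.inr) ⬝ᵥ (x ∘ Sum.inr) := by
    simp [dotProduct]
  rw [Matrix.fromBlocks_mulVec, Matrix.zero_mulVec, Matrix.zero_mulVec, add_zero, zero_add,
    sumElim_dotProduct_sumElim, h7]
  nlinarith [mul_le_mul_of_nonneg_right h3 h5, mul_le_mul_of_nonneg_right h4 h6]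

/-- Stability of the inverse of `B Bᵀ + Λ Λᵀ + N` with mutually orthogonal factors `B` and `Λ` of
possibly different strengths `φ` and `ψ`. -/
theorem norm_inv_sub_inv_le_of_two_factors {κ κ' : Type*} [Fintype κ] [DecidableEq κ] [Fintype κ']
    [DecidableEq κ'] {B G : Matrix n κ ℝ} {L G' : Matrix n κ' ℝ} {M : Matrix κ κ ℝ}
    {M' : Matrix κ' κ' ℝ} {N N' : Matrix n n ℝ} {d ζ γ m φ ψ : ℝ} (hd : 0 < d) (hd1 : d ≤ 1)
    (hζ : 2 * ζ ≤ 1 / 2) (hγ : γ ≤ d / 2) (hφ : 0 < φ) (hψ : 0 < ψ)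
    (hB : ∀ x, φ * (x ⬝ᵥ x) ≤ (B *ᵥ x) ⬝ᵥ (B *ᵥ x))
    (hL : ∀ x, ψ * (x ⬝ᵥ x) ≤ (L *ᵥ x) ⬝ᵥ (L *ᵥ x)) (hBL : Bᵀ * L = 0)
    (hG : ‖G‖ ≤ √φ * ζ) (hG' : ‖G'‖ ≤ √ψ * ζ) (hM : ‖M - 1‖ ≤ ζ) (hM' : ‖M' - 1‖ ≤ ζ)
    (hN : ∀ x, d * (x ⬝ᵥ x) ≤ x ⬝ᵥ N *ᵥ x) (hNm : ‖N‖ ≤ m) (hNN : ‖N' - N‖ ≤ γ) :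
    IsUnit ((B + G) * M * (B + G)ᵀ + (L + G') * M' * (L + G')ᵀ + N').det ∧
    ‖((B + G) * M * (B + G)ᵀ + (L + G') * M' * (L + G')ᵀ + N')⁻¹ -
        (B * Bᵀ + L * Lᵀ + N)⁻¹‖ ≤ 8 * (γ + 2 * ζ * (1 + m)) / d ^ 2 := by
  have hζ0 : 0 ≤ ζ := (norm_nonneg _).trans hM
  have hsφ : 0 < √φ := Real.sqrt_pos.2 hφ
  have hsψ : 0 < √ψ := Real.sqrt_pos.2 hψ
  set Y : Matrix n (κ ⊕ κ') ℝ := Matrix.fromCols ((√φ)⁻¹ • B) ((√ψ)⁻¹ • L) with hY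
  set H : Matrix n (κ ⊕ κ') ℝ := Matrix.fromCols ((√φ)⁻¹ • G) ((√ψ)⁻¹ • G') with hH
  set Φ : Matrix (κ ⊕ κ') (κ ⊕ κ') ℝ := Matrix.fromBlocks (√φ • 1) 0 0 (√ψ • 1) with hΦ
  set M₂ : Matrix (κ ⊕ κ') (κ ⊕ κ') ℝ := Matrix.fromBlocks M 0 0 M' with hM₂
  have hYΦ : ∀ (A : Matrix n κ ℝ) (A' : Matrix n κ' ℝ),
      Matrix.fromCols ((√φ)⁻¹ • A) ((√ψ)⁻¹ • A') * Φ = Matrix.fromCols A A' := fun A A' => by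
    rw [hΦ, Matrix.fromCols_mul_fromBlocks]
    simp [smul_smul, hsφ.ne', hsψ.ne']
  have hF : Y * Φ = Matrix.fromCols B L := hYΦ B L
  have hF' : (Y + H) * Φ = Matrix.fromCols (B + G) (L + G') := by
    rw [Matrix.add_mul, hYΦ, hYΦ]
    ext i (a | a) <;> simp
  have hcols : ∀ (A : Matrix n κ ℝ) (A' : Matrix n κ' ℝ), Matrix.fromCols A A' * M₂ *
      (Matrix.fromCols A A')ᵀ = A * M * Aᵀ + A' * M' * A'ᵀ := fun A A' => by
    rw [hM₂, Matrix.fromCols_mul_fromBlocks, Matrix.transpose_fromCols,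
      Matrix.fromCols_mul_fromRows]
    simp
  have hcols1 : ∀ (A : Matrix n κ ℝ) (A' : Matrix n κ' ℝ), Matrix.fromCols A A' *
      (Matrix.fromCols A A')ᵀ = A * Aᵀ + A' * A'ᵀ := fun A A' => by
    rw [Matrix.transpose_fromCols, Matrix.fromCols_mul_fromRows]
  have key := norm_inv_sub_inv_le (Y := Y) (H := H) (Φ := Φ) (M := M₂) hd hd1 hζ hγ ?_ ?_ ?_ ?_
    hN hNm hNN
  · rwa [hF', hF, hcols, hcols1] at key
  · simp [hΦ, Matrix.fromBlocks_transpose]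
  · intro x
    have h1 : Y *ᵥ x = (√φ)⁻¹ • (B *ᵥ (x ∘ Sum.inl)) + (√ψ)⁻¹ • (L *ᵥ (x ∘ Sum.inr)) := by
      rw [hY, Matrix.fromCols_mulVec, Matrix.smul_mulVec, Matrix.smul_mulVec]
    have h2 : (B *ᵥ (x ∘ Sum.inl)) ⬝ᵥ (L *ᵥ (x ∘ Sum.inr)) = 0 := by
      rw [Matrix.dotProduct_mulVec, ← Matrix.mulVec_transpose, Matrix.mulVec_mulVec]
      have : Lᵀ * B = 0 := by
        have h := congrArg Matrix.transpose hBL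
        rwa [Matrix.transpose_mul, Matrix.transpose_transpose, Matrix.transpose_zero] at h
      rw [this]; simp
    have h7 : x ⬝ᵥ x = (x ∘ Sum.inl) ⬝ᵥ (x ∘ Sum.inl) + (x ∘ Sum.inr) ⬝ᵥ (x ∘ Sum.inr) := by
      simp [dotProduct]
    have e1 : (√φ)⁻¹ * (√φ)⁻¹ = φ⁻¹ := by rw [← mul_inv, Real.mul_self_sqrt hφ.le]
    have e2 : (√ψ)⁻¹ * (√ψ)⁻¹ = ψ⁻¹ := by rw [← mul_inv, Real.mul_self_sqrt hψ.le]
    rw [h1, h7]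
    simp only [add_dotProduct, dotProduct_add, smul_dotProduct, dotProduct_smul, smul_eq_mul,
      dotProduct_comm (L *ᵥ (x ∘ Sum.inr)) (B *ᵥ (x ∘ Sum.inl)), h2, mul_zero, add_zero, zero_add,
      ← mul_assoc, e1, e2]
    have h3 : ∀ {a b s : ℝ}, 0 < s → s * a ≤ b → a ≤ s⁻¹ * b := fun hs h => by
      rwa [inv_mul_eq_div, le_div_iff₀ hs, mul_comm]
    exact add_le_add (h3 hφ (hB _)) (h3 hψ (hL _))
  · refine (norm_fromCols_le _ _).trans ?_
    rw [norm_smul, norm_smul, norm_inv, norm_inv, Real.norm_eq_abs, Real.norm_eq_abs,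
      abs_of_pos hsφ, abs_of_pos hsψ, two_mul]
    refine add_le_add ?_ ?_
    · rwa [inv_mul_le_iff₀ hsφ]
    · rwa [inv_mul_le_iff₀ hsψ]
  · have : M₂ - 1 = Matrix.fromBlocks (M - 1) 0 0 (M' - 1) := by
      rw [hM₂, ← Matrix.fromBlocks_one, sub_eq_add_neg, Matrix.fromBlocks_neg,
        Matrix.fromBlocks_add]
      simp [sub_eq_add_neg]
    rw [this]
    exact norm_fromBlocks_diag_le (by linarith) (by linarith)

end Inverse

/-! ### The relative Frobenius norm -/

section RelFrob

open scoped Matrix.Norms.L2Operator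

variable {ι r : Type*} [Fintype ι] [DecidableEq ι] [Fintype r] [DecidableEq r]

theorem frobNorm_eq_norm (A : Matrix ι ι ℝ) :
    frobNorm A = ‖(WithLp.toLp 2 (fun p : ι × ι => A p.1 p.2) : EuclideanSpace ℝ (ι × ι))‖ := by
  rw [frobNorm, EuclideanSpace.norm_eq]
  congr 1
  rw [Fintype.sum_prod_type_right]
  simp [Matrix.trace, Matrix.mul_apply, sq]

theorem frobNorm_add_le (A A' : Matrix ι ι ℝ) :
    frobNorm (A + A') ≤ frobNorm A + frobNorm A' := by
  simp only [frobNorm_eq_norm]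
  exact norm_add_le (WithLp.toLp 2 (fun p : ι × ι => A p.1 p.2) : EuclideanSpace ℝ (ι × ι))
    (WithLp.toLp 2 (fun p : ι × ι => A' p.1 p.2))

theorem frobNorm_mul_transpose_le {X Z : Matrix ι r ℝ} {a b : ℝ} (hX : ‖X‖ ≤ a) (hZ : ‖Z‖ ≤ b) :
    frobNorm (X * Zᵀ) ≤ √(Fintype.card r) * (a * b) := by
  have ha : 0 ≤ a := (norm_nonneg _).trans hX
  have hb : 0 ≤ b := (norm_nonneg _).trans hZ
  refine Real.sqrt_le_iff.2 ⟨by positivity, ?_⟩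
  have h1 : ((X * Zᵀ)ᵀ * (X * Zᵀ)).trace = ∑ l, (X *ᵥ Z l) ⬝ᵥ (X *ᵥ Z l) := by
    simp [Matrix.trace, Matrix.mul_apply, Matrix.mulVec, dotProduct, mul_comm]
  have h2 : ∑ l, Z l ⬝ᵥ Z l ≤ Fintype.card r * b ^ 2 := by
    have h3 : ∑ l, Z l ⬝ᵥ Z l = ∑ c, (Z *ᵥ Pi.single c 1) ⬝ᵥ (Z *ᵥ Pi.single c 1) := by
      simp only [Matrix.mulVec_single_one, dotProduct, Matrix.col_apply]
      exact Finset.sum_comm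
    rw [h3]
    calc _ ≤ ∑ _c : r, b ^ 2 := Finset.sum_le_sum fun c _ => by
          refine (mulVec_dotProduct_self_le Z _).trans ?_
          rw [dotProduct_single_one, Pi.single_eq_same, mul_one]
          exact pow_le_pow_left₀ (norm_nonneg _) hZ 2
      _ = _ := by simp
  rw [h1, mul_pow, Real.sq_sqrt (by positivity)]
  calc _ ≤ ∑ l, a ^ 2 * (Z l ⬝ᵥ Z l) := Finset.sum_le_sum fun l _ => by
        refine (mulVec_dotProduct_self_le X _).trans ?_
        exact mul_le_mul_of_nonneg_right (pow_le_pow_left₀ (norm_nonneg _) hX 2)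
          (dotProduct_self_nonneg' _)
    _ = a ^ 2 * ∑ l, Z l ⬝ᵥ Z l := by rw [Finset.mul_sum]
    _ ≤ a ^ 2 * (Fintype.card r * b ^ 2) := by gcongr
    _ = _ := by ring

theorem invSqrt_transpose (S : Matrix ι ι ℝ) : (invSqrt S)ᵀ = invSqrt S := by
  have h : IsSelfAdjoint (invSqrt S) := cfc_predicate _ S
  rwa [IsSelfAdjoint, Matrix.star_eq_conjTranspose,
    Matrix.conjTranspose_eq_transpose_of_trivial] at h

theorem invSqrt_mul_mul_invSqrt {S : Matrix ι ι ℝ} (hS : S.PosDef) :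
    invSqrt S * S * invSqrt S = 1 := by
  have hsa : IsSelfAdjoint S := hS.1
  have hpos : ∀ x ∈ spectrum ℝ S, 0 < x := fun x hx => by
    rw [hS.1.spectrum_real_eq_range_eigenvalues] at hx
    obtain ⟨i, rfl⟩ := hx
    exact hS.eigenvalues_pos i
  have hc : ContinuousOn (fun x : ℝ => (√x)⁻¹) (spectrum ℝ S) :=
    Real.continuous_sqrt.continuousOn.inv₀ fun x hx => (Real.sqrt_pos.2 (hpos x hx)).ne'
  have hid : cfc (fun x : ℝ => x) S = S := cfc_id ℝ S
  have hmul : invSqrt S * S * invSqrt S = cfc (fun x : ℝ => (√x)⁻¹ * x * (√x)⁻¹) S := by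
    rw [cfc_mul (fun x : ℝ => (√x)⁻¹ * x) (fun x : ℝ => (√x)⁻¹) S (hc.mul continuousOn_id) hc,
      cfc_mul (fun x : ℝ => (√x)⁻¹) (fun x : ℝ => x) S hc continuousOn_id, hid]
    rfl
  rw [hmul, ← cfc_one ℝ S]
  refine cfc_congr fun x hx => ?_
  have h1 := Real.sqrt_pos.2 (hpos x hx)
  have h2 := Real.mul_self_sqrt (hpos x hx).le
  simp only [Pi.one_apply]
  nth_rewrite 2 [← h2]
  field_simp

/-- `S^{-1/2}` is bounded and maps factors contained in `S` to bounded matrices. -/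
theorem invSqrt_bounds {S K : Matrix ι ι ℝ} {F : Matrix ι r ℝ} {d : ℝ} (hd : 0 < d)
    (hSs : S.IsSymm) (hS : S = F * Fᵀ + K) (hK : ∀ x, d * (x ⬝ᵥ x) ≤ x ⬝ᵥ K *ᵥ x) :
    ‖invSqrt S‖ ≤ (√d)⁻¹ ∧ ‖invSqrt S * F‖ ≤ 1 := by
  have hq : ∀ x : ι → ℝ, x ⬝ᵥ S *ᵥ x = (Fᵀ *ᵥ x) ⬝ᵥ (Fᵀ *ᵥ x) + x ⬝ᵥ K *ᵥ x := fun x => by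
    have h := dotProduct_transpose_mul_self_mulVec Fᵀ x
    rw [Matrix.transpose_transpose] at h
    rw [hS, Matrix.add_mulVec, dotProduct_add, h]
  have hpd : S.PosDef := by
    refine Matrix.PosDef.of_dotProduct_mulVec_pos ?_ fun x hx => ?_
    · rw [Matrix.IsHermitian, Matrix.conjTranspose_eq_transpose_of_trivial, hSs.eq]
    · rw [star_trivial, hq]
      have h1 := dotProduct_self_nonneg' (Fᵀ *ᵥ x)
      have h2 := mul_pos hd (dotProduct_self_pos hx)
      linarith [hK x]
  set T := invSqrt S with hT
  have hTs : Tᵀ = T := invSqrt_transpose S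
  have hTST := invSqrt_mul_mul_invSqrt hpd
  rw [← hT] at hTST
  have key : ∀ x : ι → ℝ, (Fᵀ *ᵥ (T *ᵥ x)) ⬝ᵥ (Fᵀ *ᵥ (T *ᵥ x)) +
      d * ((T *ᵥ x) ⬝ᵥ (T *ᵥ x)) ≤ x ⬝ᵥ x := fun x => by
    have h1 : x ⬝ᵥ x = (T *ᵥ x) ⬝ᵥ S *ᵥ (T *ᵥ x) := by
      have h2 : x ⬝ᵥ (T * S * T) *ᵥ x = x ⬝ᵥ x := by rw [hTST, Matrix.one_mulVec]
      rw [← h2, ← Matrix.mulVec_mulVec, ← Matrix.mulVec_mulVec, Matrix.dotProduct_mulVec,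
        ← Matrix.mulVec_transpose, hTs]
    rw [h1, hq]
    linarith [hK (T *ᵥ x)]
  constructor
  · refine norm_le_of_mulVec (by positivity) fun x => ?_
    rw [inv_pow, Real.sq_sqrt hd.le, inv_mul_eq_div, le_div_iff₀ hd]
    linarith [key x, dotProduct_self_nonneg' (Fᵀ *ᵥ (T *ᵥ x))]
  · rw [← norm_transpose, Matrix.transpose_mul, hTs]
    refine norm_le_of_mulVec zero_le_one fun x => ?_
    rw [← Matrix.mulVec_mulVec]
    have := mul_nonneg hd.le (dotProduct_self_nonneg' (T *ᵥ x))
    linarith [key x]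

theorem frobNorm_factor_error_le {T : Matrix ι ι ℝ} {F G : Matrix ι r ℝ} {M : Matrix r r ℝ}
    {ζ g t : ℝ} (hTs : Tᵀ = T) (hT : ‖T‖ ≤ t) (hTF : ‖T * F‖ ≤ 1) (hM : ‖M - 1‖ ≤ ζ) (hζ : ζ ≤ 1)
    (hG : ‖G‖ ≤ g) :
    frobNorm (T * ((F + G) * M * (F + G)ᵀ - F * Fᵀ) * T) ≤
      √(Fintype.card r) * (ζ + 4 * (t * g) + 2 * (t * g) ^ 2) := by
  have hM2 : ‖M‖ ≤ 2 := by
    have : M = 1 + (M - 1) := by abel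
    rw [this]
    exact (norm_add_le _ _).trans (by linarith [norm_one_le (n := r)])
  have hTG : ‖T * G‖ ≤ t * g := norm_mul_le_of_le hT hG
  have h : T * ((F + G) * M * (F + G)ᵀ - F * Fᵀ) * T = T * F * (M - 1) * (T * F)ᵀ +
      T * F * M * (T * G)ᵀ + T * G * M * (T * F)ᵀ + T * G * M * (T * G)ᵀ := by
    rw [Matrix.transpose_mul, Matrix.transpose_mul, hTs, Matrix.transpose_add]
    simp only [Matrix.mul_add, Matrix.add_mul, Matrix.mul_sub, Matrix.sub_mul, Matrix.mul_assoc,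
      Matrix.one_mul]
    abel
  rw [h]
  refine (frobNorm_add_le _ _).trans ((add_le_add ((frobNorm_add_le _ _).trans (add_le_add
    ((frobNorm_add_le _ _).trans (add_le_add
      (frobNorm_mul_transpose_le (norm_mul_le_of_le hTF hM) hTF)
      (frobNorm_mul_transpose_le (norm_mul_le_of_le hTF hM2) hTG)))
      (frobNorm_mul_transpose_le (norm_mul_le_of_le hTG hM2) hTF)))
      (frobNorm_mul_transpose_le (norm_mul_le_of_le hTG hM2) hTG)).trans (le_of_eq ?_))
  ring

theorem dotProduct_mul_transpose_mulVec_nonneg (F : Matrix ι r ℝ) (x : ι → ℝ) :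
    0 ≤ x ⬝ᵥ (F * Fᵀ) *ᵥ x := by
  rw [← Matrix.mulVec_mulVec, Matrix.dotProduct_mulVec, ← Matrix.mulVec_transpose]
  exact dotProduct_self_nonneg' _

/-- The relative error of `B Bᵀ + Λ Λᵀ + N` when its factors and its sparse part are perturbed. The
perturbations `G`, `G'` of the factors enter through their rows. -/
theorem relFrobNorm_le {r' : Type*} [Fintype r'] [DecidableEq r'] [Nonempty ι]
    {B G : Matrix ι r ℝ} {L G' : Matrix ι r' ℝ} {M : Matrix r r ℝ} {M' : Matrix r' r' ℝ}
    {N N' : Matrix ι ι ℝ} {d ζ γ R : ℝ} (hd : 0 < d) (hd1 : d ≤ 1) (hζ : ζ ≤ 1)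
    (hNs : N.IsSymm) (hN : ∀ x, d * (x ⬝ᵥ x) ≤ x ⬝ᵥ N *ᵥ x)
    (hG : ∀ i, ‖row i G‖ ≤ ζ) (hG' : ∀ i, ‖row i G'‖ ≤ ζ) (hM : ‖M - 1‖ ≤ ζ) (hM' : ‖M' - 1‖ ≤ ζ)
    (hNN : ‖N' - N‖ ≤ γ) (hr : (Fintype.card r : ℝ) ≤ R ^ 2) (hr' : (Fintype.card r' : ℝ) ≤ R ^ 2)
    (hR : 0 ≤ R) :
    relFrobNorm (B * Bᵀ + L * Lᵀ + N) ((B + G) * M * (B + G)ᵀ + (L + G') * M' * (L + G')ᵀ + N' -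
      (B * Bᵀ + L * Lᵀ + N)) ≤
      2 * R * (5 * ζ + 2 * √(Fintype.card ι) * ζ ^ 2) / d + γ / d := by
  have hζ0 : 0 ≤ ζ := (norm_nonneg _).trans hM
  set S := B * Bᵀ + L * Lᵀ + N with hS
  have hSs : S.IsSymm := by
    rw [Matrix.IsSymm, hS]
    simp [hNs.eq]
  obtain ⟨hT, hTB⟩ := invSqrt_bounds (F := B) (K := L * Lᵀ + N) hd hSs (by rw [hS]; abel)
    fun x => by
      rw [Matrix.add_mulVec, dotProduct_add]
      linarith [hN x, dotProduct_mul_transpose_mulVec_nonneg L x]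
  obtain ⟨-, hTL⟩ := invSqrt_bounds (F := L) (K := B * Bᵀ + N) hd hSs (by rw [hS]; abel)
    fun x => by
      rw [Matrix.add_mulVec, dotProduct_add]
      linarith [hN x, dotProduct_mul_transpose_mulVec_nonneg B x]
  have hTs := invSqrt_transpose S
  set T := invSqrt S with hTdef
  set n : ℝ := ((Fintype.card ι : ℕ) : ℝ) with hn
  have hn1 : 1 ≤ n := by
    rw [hn]; exact_mod_cast Fintype.card_pos
  have hsn : 1 ≤ √n := Real.one_le_sqrt.2 hn1
  have hgn : ‖G‖ ≤ √n * ζ := norm_le_sqrt_card_mul hζ0 hG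
  have hgn' : ‖G'‖ ≤ √n * ζ := norm_le_sqrt_card_mul hζ0 hG'
  have e1 := frobNorm_factor_error_le hTs hT hTB hM hζ hgn
  have e2 := frobNorm_factor_error_le hTs hT hTL hM' hζ hgn'
  have e3 : frobNorm (T * (N' - N) * T) ≤ √n * (γ * d⁻¹) := by
    have h1 : T * (N' - N) * T = T * (N' - N) * Tᵀ := by rw [hTs]
    rw [h1]
    refine (frobNorm_mul_transpose_le (norm_mul_le_of_le hT hNN) hT).trans (le_of_eq ?_)
    have : (√d)⁻¹ * (√d)⁻¹ = d⁻¹ := by rw [← mul_inv, Real.mul_self_sqrt hd.le]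
    rw [← this, hn]
    ring
  have hsplit : T * ((B + G) * M * (B + G)ᵀ + (L + G') * M' * (L + G')ᵀ + N' - S) * T =
      T * ((B + G) * M * (B + G)ᵀ - B * Bᵀ) * T + T * ((L + G') * M' * (L + G')ᵀ - L * Lᵀ) * T +
        T * (N' - N) * T := by
    rw [← Matrix.add_mul, ← Matrix.mul_add, ← Matrix.add_mul, ← Matrix.mul_add, hS]
    congr 2
    abel
  have hcr : ∀ {x : ℝ}, x ≤ R ^ 2 → √x ≤ R := fun h => by
    simpa [Real.sqrt_sq hR] using Real.sqrt_le_sqrt h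
  rw [relFrobNorm, ← hTdef, hsplit, ← hn]
  set w := (√d)⁻¹ * (√n * ζ) with hw
  have hsd : 0 < √d := Real.sqrt_pos.2 hd
  have hw0 : 0 ≤ w := by positivity
  have hsdd : (√d)⁻¹ ≤ d⁻¹ := by
    rw [inv_le_inv₀ hsd hd]
    exact Real.le_sqrt_of_sq_le (by nlinarith)
  have hw1 : w ≤ √n * (ζ / d) := by
    calc w ≤ d⁻¹ * (√n * ζ) := mul_le_mul_of_nonneg_right hsdd (by positivity)
      _ = _ := by ring
  have hw2 : w ^ 2 = n * ζ ^ 2 / d := by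
    rw [hw, mul_pow, mul_pow, inv_pow, Real.sq_sqrt hd.le, Real.sq_sqrt (by linarith)]
    ring
  rw [inv_mul_le_iff₀ (by linarith)]
  have hA : ζ + 4 * w + 2 * w ^ 2 ≤ √n * ((5 * ζ + 2 * √n * ζ ^ 2) / d) := by
    have h1 : ζ ≤ √n * (ζ / d) := by
      have : ζ ≤ ζ / d := by
        rw [le_div_iff₀ hd]; nlinarith
      nlinarith
    have h2 : √n * ((5 * ζ + 2 * √n * ζ ^ 2) / d) =
        √n * (ζ / d) + 4 * (√n * (ζ / d)) + 2 * ((√n * √n) * ζ ^ 2 / d) := by ring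
    rw [h2, Real.mul_self_sqrt (by linarith), hw2]
    linarith
  have hA0 : 0 ≤ ζ + 4 * w + 2 * w ^ 2 := by positivity
  calc _ ≤ R * (ζ + 4 * w + 2 * w ^ 2) + R * (ζ + 4 * w + 2 * w ^ 2) + √n * (γ * d⁻¹) := by
        refine (frobNorm_add_le _ _).trans (add_le_add ((frobNorm_add_le _ _).trans
          (add_le_add (e1.trans ?_) (e2.trans ?_))) e3)
        · exact mul_le_mul_of_nonneg_right (hcr hr) hA0
        · exact mul_le_mul_of_nonneg_right (hcr hr') hA0
    _ ≤ R * (√n * ((5 * ζ + 2 * √n * ζ ^ 2) / d)) + R * (√n * ((5 * ζ + 2 * √n * ζ ^ 2) / d)) +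
        √n * (γ * d⁻¹) := by gcongr
    _ = _ := by ring

end RelFrob

/-! ### Sparsity and adaptive thresholding -/

section Threshold

open scoped Matrix.Norms.L2Operator

variable {ι : Type*} [Fintype ι] [DecidableEq ι]

/-- `|x| ^ q` with the convention `0 ^ 0 = 0`. -/
noncomputable def absPow (q x : ℝ) : ℝ := if x = 0 then 0 else |x| ^ q

theorem absPow_nonneg (q x : ℝ) : 0 ≤ absPow q x := by
  unfold absPow
  split_ifs <;> positivity

theorem sum_absPow_le_sparsity (q : ℝ) (S : Matrix ι ι ℝ) (i : ι) :
    ∑ j, absPow q (S i j) ≤ sparsity q S :=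
  le_ciSup (f := fun i => ∑ j, absPow q (S i j)) (Set.finite_range _).bddAbove i

theorem sparsity_nonneg (q : ℝ) (S : Matrix ι ι ℝ) : 0 ≤ sparsity q S :=
  Real.iSup_nonneg fun _ => Finset.sum_nonneg fun _ _ => absPow_nonneg _ _

theorem abs_le_mul_absPow {q x d : ℝ} (hq : 0 ≤ q) (hq1 : q < 1) (hd : 1 ≤ d) (hx : |x| ≤ d) :
    |x| ≤ d * absPow q x := by
  unfold absPow
  split_ifs with h
  · simp [h]
  · have h0 : 0 < |x| := abs_pos.2 h
    calc |x| = |x| ^ (1 - q) * |x| ^ q := by rw [← Real.rpow_add h0]; simp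
      _ ≤ d ^ (1 - q) * |x| ^ q := by gcongr
      _ ≤ d ^ (1 : ℝ) * |x| ^ q := by gcongr; linarith
      _ = _ := by rw [Real.rpow_one]

theorem sum_abs_le_mul_sparsity {q d : ℝ} (hq : 0 ≤ q) (hq1 : q < 1) (hd : 1 ≤ d)
    {S : Matrix ι ι ℝ} (hS : ∀ i j, |S i j| ≤ d) (i : ι) :
    ∑ j, |S i j| ≤ d * sparsity q S := by
  calc _ ≤ ∑ j, d * absPow q (S i j) :=
        Finset.sum_le_sum fun j _ => abs_le_mul_absPow hq hq1 hd (hS i j)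
    _ = d * ∑ j, absPow q (S i j) := by rw [Finset.mul_sum]
    _ ≤ _ := mul_le_mul_of_nonneg_left (sum_absPow_le_sparsity q S i) (by linarith)

theorem le_sparsity {q d : ℝ} (hq : 0 ≤ q) (hq1 : q < 1) (hd : 0 < d) (hd1 : d ≤ 1)
    {S : Matrix ι ι ℝ} (i : ι) (hS : d ≤ S i i) : d ≤ sparsity q S := by
  have h0 : 0 < S i i := hd.trans_le hS
  calc d = d ^ (1 : ℝ) := (Real.rpow_one d).symm
    _ ≤ d ^ q := Real.rpow_le_rpow_of_exponent_ge hd hd1 hq1.le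
    _ ≤ absPow q (S i i) := by
        rw [absPow, if_neg h0.ne', abs_of_pos h0]
        gcongr
    _ ≤ ∑ j, absPow q (S i j) :=
        Finset.single_le_sum (f := fun j => absPow q (S i j)) (fun j _ => absPow_nonneg _ _)
          (Finset.mem_univ i)
    _ ≤ _ := sum_absPow_le_sparsity q S i

open Classical in
/-- The effect of thresholding on one entry: the error is at most the threshold plus the estimation
error. -/
theorem abs_threshold_sub_le {s : ℝ → ℝ → ℝ} (hs : IsShrinkage s) {t z x b : ℝ} (ht : 0 ≤ t)
    (hz : |z - x| ≤ b) : |(if t ≤ |z| then s t z else 0) - x| ≤ t + b := by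
  split_ifs with h
  · have h1 := (hs t z ht h).2
    calc _ = |(s t z - z) + (z - x)| := by ring_nf
      _ ≤ _ := (abs_add_le _ _).trans (add_le_add h1 hz)
  · rw [zero_sub, abs_neg]
    have h1 : |x| ≤ |z| + |z - x| := by
      have := abs_sub_abs_le_abs_sub x z
      rw [abs_sub_comm x z] at this
      linarith
    linarith [not_le.1 h]

open Classical in
/-- If the threshold exceeds twice the estimation error, then thresholding one entry `x` costs at
most a multiple of `t ^ (1 - q) |x| ^ q`; in particular vanishing entries are recovered. -/
theorem abs_threshold_sub_le_absPow {s : ℝ → ℝ → ℝ} (hs : IsShrinkage s) {t z x b q : ℝ}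
    (hq : 0 ≤ q) (hq1 : q < 1) (ht : 0 < t) (hb : 2 * b ≤ t) (hz : |z - x| ≤ b) :
    |(if t ≤ |z| then s t z else 0) - x| ≤ 4 * t ^ (1 - q) * absPow q x := by
  have hzx : |z| ≤ |x| + b := by linarith [abs_sub_abs_le_abs_sub z x]
  have hxz : |x| ≤ |z| + b := by
    have := abs_sub_abs_le_abs_sub x z
    rw [abs_sub_comm x z] at this
    linarith
  by_cases hx : x = 0
  · have h1 : ¬ t ≤ |z| := by
      rw [hx, abs_zero] at hzx
      linarith
    simp [if_neg h1, hx, absPow]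
  have hx0 : 0 < |x| := abs_pos.2 hx
  rw [absPow, if_neg hx]
  have htq : 0 < t ^ (1 - q) := Real.rpow_pos_of_pos ht _
  have hxq : 0 < |x| ^ q := Real.rpow_pos_of_pos hx0 _
  have h2q : ∀ e : ℝ, e ≤ 1 → (2 : ℝ) ^ e ≤ 2 := fun e he => by
    calc (2 : ℝ) ^ e ≤ 2 ^ (1 : ℝ) := Real.rpow_le_rpow_of_exponent_le (by norm_num) he
      _ = 2 := Real.rpow_one 2
  split_ifs with h
  · have h1 := abs_threshold_sub_le hs ht.le hz
    rw [if_pos h] at h1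
    have h2 : t ≤ 2 * |x| := by linarith
    have h3 : t ≤ 2 * (t ^ (1 - q) * |x| ^ q) := by
      calc t = t ^ (1 - q) * t ^ q := by rw [← Real.rpow_add ht]; simp
        _ ≤ t ^ (1 - q) * (2 * |x|) ^ q := by gcongr
        _ = t ^ (1 - q) * (2 ^ q * |x| ^ q) := by
            rw [Real.mul_rpow (by norm_num) hx0.le]
        _ ≤ t ^ (1 - q) * (2 * |x| ^ q) := by gcongr; exact h2q q hq1.le
        _ = _ := by ring
    linarith
  · rw [zero_sub, abs_neg]
    have h2 : |x| ≤ 2 * t := by linarith [not_le.1 h]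
    have h3 : |x| ≤ 2 * (t ^ (1 - q) * |x| ^ q) := by
      calc |x| = |x| ^ (1 - q) * |x| ^ q := by rw [← Real.rpow_add hx0]; simp
        _ ≤ (2 * t) ^ (1 - q) * |x| ^ q := by gcongr
        _ = 2 ^ (1 - q) * t ^ (1 - q) * |x| ^ q := by
            rw [Real.mul_rpow (by norm_num) ht.le]
        _ ≤ 2 * t ^ (1 - q) * |x| ^ q := by gcongr; exact h2q _ (by linarith)
        _ = _ := by ring
    have := mul_pos htq hxq
    linarith

theorem sqrt_mul_mem_Icc {x y a b : ℝ} (ha : 0 ≤ a) (hx : a ≤ x) (hx' : x ≤ b) (hy : a ≤ y)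
    (hy' : y ≤ b) : a ≤ √(x * y) ∧ √(x * y) ≤ b := by
  constructor
  · exact Real.le_sqrt_of_sq_le (by nlinarith)
  · refine Real.sqrt_le_iff.2 ⟨by linarith, by nlinarith⟩

theorem abs_adaptiveThreshold_sub_le {s : ι → ι → ℝ → ℝ → ℝ} (hs : ∀ i l, IsShrinkage (s i l))
    {A N : Matrix ι ι ℝ} {τ b d : ℝ} (hτ : 0 ≤ τ) (hAN : ∀ i l, |A i l - N i l| ≤ b)
    (hNd : ∀ i, N i i ≤ d) (hN0 : ∀ i, b ≤ N i i) (hb : b ≤ d) (i l : ι) :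
    |adaptiveThreshold s τ A i l - N i l| ≤ 2 * d * τ + b := by
  unfold adaptiveThreshold
  have hb0 : 0 ≤ b := (abs_nonneg _).trans (hAN i i)
  have hA : ∀ i, 0 ≤ A i i ∧ A i i ≤ 2 * d := fun i => by
    have h1 := abs_le.1 (hAN i i)
    constructor <;> linarith [hNd i, hN0 i]
  have hd : 0 ≤ d := hb0.trans hb
  split_ifs with h h'
  · refine (hAN i l).trans ?_
    have : 0 ≤ 2 * d * τ := by positivity
    linarith
  all_goals
    have h2 := sqrt_mul_mem_Icc le_rfl (hA i).1 (hA i).2 (hA l).1 (hA l).2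
    have h1 := abs_threshold_sub_le (hs i l) (mul_nonneg hτ h2.1) (hAN i l)
    first | rw [if_pos h'] at h1 | rw [if_neg h'] at h1
    have h3 : τ * √(A i i * A l l) ≤ 2 * d * τ := by nlinarith [h2.2]
    linarith

/-- Adaptive thresholding with a sufficiently large threshold estimates a sparse matrix in operator
norm. -/
theorem norm_adaptiveThreshold_sub_le {s : ι → ι → ℝ → ℝ → ℝ} (hs : ∀ i l, IsShrinkage (s i l))
    {A N : Matrix ι ι ℝ} {τ b c d q : ℝ} (hq : 0 ≤ q) (hq1 : q < 1) (hNs : N.IsSymm)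
    (hτ : 0 < τ) (hAN : ∀ i l, |A i l - N i l| ≤ b) (hc : 0 < c) (hcd : c ≤ d)
    (hNd : ∀ i, N i i ≤ d) (hNc : ∀ i, c ≤ N i i) (hbc : 2 * b ≤ c) (hbτ : 4 * b ≤ c * τ) :
    ‖adaptiveThreshold s τ A - N‖ ≤ 4 * (2 * d * τ) ^ (1 - q) * sparsity q N := by
  have hd : 0 < d := hc.trans_le hcd
  have hK : 0 ≤ 4 * (2 * d * τ) ^ (1 - q) := by positivity
  have hA : ∀ i, c / 2 ≤ A i i ∧ A i i ≤ 2 * d := fun i => by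
    have h1 := abs_le.1 (hAN i i)
    constructor <;> linarith [hNd i, hNc i]
  have key : ∀ i l, |(adaptiveThreshold s τ A - N) i l| ≤
      4 * (2 * d * τ) ^ (1 - q) * absPow q (N i l) := fun i l => by
    rw [Matrix.sub_apply]
    unfold adaptiveThreshold
    by_cases h : i = l
    · subst h
      rw [if_pos rfl]
      refine (hAN i i).trans ?_
      have hN0 : 0 < N i i := hc.trans_le (hNc i)
      rw [absPow, if_neg hN0.ne', abs_of_pos hN0]
      have hb0 : 0 ≤ b := (abs_nonneg _).trans (hAN i i)
      rcases hb0.eq_or_lt with hb | hb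
      · rw [← hb]; positivity
      have h1 : b ≤ 2 * d * τ := by nlinarith
      calc b = b ^ (1 - q) * b ^ q := by rw [← Real.rpow_add hb]; simp
        _ ≤ (2 * d * τ) ^ (1 - q) * N i i ^ q := by
            gcongr
            linarith [hNc i]
        _ ≤ 4 * ((2 * d * τ) ^ (1 - q) * N i i ^ q) := by
            have : 0 ≤ (2 * d * τ) ^ (1 - q) * N i i ^ q := by positivity
            linarith
        _ = _ := by ring
    · rw [if_neg h]
      have h2 := sqrt_mul_mem_Icc (by positivity) (hA i).1 (hA i).2 (hA l).1 (hA l).2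
      have h3 : τ * √(A i i * A l l) ≤ 2 * d * τ := by nlinarith [h2.2]
      have h4 : τ * (c / 2) ≤ τ * √(A i i * A l l) := mul_le_mul_of_nonneg_left h2.1 hτ.le
      have h5 : 0 < τ * √(A i i * A l l) := lt_of_lt_of_le (by positivity) h4
      refine (abs_threshold_sub_le_absPow (hs i l) hq hq1 h5 (by linarith) (hAN i l)).trans ?_
      have := absPow_nonneg q (N i l)
      gcongr
  have hrow : ∀ i, ∑ l, |(adaptiveThreshold s τ A - N) i l| ≤
      4 * (2 * d * τ) ^ (1 - q) * sparsity q N := fun i => by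
    calc _ ≤ ∑ l, 4 * (2 * d * τ) ^ (1 - q) * absPow q (N i l) :=
          Finset.sum_le_sum fun l _ => key i l
      _ = 4 * (2 * d * τ) ^ (1 - q) * ∑ l, absPow q (N i l) := by rw [Finset.mul_sum]
      _ ≤ _ := mul_le_mul_of_nonneg_left (sum_absPow_le_sparsity q N i) hK
  have hcol : ∀ l, ∑ i, |(adaptiveThreshold s τ A - N) i l| ≤
      4 * (2 * d * τ) ^ (1 - q) * sparsity q N := fun l => by
    calc _ ≤ ∑ i, 4 * (2 * d * τ) ^ (1 - q) * absPow q (N l i) :=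
          Finset.sum_le_sum fun i _ => by
            rw [hNs.apply i l]
            exact key i l
      _ = 4 * (2 * d * τ) ^ (1 - q) * ∑ i, absPow q (N l i) := by rw [Finset.mul_sum]
      _ ≤ _ := mul_le_mul_of_nonneg_left (sum_absPow_le_sparsity q N l) hK
  exact norm_le_of_sum_abs_le (mul_nonneg hK (sparsity_nonneg q N)) hrow hcol

end Threshold

/-! ### Entrywise errors -/

section Entrywise

open scoped Matrix.Norms.L2Operator

variable {ι : Type*} [Fintype ι] [DecidableEq ι]

theorem abs_apply_le_maxNorm (A : Matrix ι ι ℝ) (i j : ι) : |A i j| ≤ maxNorm A :=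
  (le_ciSup (f := fun j => |A i j|) (Set.finite_range _).bddAbove j).trans
    (le_ciSup (f := fun i => ⨆ j, |A i j|) (Set.finite_range _).bddAbove i)

theorem maxNorm_le {A : Matrix ι ι ℝ} {b : ℝ} (hb : 0 ≤ b) (h : ∀ i j, |A i j| ≤ b) :
    maxNorm A ≤ b :=
  Real.iSup_le (fun i => Real.iSup_le (fun j => h i j) hb) hb

theorem abs_factor_error_apply_le {r : Type*} [Fintype r] [DecidableEq r] {F G : Matrix ι r ℝ}
    {M : Matrix r r ℝ} {f ζ : ℝ} (hF : ∀ i, ‖row i F‖ ≤ f) (hG : ∀ i, ‖row i G‖ ≤ ζ)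
    (hM : ‖M - 1‖ ≤ ζ) (hζ : ζ ≤ 1) (hf : 1 ≤ f) (i l : ι) :
    |((F + G) * M * (F + G)ᵀ - F * Fᵀ) i l| ≤ 7 * f ^ 2 * ζ := by
  have hζ0 : 0 ≤ ζ := (norm_nonneg _).trans hM
  have hM2 : ‖M‖ ≤ 2 := by
    have : M = 1 + (M - 1) := by abel
    rw [this]
    exact (norm_add_le _ _).trans (by linarith [norm_one_le (n := r)])
  have h : (F + G) * M * (F + G)ᵀ - F * Fᵀ = F * (M - 1) * Fᵀ + F * M * Gᵀ + G * M * Fᵀ +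
      G * M * Gᵀ := by
    simp only [Matrix.transpose_add, Matrix.mul_add, Matrix.add_mul, Matrix.mul_sub,
      Matrix.sub_mul, Matrix.mul_one]
    abel
  have hb : ∀ {X Y : Matrix ι r ℝ} {K : Matrix r r ℝ} {x y κ : ℝ}, 0 ≤ κ → 0 ≤ x →
      ‖row i X‖ ≤ x → ‖K‖ ≤ κ → ‖row l Y‖ ≤ y → |(X * K * Yᵀ) i l| ≤ x * κ * y :=
    fun hκ hx h1 h2 h3 => (abs_mul_mul_transpose_apply_le _ _ _ i l).trans (by gcongr)
  have e1 := hb hζ0 (by linarith) (hF i) hM (hF l)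
  have e2 := hb zero_le_two (by linarith) (hF i) hM2 (hG l)
  have e3 := hb zero_le_two hζ0 (hG i) hM2 (hF l)
  have e4 := hb zero_le_two hζ0 (hG i) hM2 (hG l)
  rw [h, Matrix.add_apply, Matrix.add_apply, Matrix.add_apply]
  refine (abs_add_le _ _).trans ((add_le_add ((abs_add_le _ _).trans (add_le_add
    ((abs_add_le _ _).trans (add_le_add e1 e2)) e3)) e4).trans ?_)
  have h1 : ζ * ζ ≤ ζ := by nlinarith
  have h2 : f ≤ f ^ 2 := by nlinarith
  nlinarith [mul_le_mul_of_nonneg_right h2 hζ0]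

/-- The expansion of a principal part with one common bound for all errors. -/
theorem principalPart_expansion_uniform {k : ℕ} {S R N E P : Matrix ι ι ℝ}
    {B : Matrix ι (Fin k) ℝ} {φ d e m t : ℝ} (hP : IsPrincipalPart S k P) (hφ : 0 < φ)
    (hd : 1 ≤ d) (he : 0 ≤ e) (hm : 0 ≤ m)
    (hB : ∀ c, φ * (c ⬝ᵥ c) ≤ (B *ᵥ c) ⬝ᵥ (B *ᵥ c))
    (hS : S = B * Bᵀ + R + N + E) (hRB : R * B = 0) (hR : ‖R‖ ≤ φ / 8)
    (hSd : ∀ i j, |S i j| ≤ d) (hAd : ∀ i j, |(B * Bᵀ + R) i j| ≤ d) (hE : ∀ i j, |E i j| ≤ e)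
    (hNr : ∀ i, ∑ j, |N i j| ≤ m) (hNc : ∀ j, ∑ i, |N i j| ≤ m)
    (hBd : ∀ i, ‖row i B‖ ≤ d) (hφd : φ ≤ d * Fintype.card ι)
    (hθ : Fintype.card ι * (Fintype.card ι * e + m) / φ ^ 2 ≤ t) (ht : 10 * d ^ 2 * t ≤ 1) :
    ∃ (G : Matrix ι (Fin k) ℝ) (M : Matrix (Fin k) (Fin k) ℝ), P = (B + G) * M * (B + G)ᵀ ∧
      (∀ i, ‖row i G‖ ≤ 10 * d ^ 2 * t) ∧
      (∀ i, ‖row i G‖ ≤ 10 * d ^ 2 * t * √(φ / Fintype.card ι)) ∧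
      ‖M - 1‖ ≤ 10 * d ^ 2 * t ∧
      ∀ i j, |(P - B * Bᵀ) i j| ≤ 7 * d ^ 2 * (10 * d ^ 2 * t) := by
  set n : ℝ := ((Fintype.card ι : ℕ) : ℝ) with hn
  have hn0 : 0 < n := by
    by_contra h
    have : n ≤ 0 := not_lt.1 h
    nlinarith
  have ht0 : 0 ≤ t := le_trans (by positivity) hθ
  have hdd : 10 * d * t ≤ 10 * d ^ 2 * t := by
    have : d ≤ d ^ 2 := by nlinarith
    gcongr
  obtain ⟨G, M, hPe, hG, hM⟩ := principalPart_expansion hP hφ hd he hm hB hS hRB hR hSd hAd hE hNr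
    hNc hφd ((mul_le_mul_of_nonneg_left hθ (by positivity)).trans (hdd.trans ht))
  have hsφ : 0 < √φ := Real.sqrt_pos.2 hφ
  have hsn : 0 < √n := Real.sqrt_pos.2 hn0
  have hM' : ‖M - 1‖ ≤ 10 * d ^ 2 * t :=
    hM.trans ((mul_le_mul_of_nonneg_left hθ (by positivity)).trans hdd)
  have hG1 : ∀ i, ‖row i G‖ ≤ 5 * d * t * √(φ / n) := fun i => by
    refine (hG i).trans ?_
    have h1 : √n * (n * e + m) / (φ * √φ) = n * (n * e + m) / φ ^ 2 * √(φ / n) := by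
      rw [Real.sqrt_div hφ.le]
      have e1 : n = √n * √n := (Real.mul_self_sqrt hn0.le).symm
      have e2 : φ = √φ * √φ := (Real.mul_self_sqrt hφ.le).symm
      rw [div_mul_div_comm, div_eq_div_iff (by positivity) (by positivity)]
      generalize n * e + m = η
      calc √n * η * (φ ^ 2 * √n) = (√n * √n) * η * φ * φ := by ring
        _ = n * η * φ * (√φ * √φ) := by rw [← e1, ← e2]
        _ = _ := by ring
    rw [h1, ← mul_assoc]
    gcongr
  have hs : √(φ / n) ≤ d := by
    refine Real.sqrt_le_iff.2 ⟨by linarith, ?_⟩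
    rw [div_le_iff₀ hn0]
    nlinarith
  have hG2 : ∀ i, ‖row i G‖ ≤ 10 * d ^ 2 * t := fun i => (hG1 i).trans (by
    calc 5 * d * t * √(φ / n) ≤ 5 * d * t * d := by gcongr
      _ ≤ 10 * d ^ 2 * t := by
        have : 0 ≤ d ^ 2 * t := by positivity
        linarith)
  refine ⟨G, M, hPe, hG2, fun i => (hG1 i).trans ?_, hM', fun i j => ?_⟩
  · refine mul_le_mul_of_nonneg_right (le_trans ?_ hdd) (Real.sqrt_nonneg _)
    have : 0 ≤ d * t := by positivity
    linarith
  · rw [hPe]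
    exact abs_factor_error_apply_le hBd hG2 hM' ht hd i j

end Entrywise

/-! ### Rates -/

section Rates

/-- Comparison of the rates of the global and the local expansion with `ω`. Here `m` is the sparsity
level and `ε = √(log p / T)`. -/
theorem rates_le {p m ε c a₁ a₂ : ℝ} (hp : 1 ≤ p) (hm : 0 ≤ m) (hε : 0 ≤ ε) (hc : 0 < c)
    (ha₁ : a₁ ≤ 1) (ha₂ : a₂ ≤ 1) :
    ε ≤ p ^ (2 * (1 - a₁)) * ε + m * p ^ (1 - 2 * a₁) ∧
    p ^ (2 * (1 - a₁)) * ε + m * p ^ (1 - 2 * a₁) ≤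
      p ^ (2 * c * (1 - a₂)) * (p ^ (2 * (1 - a₁)) * ε + m * p ^ (1 - 2 * a₁)) +
        m * p ^ (c * (1 - 2 * a₂)) ∧
    p ^ (2 * c * (1 - a₂)) * (p ^ (2 * (1 - a₁)) * ε + m * p ^ (1 - 2 * a₁)) +
        m * p ^ (c * (1 - 2 * a₂)) ≤
      p ^ (5 / 2 * (1 - a₁) + 5 / 2 * c * (1 - a₂)) * ε + m / √(p ^ (c * (5 * a₂ - 3)))
        + m / √(p ^ (5 * a₁ - 3 - 5 * c * (1 - a₂))) := by
  have hp0 : 0 < p := by linarith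
  have h1a : 0 ≤ 1 - a₁ := by linarith
  have h1b : 0 ≤ c * (1 - a₂) := mul_nonneg hc.le (by linarith)
  have hsq : ∀ x : ℝ, m / √(p ^ x) = m * p ^ (-x / 2) := fun x => by
    rw [Real.sqrt_eq_rpow, ← Real.rpow_mul hp0.le, div_eq_mul_inv, ← Real.rpow_neg hp0.le]
    congr 2
    ring
  have hone : ∀ {x : ℝ}, 0 ≤ x → 1 ≤ p ^ x := fun hx => Real.one_le_rpow hp hx
  have hu : 0 ≤ p ^ (2 * (1 - a₁)) * ε + m * p ^ (1 - 2 * a₁) := by positivity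
  refine ⟨?_, ?_, ?_⟩
  · have h2 := hone (x := 2 * (1 - a₁)) (by linarith)
    have h3 : 0 ≤ m * p ^ (1 - 2 * a₁) := by positivity
    nlinarith
  · have h2 := hone (x := 2 * c * (1 - a₂)) (by linarith)
    have h3 : 0 ≤ m * p ^ (c * (1 - 2 * a₂)) := by positivity
    nlinarith
  · rw [hsq, hsq, mul_add, ← mul_assoc, ← Real.rpow_add hp0]
    have e1 : p ^ (2 * c * (1 - a₂) + 2 * (1 - a₁)) * ε ≤
        p ^ (5 / 2 * (1 - a₁) + 5 / 2 * c * (1 - a₂)) * ε :=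
      mul_le_mul_of_nonneg_right (Real.rpow_le_rpow_of_exponent_le hp (by linarith)) hε
    have e2 : p ^ (2 * c * (1 - a₂)) * (m * p ^ (1 - 2 * a₁)) ≤
        m * p ^ (-(5 * a₁ - 3 - 5 * c * (1 - a₂)) / 2) := by
      rw [mul_left_comm, ← Real.rpow_add hp0]
      exact mul_le_mul_of_nonneg_left (Real.rpow_le_rpow_of_exponent_le hp (by linarith)) hm
    have e3 : m * p ^ (c * (1 - 2 * a₂)) ≤ m * p ^ (-(c * (5 * a₂ - 3)) / 2) :=
      mul_le_mul_of_nonneg_left (Real.rpow_le_rpow_of_exponent_le hp (by linarith)) hm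
    linarith

theorem strength_ratio_le {p φ e m a b d K ε : ℝ} (hp : 0 < p) (hb : 0 < b) (hφ : φ = b * p ^ a)
    (he : e = K * ε) :
    p * (p * e + d * m) / φ ^ 2 =
      (K * (p ^ (2 * (1 - a)) * ε) + d * (m * p ^ (1 - 2 * a))) / b ^ 2 := by
  have h0 : 0 < p ^ a := Real.rpow_pos_of_pos hp a
  have h1 : p ^ (2 * (1 - a)) = p ^ 2 / (p ^ a) ^ 2 := by
    rw [← Real.rpow_natCast, ← Real.rpow_natCast, ← Real.rpow_mul hp.le, ← Real.rpow_sub hp]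
    congr 1
    push_cast
    ring
  have h2 : p ^ (1 - 2 * a) = p / (p ^ a) ^ 2 := by
    rw [← Real.rpow_natCast, ← Real.rpow_mul hp.le, Real.rpow_sub hp, Real.rpow_one]
    congr 2
    push_cast
    ring
  rw [h1, h2, hφ, he]
  field_simp

/-- The strength of a group of size `s ≍ p ^ c` in terms of `p`. -/
theorem group_rpow_le {s p b d c a : ℝ} (hp : 0 < p) (hb : 0 < b) (hb1 : b ≤ 1) (hd : 1 ≤ d)
    (hs : b * p ^ c ≤ s) (hs' : s ≤ d * p ^ c) (ha : 1 / 2 ≤ a) (ha1 : a ≤ 1) :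
    s ^ (2 * (1 - a)) ≤ d * p ^ (2 * c * (1 - a)) ∧
      s ^ (1 - 2 * a) ≤ b⁻¹ * p ^ (c * (1 - 2 * a)) := by
  have hpc : 0 < p ^ c := Real.rpow_pos_of_pos hp c
  have hs0 : 0 < s := (mul_pos hb hpc).trans_le hs
  constructor
  · calc s ^ (2 * (1 - a)) ≤ (d * p ^ c) ^ (2 * (1 - a)) :=
          Real.rpow_le_rpow hs0.le hs' (by linarith)
      _ = d ^ (2 * (1 - a)) * p ^ (2 * c * (1 - a)) := by
          rw [Real.mul_rpow (by linarith) hpc.le, ← Real.rpow_mul hp.le]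
          congr 2
          ring
      _ ≤ d ^ (1 : ℝ) * p ^ (2 * c * (1 - a)) := by
          gcongr
          linarith
      _ = _ := by rw [Real.rpow_one]
  · calc s ^ (1 - 2 * a) ≤ (b * p ^ c) ^ (1 - 2 * a) :=
          Real.rpow_le_rpow_of_nonpos (by positivity) hs (by linarith)
      _ = b ^ (1 - 2 * a) * p ^ (c * (1 - 2 * a)) := by
          rw [Real.mul_rpow hb.le hpc.le, ← Real.rpow_mul hp.le]
      _ ≤ b ^ (-1 : ℝ) * p ^ (c * (1 - 2 * a)) := by
          refine mul_le_mul_of_nonneg_right ?_ (by positivity)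
          exact Real.rpow_le_rpow_of_exponent_ge hb hb1 (by linarith)
      _ = _ := by rw [Real.rpow_neg_one]

theorem sqrt_mul_le {d : ℝ} (hd : 1 ≤ d) (n l : ℕ) : √(n : ℝ) * d ≤ (n + l) * d ^ 2 + d + 1 := by
  have h1 : √(n : ℝ) ≤ n := by
    rcases Nat.eq_zero_or_pos n with h | h
    · simp [h]
    · have : (1 : ℝ) ≤ n := by exact_mod_cast h
      exact Real.sqrt_le_iff.2 ⟨by linarith, by nlinarith⟩
  have h2 : d ≤ d ^ 2 := by nlinarith
  have h3 : √(n : ℝ) * d ≤ n * d ^ 2 := by gcongr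
  have h4 : 0 ≤ (l : ℝ) * d ^ 2 := by positivity
  nlinarith

theorem mul_rpow_le_mul_self {x a b e : ℝ} (hx : 1 ≤ x) (ha : a ≤ 1) (hb : b ≤ 1) (he : 1 ≤ e) :
    b * x ^ a ≤ e * x := by
  have h1 : x ^ a ≤ x := by
    simpa using Real.rpow_le_rpow_of_exponent_le hx ha
  have h2 : 0 ≤ x ^ a := by positivity
  nlinarith

end Rates

/-! ### Principal components in the multi-level factor model -/

section ModelExpansion

open scoped Matrix.Norms.L2Operator

variable {Ω : Type*} [MeasurableSpace Ω] {μ : Measure Ω} {k : ℕ}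

/-- The assumptions on the model for a fixed sample size, with explicit constants `b`, `d`, `R`:
lower bounds on the strength of the factors and on the idiosyncratic covariance matrix, upper bounds
on the loadings, the idiosyncratic covariances and the numbers of local factors. -/
structure Model.IsRegular (M : Model μ k) (c a₁ a₂ b d : ℝ) (R : ℕ) : Prop where
  b_pos : 0 < b
  b_le : b ≤ 1
  one_le_d : 1 ≤ d
  one_le_p : 1 ≤ (M.p : ℝ)
  size_ge : ∀ j, b * (M.p : ℝ) ^ c ≤ (M.size j : ℝ)
  size_le : ∀ j, (M.size j : ℝ) ≤ d * (M.p : ℝ) ^ c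
  rank_le : ∀ j, M.rank j ≤ R
  global : ∀ x, b * (M.p : ℝ) ^ a₁ * (x ⬝ᵥ x) ≤ (M.B *ᵥ x) ⬝ᵥ (M.B *ᵥ x)
  locals : ∀ j x, b * (M.size j : ℝ) ^ a₂ * (x ⬝ᵥ x) ≤ (M.L j *ᵥ x) ⬝ᵥ (M.L j *ᵥ x)
  B_le : ∀ i a, |M.B i a| ≤ d
  L_le : ∀ j i a, |M.L j i a| ≤ d
  Su_symm : M.Su.IsSymm
  Su_ge : ∀ x, b * (x ⬝ᵥ x) ≤ x ⬝ᵥ M.Su *ᵥ x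
  Su_le : ∀ i l, |M.Su i l| ≤ d
  orth : M.Bᵀ * M.Lam = 0

namespace Model

theorem card_ind (M : Model μ k) : Fintype.card M.Ind = M.p := by
  simp [Model.p, Fintype.card_sigma]

theorem Lam_mul_transpose (M : Model μ k) :
    M.Lam * M.Lamᵀ = Matrix.blockDiagonal' fun j => M.L j * (M.L j)ᵀ := by
  rw [Lam, Matrix.blockDiagonal'_transpose, ← Matrix.blockDiagonal'_mul]

theorem blockDiag_Sig (M : Model μ k) (j : Fin M.J) : M.Sig.blockDiag' j =
    M.Bgroup j * (M.Bgroup j)ᵀ + M.L j * (M.L j)ᵀ + M.Su.blockDiag' j := by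
  rw [Sig, Lam_mul_transpose, Matrix.blockDiag'_add, Matrix.blockDiag'_add, Pi.add_apply,
    Pi.add_apply, Matrix.blockDiag'_blockDiagonal']
  rfl

/-- The rate of the global principal components. -/
noncomputable def rateGlobal (M : Model μ k) (a₁ q : ℝ) : ℝ :=
  (M.p : ℝ) ^ (2 * (1 - a₁)) * M.eps + M.m q * (M.p : ℝ) ^ (1 - 2 * a₁)

/-- The rate of the local principal components. -/
noncomputable def rateLocal (M : Model μ k) (c a₁ a₂ q : ℝ) : ℝ :=
  (M.p : ℝ) ^ (2 * c * (1 - a₂)) * M.rateGlobal a₁ q + M.m q * (M.p : ℝ) ^ (c * (1 - 2 * a₂))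

theorem m_nonneg (M : Model μ k) (q : ℝ) : 0 ≤ M.m q := sparsity_nonneg q M.Su

theorem eps_nonneg (M : Model μ k) : 0 ≤ M.eps := Real.sqrt_nonneg _

namespace IsRegular

variable {M : Model μ k} {c a₁ a₂ b d q : ℝ} {R : ℕ}

theorem p_pos (h : M.IsRegular c a₁ a₂ b d R) : 0 < (M.p : ℝ) := by linarith [h.one_le_p]

theorem size_pos (h : M.IsRegular c a₁ a₂ b d R) (j : Fin M.J) : 0 < (M.size j : ℝ) :=
  (mul_pos h.b_pos (Real.rpow_pos_of_pos h.p_pos c)).trans_le (h.size_ge j)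

theorem one_le_size (h : M.IsRegular c a₁ a₂ b d R) (j : Fin M.J) : 1 ≤ (M.size j : ℝ) := by
  have := h.size_pos j
  exact_mod_cast this

theorem rateGlobal_nonneg (h : M.IsRegular c a₁ a₂ b d R) : 0 ≤ M.rateGlobal a₁ q := by
  have := h.p_pos
  have := M.m_nonneg q
  have := M.eps_nonneg
  unfold rateGlobal
  positivity

theorem abs_LL_le (h : M.IsRegular c a₁ a₂ b d R) (j : Fin M.J) (i l : Fin (M.size j)) :
    |(M.L j * (M.L j)ᵀ) i l| ≤ R * d ^ 2 := by
  rw [Matrix.mul_apply]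
  calc _ ≤ ∑ a, |M.L j i a * (M.L j)ᵀ a l| := Finset.abs_sum_le_sum_abs _ _
    _ ≤ ∑ _a : Fin (M.rank j), d ^ 2 := Finset.sum_le_sum fun a _ => by
        rw [abs_mul, sq]
        exact mul_le_mul (h.L_le j i a) (h.L_le j l a) (abs_nonneg _) (by linarith [h.one_le_d])
    _ = M.rank j * d ^ 2 := by simp
    _ ≤ _ := by
        gcongr
        exact_mod_cast h.rank_le j

theorem abs_BB_le (h : M.IsRegular c a₁ a₂ b d R) (i l : M.Ind) :
    |(M.B * M.Bᵀ) i l| ≤ k * d ^ 2 := by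
  rw [Matrix.mul_apply]
  calc _ ≤ ∑ a, |M.B i a * M.Bᵀ a l| := Finset.abs_sum_le_sum_abs _ _
    _ ≤ ∑ _a : Fin k, d ^ 2 := Finset.sum_le_sum fun a _ => by
        rw [abs_mul, sq]
        exact mul_le_mul (h.B_le i a) (h.B_le l a) (abs_nonneg _) (by linarith [h.one_le_d])
    _ = _ := by simp

theorem abs_LamLam_le (h : M.IsRegular c a₁ a₂ b d R) (i l : M.Ind) :
    |(M.Lam * M.Lamᵀ) i l| ≤ R * d ^ 2 := by
  rw [M.Lam_mul_transpose]
  obtain ⟨j, i⟩ := i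
  obtain ⟨j', l⟩ := l
  by_cases hj : j = j'
  · subst hj
    rw [Matrix.blockDiagonal'_apply_eq]
    exact h.abs_LL_le j i l
  · rw [Matrix.blockDiagonal'_apply_ne _ _ _ hj, abs_zero]
    positivity

theorem norm_LamLam_le (h : M.IsRegular c a₁ a₂ b d R) :
    ‖M.Lam * M.Lamᵀ‖ ≤ R * d ^ 3 * (M.p : ℝ) ^ c := by
  have hs : (M.Lam * M.Lamᵀ).IsSymm := by
    rw [Matrix.IsSymm, Matrix.transpose_mul, Matrix.transpose_transpose]
  have hd := h.one_le_d
  have hp := h.p_pos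
  have hr : ∀ i, ∑ l, |(M.Lam * M.Lamᵀ) i l| ≤ R * d ^ 3 * (M.p : ℝ) ^ c := fun ⟨j, i⟩ => by
    rw [M.Lam_mul_transpose, Fintype.sum_sigma, Finset.sum_eq_single j]
    · calc _ ≤ ∑ _l : Fin (M.size j), R * d ^ 2 := Finset.sum_le_sum fun l _ => by
            rw [Matrix.blockDiagonal'_apply_eq]
            exact h.abs_LL_le j i l
        _ = M.size j * (R * d ^ 2) := by simp
        _ ≤ (d * (M.p : ℝ) ^ c) * (R * d ^ 2) := by
            gcongr
            exact h.size_le j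
        _ = _ := by ring
    · intro j' _ hj
      refine Finset.sum_eq_zero fun l _ => ?_
      rw [Matrix.blockDiagonal'_apply_ne _ _ _ hj.symm, abs_zero]
    · simp
  exact norm_le_of_sum_abs_le (by positivity) hr fun l => by
    simpa only [hs.apply] using hr l

theorem norm_row_B_le (h : M.IsRegular c a₁ a₂ b d R) (i : M.Ind) : ‖row i M.B‖ ≤ √k * d := by
  have hd := h.one_le_d
  simpa using norm_row_le (by linarith) i (h.B_le i)

theorem norm_row_L_le (h : M.IsRegular c a₁ a₂ b d R) (j : Fin M.J) (i : Fin (M.size j)) :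
    ‖row i (M.L j)‖ ≤ √R * d := by
  have hd := h.one_le_d
  refine (norm_row_le (by linarith) i (h.L_le j i)).trans ?_
  rw [Fintype.card_fin]
  gcongr
  exact_mod_cast h.rank_le j

theorem sum_abs_Su_le (h : M.IsRegular c a₁ a₂ b d R) (hq : 0 ≤ q) (hq1 : q < 1) (i : M.Ind) :
    ∑ l, |M.Su i l| ≤ d * M.m q := sum_abs_le_mul_sparsity hq hq1 h.one_le_d h.Su_le i

theorem sum_abs_Su_block_le (h : M.IsRegular c a₁ a₂ b d R) (hq : 0 ≤ q) (hq1 : q < 1)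
    (j : Fin M.J) (i : Fin (M.size j)) : ∑ l, |M.Su.blockDiag' j i l| ≤ d * M.m q := by
  refine le_trans ?_ (h.sum_abs_Su_le hq hq1 ⟨j, i⟩)
  rw [Fintype.sum_sigma]
  exact Finset.single_le_sum (f := fun j' => ∑ l, |M.Su ⟨j, i⟩ ⟨j', l⟩|)
    (fun j' _ => Finset.sum_nonneg fun l _ => abs_nonneg _) (Finset.mem_univ j)

/-- The first `k` principal components of the sample covariance matrix recover `B Bᵀ`. -/
theorem global_expansion (h : M.IsRegular c a₁ a₂ b d R) (hq : 0 ≤ q) (hq1 : q < 1)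
    (ha₁ : a₁ ≤ 1) {K D : ℝ} (hK : 0 ≤ K) (hD : D = (k + R) * d ^ 2 + d + 1)
    {S P : Matrix M.Ind M.Ind ℝ} (hP : IsPrincipalPart S k P)
    (hS : ∀ i l, |(S - M.Sig) i l| ≤ K * M.eps) (hKε : K * M.eps ≤ 1)
    (hsep : 8 * (R * d ^ 3 * (M.p : ℝ) ^ c) ≤ b * (M.p : ℝ) ^ a₁)
    (hsmall : 10 * D ^ 2 * ((K + d) / b ^ 2 * M.rateGlobal a₁ q) ≤ 1) :
    ∃ (G : Matrix M.Ind (Fin k) ℝ) (A : Matrix (Fin k) (Fin k) ℝ),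
      P = (M.B + G) * A * (M.B + G)ᵀ ∧
      (∀ i, ‖row i G‖ ≤ 10 * D ^ 2 * ((K + d) / b ^ 2 * M.rateGlobal a₁ q)) ∧
      (∀ i, ‖row i G‖ ≤ 10 * D ^ 2 * ((K + d) / b ^ 2 * M.rateGlobal a₁ q) *
        √(b * (M.p : ℝ) ^ a₁ / M.p)) ∧
      ‖A - 1‖ ≤ 10 * D ^ 2 * ((K + d) / b ^ 2 * M.rateGlobal a₁ q) ∧
      ∀ i l, |(P - M.B * M.Bᵀ) i l| ≤
        7 * D ^ 2 * (10 * D ^ 2 * ((K + d) / b ^ 2 * M.rateGlobal a₁ q)) := by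
  have hd := h.one_le_d
  have hb := h.b_pos
  have hp := h.p_pos
  have hD1 : 1 ≤ D := by
    rw [hD]
    have : 0 ≤ ((k : ℝ) + R) * d ^ 2 := by positivity
    linarith
  have hm := M.m_nonneg q
  have hε := M.eps_nonneg
  have hLB : M.Lam * M.Lamᵀ * M.B = 0 := by
    have h1 := congrArg Matrix.transpose h.orth
    rw [Matrix.transpose_mul, Matrix.transpose_transpose, Matrix.transpose_zero] at h1
    rw [Matrix.mul_assoc, h1, Matrix.mul_zero]
  have hA : ∀ i l, |(M.B * M.Bᵀ + M.Lam * M.Lamᵀ) i l| ≤ (k + R) * d ^ 2 := fun i l => by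
    rw [Matrix.add_apply, add_mul]
    exact (abs_add_le _ _).trans (add_le_add (h.abs_BB_le i l) (h.abs_LamLam_le i l))
  have hφ : 0 < b * (M.p : ℝ) ^ a₁ := by positivity
  have key := principalPart_expansion_uniform (S := S) (R := M.Lam * M.Lamᵀ) (N := M.Su)
    (E := S - M.Sig) (B := M.B) (φ := b * (M.p : ℝ) ^ a₁) (d := D) (e := K * M.eps)
    (m := d * M.m q) (t := (K + d) / b ^ 2 * M.rateGlobal a₁ q) hP hφ hD1 (by positivity)
    (by positivity) h.global (by rw [Sig]; abel) hLB
    (h.norm_LamLam_le.trans (by linarith)) (fun i l => ?_)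
    (fun i l => (hA i l).trans (by rw [hD]; linarith)) hS (h.sum_abs_Su_le hq hq1)
    (fun l => by simpa only [h.Su_symm.apply] using h.sum_abs_Su_le hq hq1 l)
    (fun i => (h.norm_row_B_le i).trans (by rw [hD]; exact sqrt_mul_le hd k R)) ?_ ?_ hsmall
  · rw [M.card_ind] at key
    exact key
  · have e1 : S i l = (M.B * M.Bᵀ + M.Lam * M.Lamᵀ) i l + M.Su i l + (S - M.Sig) i l := by
      simp [Sig]
    rw [e1, hD]
    refine (abs_add_le _ _).trans (add_le_add ((abs_add_le _ _).trans
      (add_le_add (hA i l) (h.Su_le i l))) ((hS i l).trans hKε))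
  · rw [M.card_ind]
    exact mul_rpow_le_mul_self h.one_le_p ha₁ h.b_le hD1
  · rw [M.card_ind, strength_ratio_le hp hb rfl rfl, div_mul_eq_mul_div]
    gcongr
    unfold rateGlobal
    have e1 : 0 ≤ (M.p : ℝ) ^ (2 * (1 - a₁)) * M.eps := by positivity
    have e2 : 0 ≤ M.m q * (M.p : ℝ) ^ (1 - 2 * a₁) := by positivity
    nlinarith

/-- The first `r_j` principal components of block `j` of the remainder recover `Λ^j Λ^jᵀ`. -/
theorem local_expansion (h : M.IsRegular c a₁ a₂ b d R) (hq : 0 ≤ q) (hq1 : q < 1)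
    (ha₂ : 1 / 2 ≤ a₂) (ha₂' : a₂ ≤ 1) {j : Fin M.J} {K D : ℝ} (hK : 0 ≤ K)
    (hD : D = (k + R) * d ^ 2 + d + 1) {S Q : Matrix (Fin (M.size j)) (Fin (M.size j)) ℝ}
    (hQ : IsPrincipalPart S (M.rank j) Q)
    (hS : ∀ i l, |(S - (M.L j * (M.L j)ᵀ + M.Su.blockDiag' j)) i l| ≤ K * M.rateGlobal a₁ q)
    (hK1 : K * M.rateGlobal a₁ q ≤ 1)
    (hsmall : 10 * D ^ 2 * ((K * d + d / b) / b ^ 2 * M.rateLocal c a₁ a₂ q) ≤ 1) :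
    ∃ (G : Matrix (Fin (M.size j)) (Fin (M.rank j)) ℝ)
      (A : Matrix (Fin (M.rank j)) (Fin (M.rank j)) ℝ),
      Q = (M.L j + G) * A * (M.L j + G)ᵀ ∧
      (∀ i, ‖row i G‖ ≤ 10 * D ^ 2 * ((K * d + d / b) / b ^ 2 * M.rateLocal c a₁ a₂ q)) ∧
      (∀ i, ‖row i G‖ ≤ 10 * D ^ 2 * ((K * d + d / b) / b ^ 2 * M.rateLocal c a₁ a₂ q) *
        √(b * (M.size j : ℝ) ^ a₂ / M.size j)) ∧
      ‖A - 1‖ ≤ 10 * D ^ 2 * ((K * d + d / b) / b ^ 2 * M.rateLocal c a₁ a₂ q) ∧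
      ∀ i l, |(Q - M.L j * (M.L j)ᵀ) i l| ≤
        7 * D ^ 2 * (10 * D ^ 2 * ((K * d + d / b) / b ^ 2 * M.rateLocal c a₁ a₂ q)) := by
  have hd := h.one_le_d
  have hb := h.b_pos
  have hp := h.p_pos
  have hs := h.size_pos j
  have hD1 : 1 ≤ D := by
    rw [hD]
    have : 0 ≤ ((k : ℝ) + R) * d ^ 2 := by positivity
    linarith
  have hm := M.m_nonneg q
  have hu : 0 ≤ M.rateGlobal a₁ q := h.rateGlobal_nonneg
  have hkd : 0 ≤ (k : ℝ) * d ^ 2 := by positivity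
  have hSus : (M.Su.blockDiag' j).IsSymm := Matrix.IsSymm.ext fun i l => h.Su_symm.apply _ _
  have hφ : 0 < b * (M.size j : ℝ) ^ a₂ := by positivity
  have key := principalPart_expansion_uniform (S := S) (R := 0) (N := M.Su.blockDiag' j)
    (E := S - (M.L j * (M.L j)ᵀ + M.Su.blockDiag' j)) (B := M.L j)
    (φ := b * (M.size j : ℝ) ^ a₂) (d := D) (e := K * M.rateGlobal a₁ q)
    (m := d * M.m q) (t := (K * d + d / b) / b ^ 2 * M.rateLocal c a₁ a₂ q) hQ hφ hD1
    (by positivity) (by positivity) (h.locals j) (by rw [add_zero]; abel) (Matrix.zero_mul _)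
    (by rw [norm_zero]; positivity) (fun i l => ?_)
    (fun i l => by
      rw [add_zero]
      exact (h.abs_LL_le j i l).trans (by rw [hD]; linarith)) hS
    (h.sum_abs_Su_block_le hq hq1 j)
    (fun l => by simpa only [hSus.apply] using h.sum_abs_Su_block_le hq hq1 j l)
    (fun i => (h.norm_row_L_le j i).trans (by
      rw [hD, add_comm (k : ℝ)]; exact sqrt_mul_le hd R k)) ?_ ?_ hsmall
  · rw [Fintype.card_fin] at key
    exact key
  · have e1 : S i l = (M.L j * (M.L j)ᵀ) i l + M.Su.blockDiag' j i l +
        (S - (M.L j * (M.L j)ᵀ + M.Su.blockDiag' j)) i l := by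
      simp
    rw [e1]
    refine ((abs_add_le _ _).trans (add_le_add ((abs_add_le _ _).trans
      (add_le_add (h.abs_LL_le j i l) (h.Su_le _ _))) ((hS i l).trans hK1))).trans ?_
    rw [hD]
    linarith
  · rw [Fintype.card_fin]
    exact mul_rpow_le_mul_self (h.one_le_size j) ha₂' h.b_le hD1
  · rw [Fintype.card_fin, strength_ratio_le hs hb rfl rfl, div_mul_eq_mul_div]
    obtain ⟨g1, g2⟩ := group_rpow_le hp hb h.b_le hd (h.size_ge j) (h.size_le j) ha₂ ha₂'
    gcongr
    unfold rateLocal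
    calc K * ((M.size j : ℝ) ^ (2 * (1 - a₂)) * M.rateGlobal a₁ q) +
          d * (M.m q * (M.size j : ℝ) ^ (1 - 2 * a₂)) ≤
        K * (d * (M.p : ℝ) ^ (2 * c * (1 - a₂)) * M.rateGlobal a₁ q) +
          d * (M.m q * (b⁻¹ * (M.p : ℝ) ^ (c * (1 - 2 * a₂)))) := by gcongr
      _ = K * d * ((M.p : ℝ) ^ (2 * c * (1 - a₂)) * M.rateGlobal a₁ q) +
          d / b * (M.m q * (M.p : ℝ) ^ (c * (1 - 2 * a₂))) := by ring
      _ ≤ _ := by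
          have e1 : 0 ≤ (M.p : ℝ) ^ (2 * c * (1 - a₂)) * M.rateGlobal a₁ q := by positivity
          have e2 : 0 ≤ M.m q * (M.p : ℝ) ^ (c * (1 - 2 * a₂)) := by positivity
          have e3 : 0 ≤ K * d := by positivity
          have e4 : 0 ≤ d / b := by positivity
          nlinarith [mul_nonneg e3 e2, mul_nonneg e4 e1]

end IsRegular

end Model

end ModelExpansion

/-! ### The estimator of one group -/

section GroupEstimator

open scoped Matrix.Norms.L2Operator

variable {Ω : Type*} [MeasurableSpace Ω] {μ : Measure Ω} {k : ℕ}

/-- The low-rank parts `P`, `Q` of the estimator, restricted to group `j`, are those of the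
covariance matrix up to perturbations of size `ζ` of the loadings (also relative to the strength of
the factors) and of the coefficient matrices, and the residual covariance matrix `U` is entrywise
`ζ`-close to the idiosyncratic one. -/
structure Model.GroupExpansion (M : Model μ k) (a₁ a₂ : ℝ) (j : Fin M.J)
    (P Q U : Matrix (Fin (M.size j)) (Fin (M.size j)) ℝ) (ζ : ℝ)
    (G : Matrix (Fin (M.size j)) (Fin k) ℝ) (A : Matrix (Fin k) (Fin k) ℝ)
    (G' : Matrix (Fin (M.size j)) (Fin (M.rank j)) ℝ)
    (A' : Matrix (Fin (M.rank j)) (Fin (M.rank j)) ℝ) : Prop where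
  global_eq : P = (M.Bgroup j + G) * A * (M.Bgroup j + G)ᵀ
  local_eq : Q = (M.L j + G') * A' * (M.L j + G')ᵀ
  row_global : ∀ i, ‖row i G‖ ≤ ζ
  row_local : ∀ i, ‖row i G'‖ ≤ ζ
  norm_global : ‖G‖ ≤ √((M.size j : ℝ) / M.p * (M.p : ℝ) ^ a₁) * ζ
  norm_local : ‖G'‖ ≤ √((M.size j : ℝ) ^ a₂) * ζ
  coeff_global : ‖A - 1‖ ≤ ζ
  coeff_local : ‖A' - 1‖ ≤ ζ
  global_error : ∀ i l, |(P - M.Bgroup j * (M.Bgroup j)ᵀ) i l| ≤ ζ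
  local_error : ∀ i l, |(Q - M.L j * (M.L j)ᵀ) i l| ≤ ζ
  residual_error : ∀ i l, |U i l - M.Su.blockDiag' j i l| ≤ ζ

theorem norm_le_sqrt_mul_of_row {n r : ℕ} {G : Matrix (Fin n) (Fin r) ℝ} {z t g : ℝ} (hz : 0 ≤ z)
    (hG : ∀ i, ‖row i G‖ ≤ z * √t) (hg : (n : ℝ) * t ≤ g) : ‖G‖ ≤ √g * z := by
  refine (norm_le_sqrt_card_mul (by positivity) hG).trans ?_
  rw [Fintype.card_fin, mul_left_comm, ← Real.sqrt_mul (by positivity), mul_comm]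
  gcongr

namespace Model.IsRegular

variable {c a₁ a₂ b d q : ℝ} {R : ℕ}

/-- The constant `C` depends on the constants of the model and on `K` only. -/
theorem exists_groupExpansion (k : ℕ) (hq : 0 ≤ q) (hq1 : q < 1) (hc : 0 < c) (ha₁ : a₁ ≤ 1)
    (ha₂ : 1 / 2 ≤ a₂) (ha₂' : a₂ ≤ 1) (hb : 0 < b) (hb1 : b ≤ 1) (hd : 1 ≤ d) (R : ℕ) {K : ℝ}
    (hK : 0 ≤ K) :
    ∃ C : ℝ, 1 ≤ C ∧ ∀ {Ω : Type*} [MeasurableSpace Ω] {μ : Measure Ω} (M : Model μ k),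
      M.IsRegular c a₁ a₂ b d R → 8 * (R * d ^ 3 * (M.p : ℝ) ^ c) ≤ b * (M.p : ℝ) ^ a₁ →
      C * M.omega c a₁ a₂ q ≤ 1 → ∀ (S P : Matrix M.Ind M.Ind ℝ)
        (Q : ∀ j, Matrix (Fin (M.size j)) (Fin (M.size j)) ℝ), IsPrincipalPart S k P →
        (∀ j, IsPrincipalPart ((S - P).blockDiag' j) (M.rank j) (Q j)) →
        maxNorm (S - M.Sig) ≤ K * M.eps → ∀ j, ∃ G A G' A',
          M.GroupExpansion a₁ a₂ j (P.blockDiag' j) (Q j)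
            ((S - P - Matrix.blockDiagonal' Q).blockDiag' j) (C * M.omega c a₁ a₂ q) G A G' A' := by
  obtain ⟨D, hD⟩ : ∃ D : ℝ, D = (k + R) * d ^ 2 + d + 1 := ⟨_, rfl⟩
  have hD1 : 1 ≤ D := by
    rw [hD]
    have : 0 ≤ ((k : ℝ) + R) * d ^ 2 := by positivity
    linarith
  obtain ⟨Cg, hCg⟩ : ∃ Cg : ℝ, Cg = 10 * D ^ 2 * ((K + d) / b ^ 2) := ⟨_, rfl⟩
  have hCg0 : 0 ≤ Cg := by rw [hCg]; positivity
  obtain ⟨Ce, hCe⟩ : ∃ Ce : ℝ, Ce = K + 7 * D ^ 2 * Cg := ⟨_, rfl⟩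
  have hCe0 : 0 ≤ Ce := by rw [hCe]; positivity
  have hCeK : K ≤ Ce := by rw [hCe]; linarith [show 0 ≤ 7 * D ^ 2 * Cg by positivity]
  obtain ⟨Cl, hCl⟩ : ∃ Cl : ℝ, Cl = 10 * D ^ 2 * ((Ce * d + d / b) / b ^ 2) := ⟨_, rfl⟩
  have hCl0 : 0 ≤ Cl := by rw [hCl]; positivity
  have hD7 : ∀ {x : ℝ}, 0 ≤ x → x ≤ 7 * D ^ 2 * x := fun hx => by
    have : 1 ≤ D ^ 2 := one_le_pow₀ hD1
    nlinarith
  have hCl7 := hD7 hCl0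
  have hCg7 := hD7 hCg0
  refine ⟨Ce + 7 * D ^ 2 * Cl + 1, by linarith, ?_⟩
  intro Ω _ μ M h hsep hsmall S P Q hP hQ hS j
  set C := Ce + 7 * D ^ 2 * Cl + 1 with hC
  have hp := h.p_pos
  obtain ⟨r1, r2, r3⟩ := rates_le h.one_le_p (M.m_nonneg q) M.eps_nonneg hc ha₁ ha₂'
  have r3' : M.rateLocal c a₁ a₂ q ≤ M.omega c a₁ a₂ q := r3
  have r2' : M.rateGlobal a₁ q ≤ M.rateLocal c a₁ a₂ q := r2
  have r1' : M.eps ≤ M.rateGlobal a₁ q := r1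
  have hu : 0 ≤ M.rateGlobal a₁ q := h.rateGlobal_nonneg
  set u := M.rateGlobal a₁ q
  set v := M.rateLocal c a₁ a₂ q
  set w := M.omega c a₁ a₂ q
  have hv : 0 ≤ v := hu.trans r2'
  have hw : 0 ≤ w := hv.trans r3'
  have huw : u ≤ w := r2'.trans r3'
  have hle : ∀ {x y : ℝ}, 0 ≤ x → x ≤ C → y ≤ w → 0 ≤ y → x * y ≤ C * w :=
    fun h1 h2 h3 h4 => mul_le_mul h2 h3 h4 (h1.trans h2)
  have hεe : K * M.eps ≤ Ce * u := mul_le_mul hCeK r1' M.eps_nonneg hCe0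
  have hCeu : Ce * u ≤ C * w := hle hCe0 (by linarith) huw hu
  have hCgu : Cg * u ≤ C * w := hle hCg0 (by linarith) huw hu
  have hClv : Cl * v ≤ C * w := hle hCl0 (by linarith) r3' hv
  have eg : 10 * D ^ 2 * ((K + d) / b ^ 2 * u) = Cg * u := by rw [hCg]; ring
  have el : 10 * D ^ 2 * ((Ce * d + d / b) / b ^ 2 * v) = Cl * v := by rw [hCl]; ring
  have hSE : ∀ i l, |(S - M.Sig) i l| ≤ K * M.eps := fun i l =>
    (abs_apply_le_maxNorm _ i l).trans hS
  obtain ⟨G, A, hPe, hG1, hG2, hA, hPB⟩ := h.global_expansion hq hq1 ha₁ hK hD hP hSE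
    (hεe.trans (hCeu.trans hsmall)) hsep (by rw [eg]; exact hCgu.trans hsmall)
  rw [eg] at hG1 hG2 hA hPB
  have hPBj : ∀ i l, |(P.blockDiag' j - M.Bgroup j * (M.Bgroup j)ᵀ) i l| ≤
      7 * D ^ 2 * (Cg * u) := fun i l => hPB ⟨j, i⟩ ⟨j, l⟩
  have hSP : ∀ i l, |((S - P).blockDiag' j - (M.L j * (M.L j)ᵀ + M.Su.blockDiag' j)) i l| ≤
      Ce * u := fun i l => by
    have h1 : ((S - P).blockDiag' j - (M.L j * (M.L j)ᵀ + M.Su.blockDiag' j)) i l =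
        (S - M.Sig) ⟨j, i⟩ ⟨j, l⟩ -
          (P.blockDiag' j - M.Bgroup j * (M.Bgroup j)ᵀ) i l := by
      have h2 : M.Sig ⟨j, i⟩ ⟨j, l⟩ = M.Sig.blockDiag' j i l := rfl
      rw [Matrix.sub_apply S, h2, M.blockDiag_Sig]
      simp only [Matrix.sub_apply, Matrix.add_apply, Matrix.blockDiag'_apply]
      ring
    rw [h1]
    refine (abs_sub _ _).trans ((add_le_add (hSE _ _) (hPBj i l)).trans ?_)
    rw [hCe]
    nlinarith [mul_le_mul_of_nonneg_left r1' hK]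
  obtain ⟨G', A', hQe, hG1', hG2', hA', hQL⟩ := h.local_expansion hq hq1 ha₂ ha₂' hCe0 hD (hQ j)
    hSP (hCeu.trans hsmall) (by rw [el]; exact hClv.trans hsmall)
  rw [el] at hG1' hG2' hA' hQL
  have hQw : 7 * D ^ 2 * (Cl * v) ≤ C * w := by
    rw [← mul_assoc]
    exact hle (by positivity) (by linarith) r3' hv
  refine ⟨G.submatrix (fun i => ⟨j, i⟩) id, A, G', A', ?_⟩
  constructor
  · rw [hPe]; rfl
  · exact hQe
  · exact fun i => (hG1 ⟨j, i⟩).trans hCgu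
  · exact fun i => (hG1' i).trans hClv
  · have hrow : ∀ i, ‖row i (G.submatrix (fun i => (⟨j, i⟩ : M.Ind)) id)‖ ≤
        Cg * u * √(b * (M.p : ℝ) ^ a₁ / M.p) := fun i => hG2 ⟨j, i⟩
    refine (norm_le_sqrt_mul_of_row (by positivity) hrow ?_).trans
      (mul_le_mul_of_nonneg_left hCgu (Real.sqrt_nonneg _))
    rw [div_mul_eq_mul_div, mul_div_assoc']
    gcongr
    exact mul_le_of_le_one_left (by positivity) hb1
  · refine (norm_le_sqrt_mul_of_row (z := Cl * v) (by positivity) hG2' ?_).trans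
      (mul_le_mul_of_nonneg_left hClv (Real.sqrt_nonneg _))
    rw [mul_div_cancel₀ _ (h.size_pos j).ne']
    exact mul_le_of_le_one_left (by positivity) hb1
  · exact hA.trans hCgu
  · exact hA'.trans hClv
  · intro i l
    refine (hPBj i l).trans ?_
    rw [← mul_assoc]
    exact hle (by positivity) (by linarith) huw hu
  · exact fun i l => (hQL i l).trans hQw
  · intro i l
    have h1 : (S - P - Matrix.blockDiagonal' Q).blockDiag' j i l - M.Su.blockDiag' j i l =
        ((S - P).blockDiag' j - (M.L j * (M.L j)ᵀ + M.Su.blockDiag' j)) i l -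
          (Q j - M.L j * (M.L j)ᵀ) i l := by
      rw [Matrix.blockDiag'_sub, Matrix.blockDiag'_blockDiagonal']
      simp only [Pi.sub_apply, Matrix.sub_apply, Matrix.add_apply]
      ring
    rw [h1]
    refine (abs_sub _ _).trans ((add_le_add (hSP i l) (hQL i l)).trans ?_)
    have h2 : Ce * u + 7 * D ^ 2 * (Cl * v) ≤ Ce * w + 7 * D ^ 2 * (Cl * w) := by gcongr
    rw [hC]
    linarith

end Model.IsRegular

theorem blockDiag_adaptiveThreshold {J : ℕ} {size : Fin J → ℕ}
    (s : (Σ j, Fin (size j)) → (Σ j, Fin (size j)) → ℝ → ℝ → ℝ) (τ : ℝ)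
    (A : Matrix (Σ j, Fin (size j)) (Σ j, Fin (size j)) ℝ) (j : Fin J) :
    (adaptiveThreshold s τ A).blockDiag' j =
      adaptiveThreshold (fun i l => s ⟨j, i⟩ ⟨j, l⟩) τ (A.blockDiag' j) := by
  ext i l
  by_cases hil : i = l
  · subst hil
    exact (if_pos rfl).trans (if_pos rfl).symm
  · have hil' : (⟨j, i⟩ : Σ j, Fin (size j)) ≠ ⟨j, l⟩ := fun h => hil (by simpa using h)
    exact (if_neg hil').trans (if_neg hil).symm

end GroupEstimator

/-! ### Error bounds for one group at a fixed sample size -/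

section GroupErrors

open scoped Matrix.Norms.L2Operator

variable {Ω : Type*} [MeasurableSpace Ω] {μ : Measure Ω} {k : ℕ} {M : Model μ k}

theorem IsDoublePOET.blockDiag_eq {S D : Matrix M.Ind M.Ind ℝ}
    {s : M.Ind → M.Ind → ℝ → ℝ → ℝ} {τ : ℝ} (hD : IsDoublePOET S k M.rank s τ D) (j : Fin M.J) :
    ∃ P Q, IsPrincipalPart S k P ∧
      (∀ j, IsPrincipalPart ((S - P).blockDiag' j) (M.rank j) (Q j)) ∧
      D.blockDiag' j = P.blockDiag' j + Q j +
        adaptiveThreshold (fun i l => s ⟨j, i⟩ ⟨j, l⟩) τ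
          ((S - P - Matrix.blockDiagonal' Q).blockDiag' j) := by
  obtain ⟨P, Q, hP, hQ, rfl⟩ := hD
  refine ⟨P, Q, hP, hQ, ?_⟩
  rw [Matrix.blockDiag'_add, Matrix.blockDiag'_add, Pi.add_apply, Pi.add_apply,
    Matrix.blockDiag'_blockDiagonal', blockDiag_adaptiveThreshold]

namespace Model.IsRegular

variable {c a₁ a₂ b d q : ℝ} {R : ℕ}

theorem Su_diag_ge (h : M.IsRegular c a₁ a₂ b d R) (i : M.Ind) : b ≤ M.Su i i := by
  simpa using h.Su_ge (Pi.single i 1)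

/-- A principal submatrix inherits the lower bound, by extending vectors by zero. -/
theorem Su_block_ge (h : M.IsRegular c a₁ a₂ b d R) (j : Fin M.J) (x : Fin (M.size j) → ℝ) :
    b * (x ⬝ᵥ x) ≤ x ⬝ᵥ M.Su.blockDiag' j *ᵥ x := by
  have key := h.Su_ge fun i => if hi : i.1 = j then x (hi ▸ i.2) else 0
  have hsum : ∀ f : M.Ind → ℝ, (∀ j' l, j' ≠ j → f ⟨j', l⟩ = 0) →
      ∑ i, f i = ∑ l, f ⟨j, l⟩ := fun f hf => by
    rw [Fintype.sum_sigma, Finset.sum_eq_single j (fun j' _ hj' =>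
      Finset.sum_eq_zero fun l _ => hf j' l hj') (by simp)]
  simp only [dotProduct, Matrix.mulVec] at key ⊢
  rw [hsum _ fun j' l hj' => by simp [hj'], hsum _ fun j' l hj' => by simp [hj']] at key
  simp only [dite_true] at key
  refine key.trans_eq (Finset.sum_congr rfl fun i _ => ?_)
  rw [hsum _ fun j' l hj' => by simp [hj']]
  simp [Matrix.blockDiag'_apply]

theorem Su_block_isSymm (h : M.IsRegular c a₁ a₂ b d R) (j : Fin M.J) :
    (M.Su.blockDiag' j).IsSymm := Matrix.IsSymm.ext fun _ _ => h.Su_symm.apply _ _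

theorem nonempty_group (h : M.IsRegular c a₁ a₂ b d R) (j : Fin M.J) :
    Nonempty (Fin (M.size j)) := by
  rw [← Fin.pos_iff_nonempty]
  exact_mod_cast h.size_pos j

theorem le_mgroup (h : M.IsRegular c a₁ a₂ b d R) (hq : 0 ≤ q) (hq1 : q < 1) (j : Fin M.J) :
    b ≤ M.mgroup q j := by
  obtain ⟨i⟩ := h.nonempty_group j
  exact le_sparsity hq hq1 h.b_pos h.b_le i (h.Su_diag_ge ⟨j, i⟩)

theorem norm_Su_block_le (h : M.IsRegular c a₁ a₂ b d R) (hq : 0 ≤ q) (hq1 : q < 1)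
    (j : Fin M.J) : ‖M.Su.blockDiag' j‖ ≤ d * M.mgroup q j := by
  have hb := h.b_pos
  have hd := h.one_le_d
  have hm := h.le_mgroup hq hq1 j
  have hr : ∀ i, ∑ l, |M.Su.blockDiag' j i l| ≤ d * M.mgroup q j :=
    sum_abs_le_mul_sparsity hq hq1 hd fun i l => h.Su_le _ _
  exact norm_le_of_sum_abs_le (mul_nonneg (by linarith) (by linarith)) hr fun l => by
    simpa only [(h.Su_block_isSymm j).apply] using hr l

theorem Bgroup_transpose_mul_L (h : M.IsRegular c a₁ a₂ b d R) (j : Fin M.J) :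
    (M.Bgroup j)ᵀ * M.L j = 0 := by
  ext a l
  have h1 := congrFun (congrFun h.orth a) ⟨j, l⟩
  rw [Matrix.mul_apply, Fintype.sum_sigma, Finset.sum_eq_single j
    (fun j' _ hj' => Finset.sum_eq_zero fun i _ => by
      rw [Lam, Matrix.blockDiagonal'_apply_ne _ _ _ hj', mul_zero]) (by simp)] at h1
  simp only [Lam, Matrix.blockDiagonal'_apply_eq] at h1
  exact h1

end Model.IsRegular

namespace Model.GroupExpansion

variable {c a₁ a₂ b d q ζ τ : ℝ} {R : ℕ} {j : Fin M.J}
  {P Q U : Matrix (Fin (M.size j)) (Fin (M.size j)) ℝ}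
  {G : Matrix (Fin (M.size j)) (Fin k) ℝ} {A : Matrix (Fin k) (Fin k) ℝ}
  {G' : Matrix (Fin (M.size j)) (Fin (M.rank j)) ℝ}
  {A' : Matrix (Fin (M.rank j)) (Fin (M.rank j)) ℝ}
  {s : Fin (M.size j) → Fin (M.size j) → ℝ → ℝ → ℝ}

theorem maxNorm_sub_le (e : M.GroupExpansion a₁ a₂ j P Q U ζ G A G' A')
    (h : M.IsRegular c a₁ a₂ b d R) (hs : ∀ i l, IsShrinkage (s i l)) (hτ : 0 ≤ τ) (hζ : ζ ≤ b) :
    maxNorm (P + Q + adaptiveThreshold s τ U - M.Sig.blockDiag' j) ≤ 3 * ζ + 2 * d * τ := by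
  have hζ0 : 0 ≤ ζ := (norm_nonneg _).trans e.coeff_global
  have hd := h.one_le_d
  refine maxNorm_le (by positivity) fun i l => ?_
  have h1 := abs_adaptiveThreshold_sub_le hs hτ e.residual_error
    (fun i => (le_abs_self _).trans (h.Su_le ⟨j, i⟩ ⟨j, i⟩))
    (fun i => hζ.trans (h.Su_diag_ge ⟨j, i⟩)) (hζ.trans (h.b_le.trans hd)) i l
  have h2 : (P + Q + adaptiveThreshold s τ U - M.Sig.blockDiag' j) i l =
      (P - M.Bgroup j * (M.Bgroup j)ᵀ) i l + (Q - M.L j * (M.L j)ᵀ) i l +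
        (adaptiveThreshold s τ U i l - M.Su.blockDiag' j i l) := by
    rw [M.blockDiag_Sig]
    simp only [Matrix.sub_apply, Matrix.add_apply]
    ring
  rw [h2]
  refine ((abs_add_le _ _).trans (add_le_add ((abs_add_le _ _).trans
    (add_le_add (e.global_error i l) (e.local_error i l))) h1)).trans ?_
  linarith

theorem norm_threshold_sub_le (e : M.GroupExpansion a₁ a₂ j P Q U ζ G A G' A')
    (h : M.IsRegular c a₁ a₂ b d R) (hq : 0 ≤ q) (hq1 : q < 1)
    (hs : ∀ i l, IsShrinkage (s i l)) (hτ : 0 < τ) (hζ : 2 * ζ ≤ b) (hζτ : 4 * ζ ≤ b * τ) :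
    ‖adaptiveThreshold s τ U - M.Su.blockDiag' j‖ ≤ 4 * (2 * d * τ) ^ (1 - q) * M.mgroup q j :=
  norm_adaptiveThreshold_sub_le hs hq hq1 (h.Su_block_isSymm j) hτ e.residual_error h.b_pos
    (h.b_le.trans h.one_le_d) (fun i => (le_abs_self _).trans (h.Su_le ⟨j, i⟩ ⟨j, i⟩))
    (fun i => h.Su_diag_ge ⟨j, i⟩) hζ hζτ

/-- The constant `β` bounds the strength of the global factors within the group. Replacing the
strengths of all factors by their multiples by `β` turns the relative perturbation `ζ` into
`ζ / √β`. -/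
theorem opNorm_inv_sub_le (e : M.GroupExpansion a₁ a₂ j P Q U ζ G A G' A')
    (h : M.IsRegular c a₁ a₂ b d R) (hq : 0 ≤ q) (hq1 : q < 1)
    (hs : ∀ i l, IsShrinkage (s i l)) (hτ : 0 < τ) (hζτ : 4 * ζ ≤ b * τ) {β γ : ℝ} (hβ : 0 < β)
    (hβb : β ≤ b)
    (hB : ∀ x, β * ((M.size j : ℝ) / M.p * (M.p : ℝ) ^ a₁) * (x ⬝ᵥ x) ≤
      (M.Bgroup j *ᵥ x) ⬝ᵥ (M.Bgroup j *ᵥ x))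
    (hζ : 4 * ζ ≤ √β * b) (hγ : 4 * (2 * d * τ) ^ (1 - q) * M.mgroup q j ≤ γ) (hγb : γ ≤ b / 2) :
    IsUnit (P + Q + adaptiveThreshold s τ U).det ∧
      opNorm ((P + Q + adaptiveThreshold s τ U)⁻¹ - (M.Sig.blockDiag' j)⁻¹) ≤
        8 * (γ + 2 * (ζ / √β) * (1 + d * M.mgroup q j)) / b ^ 2 := by
  have hζ0 : 0 ≤ ζ := (norm_nonneg _).trans e.coeff_global
  have hb := h.b_pos
  have hb1 := h.b_le
  have hp := h.p_pos
  have hsz := h.size_pos j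
  have hsβ : 0 < √β := Real.sqrt_pos.2 hβ
  have hsβ1 : √β ≤ 1 := Real.sqrt_le_one.2 (hβb.trans hb1)
  have hζβ : ζ ≤ ζ / √β := by
    rw [le_div_iff₀ hsβ]
    exact mul_le_of_le_one_right hζ0 hsβ1
  have hscale : ∀ {x : ℝ}, √x * ζ = √(β * x) * (ζ / √β) := fun {x} => by
    rw [Real.sqrt_mul hβ.le]
    field_simp
  rw [M.blockDiag_Sig, e.global_eq, e.local_eq]
  refine norm_inv_sub_inv_le_of_two_factors (φ := β * ((M.size j : ℝ) / M.p * (M.p : ℝ) ^ a₁))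
    (ψ := β * (M.size j : ℝ) ^ a₂) hb hb1 ?_ hγb (by positivity) (by positivity) hB
    (fun x => le_trans ?_ (h.locals j x)) (h.Bgroup_transpose_mul_L j)
    (e.norm_global.trans_eq hscale) (e.norm_local.trans_eq hscale) (e.coeff_global.trans hζβ)
    (e.coeff_local.trans hζβ) (h.Su_block_ge j) (h.norm_Su_block_le hq hq1 j)
    ((e.norm_threshold_sub_le h hq hq1 hs hτ (by nlinarith) hζτ).trans hγ)
  · rw [← mul_div_assoc, div_le_iff₀ hsβ]
    nlinarith
  · have : 0 ≤ x ⬝ᵥ x := dotProduct_self_nonneg' x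
    gcongr

theorem relFrobNorm_sub_le (e : M.GroupExpansion a₁ a₂ j P Q U ζ G A G' A')
    (h : M.IsRegular c a₁ a₂ b d R) (hq : 0 ≤ q) (hq1 : q < 1)
    (hs : ∀ i l, IsShrinkage (s i l)) (hτ : 0 < τ) (hζ : 2 * ζ ≤ b) (hζτ : 4 * ζ ≤ b * τ) :
    relFrobNorm (M.Sig.blockDiag' j)
        (P + Q + adaptiveThreshold s τ U - M.Sig.blockDiag' j) ≤
      2 * (k + R : ℝ) * (5 * ζ + 2 * √(M.size j) * ζ ^ 2) / b +
        4 * (2 * d * τ) ^ (1 - q) * M.mgroup q j / b := by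
  have := h.nonempty_group j
  have hb1 := h.b_le
  have hsq : ∀ n : ℕ, n ≤ k + R → (n : ℝ) ≤ ((k : ℝ) + R) ^ 2 := fun n hn => by
    have h1 : n ≤ (k + R) ^ 2 := hn.trans (Nat.le_self_pow two_ne_zero _)
    exact_mod_cast h1
  have hr := h.rank_le j
  have key := relFrobNorm_le (B := M.Bgroup j) (L := M.L j) (R := k + R) h.b_pos hb1
    (by linarith) (h.Su_block_isSymm j) (h.Su_block_ge j) e.row_global e.row_local e.coeff_global
    e.coeff_local (e.norm_threshold_sub_le h hq hq1 hs hτ hζ hζτ)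
    (by rw [Fintype.card_fin]; exact hsq _ (by omega))
    (by rw [Fintype.card_fin]; exact hsq _ (by omega)) (by positivity)
  rw [M.blockDiag_Sig, e.global_eq, e.local_eq]
  rwa [Fintype.card_fin] at key

end Model.GroupExpansion

end GroupErrors

/-! ### Asymptotics -/

section Asymptotics

theorem abs_apply_le_of_quadForm_nonneg {ι : Type*} [Fintype ι] [DecidableEq ι]
    {A : Matrix ι ι ℝ} (hA : A.IsSymm) (h : ∀ x, 0 ≤ x ⬝ᵥ A *ᵥ x) {d : ℝ} (hd : ∀ i, A i i ≤ d)
    (i l : ι) : |A i l| ≤ d := by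
  have h1 := h (Pi.single i 1 + Pi.single l 1)
  have h2 := h (Pi.single i 1 - Pi.single l 1)
  have h3 := hA.apply i l
  simp [Matrix.mulVec_add, Matrix.mulVec_sub] at h1 h2
  rw [abs_le]
  constructor <;> linarith [hd i, hd l]

theorem le_mulVec_dotProduct_self_of_spectrum {m n : Type*} [Fintype m] [Fintype n]
    [DecidableEq n] {F : Matrix m n ℝ} {φ : ℝ} (h : ∀ e ∈ spectrum ℝ (Fᵀ * F), φ ≤ e)
    (x : n → ℝ) : φ * (x ⬝ᵥ x) ≤ (F *ᵥ x) ⬝ᵥ (F *ᵥ x) := by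
  classical
  rw [← dotProduct_transpose_mul_self_mulVec]
  exact le_dotProduct_mulVec_of_spectrum (by
    rw [Matrix.IsSymm, Matrix.transpose_mul, Matrix.transpose_transpose]) h x

theorem Model.omega_nonneg {Ω : Type*} [MeasurableSpace Ω] {μ : Measure Ω} {k : ℕ}
    (M : Model μ k) (c a₁ a₂ q : ℝ) : 0 ≤ M.omega c a₁ a₂ q := by
  have := M.m_nonneg q
  unfold Model.omega
  positivity

/-- Up to a constant, the last three terms of `relRate` are `p ^ (c / 2)` times the squares of the
terms of `ω`. -/
theorem Model.IsRegular.relRate_bounds {Ω : Type*} [MeasurableSpace Ω] {μ : Measure Ω} {k : ℕ}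
    {M : Model μ k} {c a₁ a₂ b d q : ℝ} {R : ℕ} (h : M.IsRegular c a₁ a₂ b d R) (hq : 0 ≤ q)
    (hq1 : q < 1) (j : Fin M.J) :
    M.mgroup q j * M.omega c a₁ a₂ q ^ (1 - q) ≤ M.relRate c a₁ a₂ q j ∧
      √(M.size j) * M.omega c a₁ a₂ q ^ 2 ≤ 3 * d * M.relRate c a₁ a₂ q j := by
  have hp := h.p_pos
  have hd := h.one_le_d
  have hm := M.m_nonneg q
  have hw := M.omega_nonneg c a₁ a₂ q
  have hmg : 0 ≤ M.mgroup q j := h.b_pos.le.trans (h.le_mgroup hq hq1 j)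
  have hlog : 0 ≤ Real.log M.p / M.T :=
    div_nonneg (Real.log_nonneg h.one_le_p) (Nat.cast_nonneg _)
  have hsize : √(M.size j) ≤ d * (M.p : ℝ) ^ (c / 2) := by
    refine Real.sqrt_le_iff.2 ⟨by positivity, (h.size_le j).trans ?_⟩
    rw [mul_pow, ← Real.rpow_mul_natCast hp.le, Nat.cast_ofNat, div_mul_cancel₀ _ two_ne_zero]
    gcongr
    nlinarith
  unfold Model.relRate
  refine ⟨by
    have : 0 ≤ (M.p : ℝ) ^ (5 * (1 - a₁) + c * (11 / 2 - 5 * a₂)) * (Real.log M.p / M.T) := by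
      positivity
    have : 0 ≤ M.m q ^ 2 / (M.p : ℝ) ^ (5 * a₁ - 3 + c * (5 * a₂ - 11 / 2)) := by positivity
    have : 0 ≤ M.m q ^ 2 / (M.p : ℝ) ^ (c * (5 * a₂ - 7 / 2)) := by positivity
    linarith, ?_⟩
  have hdiv : ∀ x y : ℝ, y = x - c / 2 →
      (M.p : ℝ) ^ (c / 2) * (M.m q / √((M.p : ℝ) ^ x)) ^ 2 = M.m q ^ 2 / (M.p : ℝ) ^ y :=
    fun x y hxy => by
      rw [div_pow, Real.sq_sqrt (by positivity), hxy, Real.rpow_sub hp]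
      field_simp
  have e1 : (M.p : ℝ) ^ (c / 2) *
      ((M.p : ℝ) ^ (5 / 2 * (1 - a₁) + 5 / 2 * c * (1 - a₂)) * √(Real.log M.p / M.T)) ^ 2 =
      (M.p : ℝ) ^ (5 * (1 - a₁) + c * (11 / 2 - 5 * a₂)) * (Real.log M.p / M.T) := by
    rw [mul_pow, Real.sq_sqrt hlog, ← Real.rpow_mul_natCast hp.le, ← mul_assoc,
      ← Real.rpow_add hp]
    congr 2
    push_cast
    ring
  have e2 := hdiv (c * (5 * a₂ - 3)) (c * (5 * a₂ - 7 / 2)) (by ring)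
  have e3 := hdiv (5 * a₁ - 3 - 5 * c * (1 - a₂)) (5 * a₁ - 3 + c * (5 * a₂ - 11 / 2)) (by ring)
  have hω : M.omega c a₁ a₂ q ^ (1 - q) * M.mgroup q j ≥ 0 := by positivity
  rw [← e1, ← e2, ← e3]
  have hsq : M.omega c a₁ a₂ q ^ 2 ≤
      3 * (((M.p : ℝ) ^ (5 / 2 * (1 - a₁) + 5 / 2 * c * (1 - a₂)) * √(Real.log M.p / M.T)) ^ 2 +
        (M.m q / √((M.p : ℝ) ^ (c * (5 * a₂ - 3)))) ^ 2 +
        (M.m q / √((M.p : ℝ) ^ (5 * a₁ - 3 - 5 * c * (1 - a₂)))) ^ 2) := by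
    unfold Model.omega
    generalize (M.p : ℝ) ^ (5 / 2 * (1 - a₁) + 5 / 2 * c * (1 - a₂)) * √(Real.log M.p / M.T) = x
    generalize M.m q / √((M.p : ℝ) ^ (c * (5 * a₂ - 3))) = y
    generalize M.m q / √((M.p : ℝ) ^ (5 * a₁ - 3 - 5 * c * (1 - a₂))) = z
    nlinarith [sq_nonneg (x - y), sq_nonneg (y - z), sq_nonneg (x - z)]
  calc _ ≤ d * (M.p : ℝ) ^ (c / 2) * _ := mul_le_mul hsize hsq (by positivity) (by positivity)
    _ ≤ _ := by
      have : 0 ≤ d * (M.omega c a₁ a₂ q ^ (1 - q) * M.mgroup q j) := by positivity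
      linarith

variable {Ω : ℕ → Type*} [∀ n, MeasurableSpace (Ω n)] {μ : ∀ n, Measure (Ω n)} {k : ℕ}
  {M : ∀ n, Model (μ n) k} {c a₁ a₂ q : ℝ}

theorem eventually_isRegular (hregime : Regime M c) (hperv : Pervasive M c a₁ a₂)
    (hidio : Idiosyncratic M q) (horth : ∀ n, (M n).Bᵀ * (M n).Lam = 0) :
    ∃ (b d : ℝ) (R : ℕ), 0 < b ∧ b ≤ 1 ∧ 1 ≤ d ∧
      ∀ᶠ n in atTop, (M n).IsRegular c a₁ a₂ b d R := by
  obtain ⟨R, hR⟩ := hregime.rank_le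
  obtain ⟨b₁, b₂, hb₁, hb₂, hsize⟩ := hregime.size_comparable
  obtain ⟨bg, hbg, hglobal⟩ := hperv.global
  obtain ⟨bl, hbl, hlocal⟩ := hperv.locals
  obtain ⟨dB, hbdd⟩ := hperv.bounded
  obtain ⟨bu, hbu, heig⟩ := hidio.eigenvalue
  obtain ⟨du, hvar⟩ := hidio.variance
  obtain ⟨b, hb, hb1, hbb₁, hbbg, hbbl, hbbu⟩ :
      ∃ b : ℝ, 0 < b ∧ b ≤ 1 ∧ b ≤ b₁ ∧ b ≤ bg ∧ b ≤ bl ∧ b ≤ bu :=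
    ⟨min 1 (min b₁ (min bg (min bl bu))), by positivity, by simp, by simp, by simp, by simp,
      by simp⟩
  obtain ⟨d, hd1, hdb₂, hdB, hdu⟩ : ∃ d : ℝ, 1 ≤ d ∧ b₂ ≤ d ∧ dB ≤ d ∧ du ≤ d :=
    ⟨max 1 (max b₂ (max dB du)), by simp, by simp, by simp, by simp⟩
  refine ⟨b, d, R, hb, hb1, hd1, ?_⟩
  filter_upwards [hsize, hglobal, hlocal, hbdd, heig, hvar,
    hregime.p_tendsto.eventually_ge_atTop 1, hregime.T_tendsto.eventually_ge_atTop 1]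
    with n hsize hglobal hlocal hbdd heig hvar hp hT
  have hsymm : (M n).Su.IsSymm := Matrix.IsSymm.ext fun i l => by
    rw [← (M n).cov_u ⟨0, hT⟩, ← (M n).cov_u ⟨0, hT⟩, covariance_comm]
  have hxx : ∀ {ι : Type} [Fintype ι] [DecidableEq ι] (x : ι → ℝ), 0 ≤ x ⬝ᵥ x := fun x =>
    dotProduct_self_nonneg' x
  have hSu : ∀ x, b * (x ⬝ᵥ x) ≤ x ⬝ᵥ (M n).Su *ᵥ x := fun x =>
    (mul_le_mul_of_nonneg_right hbbu (hxx x)).trans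
      (le_dotProduct_mulVec_of_spectrum hsymm (fun e he => (heig e he).le) x)
  exact
    { b_pos := hb
      b_le := hb1
      one_le_d := hd1
      one_le_p := by exact_mod_cast hp
      size_ge := fun j => le_trans (by gcongr) (hsize j).1
      size_le := fun j => (hsize j).2.trans (by gcongr)
      rank_le := hR n
      global := fun x => le_trans (by have := hxx x; gcongr)
        (le_mulVec_dotProduct_self_of_spectrum hglobal x)
      locals := fun j x => le_trans (by have := hxx x; gcongr)
        (le_mulVec_dotProduct_self_of_spectrum (hlocal j) x)
      B_le := fun i a => (hbdd.1 i a).trans hdB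
      L_le := fun j i a => by
        refine le_trans ?_ ((hbdd.2 ⟨j, i⟩ ⟨j, a⟩).trans hdB)
        rw [Model.Lam, Matrix.blockDiagonal'_apply_eq]
      Su_symm := hsymm
      Su_ge := hSu
      Su_le := abs_apply_le_of_quadForm_nonneg hsymm
        (fun x => (mul_nonneg hb.le (hxx x)).trans (hSu x)) fun i => (hvar i).trans hdu
      orth := horth n }

theorem eventually_omega_pos (hregime : Regime M c) :
    ∀ᶠ n in atTop, 0 < (M n).omega c a₁ a₂ q := by
  filter_upwards [hregime.p_tendsto.eventually_ge_atTop 2,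
    hregime.T_tendsto.eventually_ge_atTop 1] with n hp hT
  have hp' : (1 : ℝ) < (M n).p := by exact_mod_cast hp
  have hp0 : (0 : ℝ) < (M n).p := by linarith
  have hT' : (0 : ℝ) < (M n).T := by exact_mod_cast hT
  have := Real.log_pos hp'
  have := (M n).m_nonneg q
  unfold Model.omega
  positivity

/-- `ω` vanishes because `ω ^ (1 - q)` does, the sparsity level of the group being bounded below. -/
theorem omega_tendsto_zero {b : ℝ} (hb : 0 < b) (hq1 : q < 1) {j : ∀ n, Fin (M n).J}
    (hbm : ∀ᶠ n in atTop, b ≤ (M n).mgroup q (j n))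
    (hmj : Tendsto (fun n => (M n).mgroup q (j n) * (M n).omega c a₁ a₂ q ^ (1 - q))
      atTop (𝓝 0)) : Tendsto (fun n => (M n).omega c a₁ a₂ q) atTop (𝓝 0) := by
  have h1 : Tendsto (fun n => (M n).omega c a₁ a₂ q ^ (1 - q)) atTop (𝓝 0) := by
    refine tendsto_of_tendsto_of_tendsto_of_le_of_le' tendsto_const_nhds
      (by simpa using hmj.const_mul b⁻¹)
      (.of_forall fun n => Real.rpow_nonneg ((M n).omega_nonneg c a₁ a₂ q) _) ?_
    filter_upwards [hbm] with n hn
    rw [← mul_assoc]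
    refine le_mul_of_one_le_left (Real.rpow_nonneg ((M n).omega_nonneg c a₁ a₂ q) _) ?_
    rwa [inv_mul_eq_div, one_le_div hb]
  have h2 : 0 < (1 - q)⁻¹ := inv_pos.2 (by linarith)
  have h3 := h1.rpow_const (p := (1 - q)⁻¹) (Or.inr h2.le)
  rw [Real.zero_rpow h2.ne'] at h3
  refine h3.congr fun n => ?_
  rw [← Real.rpow_mul ((M n).omega_nonneg c a₁ a₂ q), mul_inv_cancel₀ (by linarith),
    Real.rpow_one]

/-- The local factors, whose strength is at most of order `p ^ c`, are weaker than the global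
ones. -/
theorem eventually_separated (hregime : Regime M c) (hca : c < a₁) {b : ℝ} (hb : 0 < b) (x : ℝ) :
    ∀ᶠ n in atTop, x * ((M n).p : ℝ) ^ c ≤ b * ((M n).p : ℝ) ^ a₁ := by
  have h1 : Tendsto (fun n => ((M n).p : ℝ)) atTop atTop :=
    tendsto_natCast_atTop_atTop.comp hregime.p_tendsto
  have h2 := (tendsto_rpow_atTop (sub_pos.2 hca)).comp h1
  filter_upwards [h2.eventually_ge_atTop (x / b), h1.eventually_ge_atTop 1] with n h3 h4
  have hp : 0 < ((M n).p : ℝ) := by linarith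
  have h5 : ((M n).p : ℝ) ^ a₁ = ((M n).p : ℝ) ^ (a₁ - c) * ((M n).p : ℝ) ^ c := by
    rw [← Real.rpow_add hp, sub_add_cancel]
  rw [h5, ← mul_assoc]
  gcongr
  rw [mul_comm]
  exact (div_le_iff₀ hb).1 h3

/-- For large `n`, the estimator of every group is a small perturbation of its target, in the sense
of `Model.GroupExpansion`, wherever the sample covariance matrix is close to the true one. -/
theorem exists_eventually_groupExpansion {b d : ℝ} {R : ℕ} (hq : 0 ≤ q) (hq1 : q < 1) (hc : 0 < c)
    (hca : c < a₁) (ha₁ : a₁ ≤ 1) (ha₂ : 1 / 2 ≤ a₂) (ha₂' : a₂ ≤ 1) (hb : 0 < b) (hb1 : b ≤ 1)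
    (hd : 1 ≤ d) (hregime : Regime M c)
    (hreg : ∀ᶠ n in atTop, (M n).IsRegular c a₁ a₂ b d R)
    (hω : Tendsto (fun n => (M n).omega c a₁ a₂ q) atTop (𝓝 0)) {K : ℝ} (hK : 0 ≤ K) :
    ∃ C : ℝ, 1 ≤ C ∧ ∀ᶠ n in atTop, ∀ (s : (M n).Ind → (M n).Ind → ℝ → ℝ → ℝ) (τ : ℝ)
      (S D : Matrix (M n).Ind (M n).Ind ℝ), IsDoublePOET S k (M n).rank s τ D →
      maxNorm (S - (M n).Sig) ≤ K * (M n).eps → ∀ j, ∃ P Q U G A G' A',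
        (M n).GroupExpansion a₁ a₂ j P Q U (C * (M n).omega c a₁ a₂ q) G A G' A' ∧
        D.blockDiag' j = P + Q +
          adaptiveThreshold (fun i l : Fin ((M n).size j) => s ⟨j, i⟩ ⟨j, l⟩) τ U := by
  obtain ⟨C, hC, key⟩ := Model.IsRegular.exists_groupExpansion k hq hq1 hc ha₁ ha₂ ha₂' hb hb1 hd R
    hK
  refine ⟨C, hC, ?_⟩
  have hCω : Tendsto (fun n => C * (M n).omega c a₁ a₂ q) atTop (𝓝 0) := by
    simpa using hω.const_mul C
  filter_upwards [hreg, eventually_separated hregime hca hb (8 * (R * d ^ 3)),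
    hCω.eventually_le_const one_pos] with n hn hsep hsmall s τ S D hD hS j
  obtain ⟨P, Q, hP, hQ, hDj⟩ := hD.blockDiag_eq j
  obtain ⟨G, A, G', A', hE⟩ := key (M n) hn (by linarith) hsmall S P Q hP hQ hS j
  exact ⟨_, _, _, G, A, G', A', hE, hDj⟩

/-- A deterministic implication `Z ≤ e → X ≤ C r` yields the stochastic order of `X` on events which
exclude `Z > e` asymptotically. -/
theorem IsBigOPOn.of_eventually_le {A : ∀ n, Set (Ω n)} {X Z : ∀ n, Ω n → ℝ} {r e : ℕ → ℝ}
    (hZ : Tendsto (fun n => μ n {x | x ∈ A n ∧ e n < Z n x}) atTop (𝓝 0))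
    (h : ∃ C : ℝ, ∀ᶠ n in atTop, ∀ x, Z n x ≤ e n → X n x ≤ C * r n) : IsBigOPOn μ A X r := by
  obtain ⟨C, hC⟩ := h
  refine fun δ hδ => ⟨C, ?_⟩
  filter_upwards [hC, hZ.eventually_le_const (ENNReal.ofReal_pos.2 hδ)] with n hn hn'
  have hsub : {x | x ∈ A n ∧ C * r n < X n x} ⊆ {x | x ∈ A n ∧ e n < Z n x} := fun x hx =>
    ⟨hx.1, by_contra fun hle => absurd (hn x (not_lt.1 hle)) (not_le.2 hx.2)⟩
  exact (measure_mono hsub).trans hn'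

end Asymptotics

end DoublePOET

open DoublePOET

theorem theorem3
    {Ω : ℕ → Type*} [∀ n, MeasurableSpace (Ω n)]
    (μ : ∀ n, MeasureTheory.Measure (Ω n)) [∀ n, MeasureTheory.IsProbabilityMeasure (μ n)]
    (k : ℕ) (M : ∀ n, DoublePOET.Model (μ n) k)
    (c a₁ a₂ q : ℝ) (hc : 0 < c ∧ c ≤ 1) (ha₁ : (3 + 2 * c) / 5 < a₁ ∧ a₁ ≤ 1)
    (ha₂ : 3 / 5 < a₂ ∧ a₂ ≤ 1) (ha : c * a₂ ≤ a₁) (hq : 0 ≤ q ∧ q < 1)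
    (hregime : DoublePOET.Regime M c)
    (hperv : DoublePOET.Pervasive M c a₁ a₂)
    (hidio : DoublePOET.Idiosyncratic M q)
    (hcov : DoublePOET.IsBigOP μ
      (fun n x => DoublePOET.maxNorm ((M n).sampleCov x - (M n).Sig)) (fun n => (M n).eps))
    (horth : ∀ n, (M n).Bᵀ * (M n).Lam = 0)
    (hm : (fun n => (M n).m q) =o[atTop] fun n =>
      min (((M n).p : ℝ) ^ ((5 * a₁ - 3) / 2)) (((M n).p : ℝ) ^ (c * (5 * a₂ - 3) / 2)))
    (j : ∀ n, Fin (M n).J)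
    (hmj : Tendsto (fun n => (M n).mgroup q (j n) * (M n).omega c a₁ a₂ q ^ (1 - q))
      atTop (𝓝 0))
    (s : ∀ n, (M n).Ind → (M n).Ind → ℝ → ℝ → ℝ)
    (hs : ∀ n i i', DoublePOET.IsShrinkage (s n i i') ∧ s n i i' = s n i' i) :
    -- maximum norm
    (∀ τ : ℕ → ℝ, DoublePOET.Comparable τ (fun n => (M n).omega c a₁ a₂ q) →
      ∀ D : ∀ n, Ω n → Matrix (M n).Ind (M n).Ind ℝ,
      (∀ n x, DoublePOET.IsDoublePOET ((M n).sampleCov x) k (M n).rank (s n) (τ n) (D n x)) →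
      DoublePOET.IsBigOP μ
        (fun n x => DoublePOET.maxNorm
          ((D n x).blockDiag' (j n) - (M n).Sig.blockDiag' (j n)))
        (fun n => (M n).omega c a₁ a₂ q)) ∧
    -- inverse and relative Frobenius norm, for a sufficiently large thresholding constant
    (∀ K : ℝ, 0 < K → ∃ C₀ : ℝ, 0 < C₀ ∧
      ∀ τ : ℕ → ℝ, DoublePOET.Comparable τ (fun n => (M n).omega c a₁ a₂ q) →
      (∀ᶠ n in atTop, C₀ * (M n).omega c a₁ a₂ q ≤ τ n) →
      ∀ D : ∀ n, Ω n → Matrix (M n).Ind (M n).Ind ℝ,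
      (∀ n x, DoublePOET.IsDoublePOET ((M n).sampleCov x) k (M n).rank (s n) (τ n) (D n x)) →
      ∀ A : ∀ n, Set (Ω n),
      Tendsto (fun n => μ n {x | x ∈ A n ∧
        K * (M n).eps < DoublePOET.maxNorm ((M n).sampleCov x - (M n).Sig)}) atTop (𝓝 0) →
      (DoublePOET.PervasiveInGroup M a₁ j →
        Tendsto (fun n => μ n {x | x ∈ A n ∧ ¬ IsUnit ((D n x).blockDiag' (j n)).det})
          atTop (𝓝 0) ∧
        DoublePOET.IsBigOPOn μ A
          (fun n x => DoublePOET.opNorm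
            (((D n x).blockDiag' (j n))⁻¹ - ((M n).Sig.blockDiag' (j n))⁻¹))
          (fun n => (M n).mgroup q (j n) * (M n).omega c a₁ a₂ q ^ (1 - q))) ∧
      (3 / 4 < a₁ → 3 / 4 < a₂ →
        DoublePOET.IsBigOPOn μ A
          (fun n x => DoublePOET.relFrobNorm ((M n).Sig.blockDiag' (j n))
            ((D n x).blockDiag' (j n) - (M n).Sig.blockDiag' (j n)))
          (fun n => (M n).relRate c a₁ a₂ q (j n)))) := by

  obtain ⟨b, d, R, hb, hb1, hd, hreg⟩ := eventually_isRegular hregime hperv hidio horth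
  have hca : c < a₁ := by linarith [ha₁.1, hc.2]
  have hbm : ∀ᶠ n in atTop, b ≤ (M n).mgroup q (j n) :=
    hreg.mono fun n hn => hn.le_mgroup hq.1 hq.2 (j n)
  have hω := omega_tendsto_zero hb hq.2 hbm hmj
  have hωpos : ∀ᶠ n in atTop, 0 < (M n).omega c a₁ a₂ q := eventually_omega_pos hregime
  have hexp := fun {K : ℝ} (hK : 0 ≤ K) => exists_eventually_groupExpansion hq.1 hq.2 hc.1 hca
    ha₁.2 (by linarith [ha₂.1]) ha₂.2 hb hb1 hd hregime hreg hω hK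
  have hωle : ∀ {x t : ℝ}, 0 < t → ∀ᶠ n in atTop, x * (M n).omega c a₁ a₂ q ≤ t :=
      fun {x t} ht => by
    have h1 : Tendsto (fun n => x * (M n).omega c a₁ a₂ q) atTop (𝓝 0) := by
      simpa using hω.const_mul x
    exact h1.eventually_le_const ht
  refine ⟨fun τ ⟨a, b', ha0, hb', hτ⟩ D hD δ hδ => ?_, fun K hK => ?_⟩
  · obtain ⟨K, hK⟩ := hcov δ hδ
    obtain ⟨C, hC, hexp⟩ := hexp (le_max_right K 0)
    refine ⟨3 * C + 2 * d * b', ?_⟩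
    filter_upwards [hK, hexp, hreg, hωpos, hτ, hωle (x := C) hb] with n hK hexp hreg hωpos hτ hζ
    refine le_trans (measure_mono fun x hx => ?_) hK
    refine ⟨trivial, by_contra fun hle => ?_⟩
    have hS : maxNorm ((M n).sampleCov x - (M n).Sig) ≤ max K 0 * (M n).eps :=
      (not_lt.1 hle).trans (mul_le_mul_of_nonneg_right (le_max_left K 0) (M n).eps_nonneg)
    obtain ⟨P, Q, U, G, A, G', A', hE, hDj⟩ := hexp _ _ _ _ (hD n x) hS (j n)
    have h1 := hE.maxNorm_sub_le hreg (fun i l => (hs n ⟨j n, i⟩ ⟨j n, l⟩).1)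
      ((mul_nonneg ha0.le hωpos.le).trans hτ.1) hζ
    refine absurd ?_ (not_le.2 hx.2)
    rw [hDj]
    refine h1.trans ?_
    have h2 : 2 * d * τ n ≤ 2 * d * (b' * (M n).omega c a₁ a₂ q) := by
      gcongr
      exact hτ.2
    linarith
  · obtain ⟨C, hC, hexp⟩ := hexp hK.le
    have hC0 : 0 < C := by linarith
    -- thresholds `τ ≥ (4 C / b) ω` dominate the entrywise error `C ω` of the residual matrix
    refine ⟨4 * C / b, by positivity, fun τ ⟨a, b', ha0, hb', hτ⟩ hCτ D hD A hA => ?_⟩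
    obtain ⟨Cγ, hCγ⟩ : ∃ Cγ : ℝ, Cγ = 4 * (2 * d * b') ^ (1 - q) := ⟨_, rfl⟩
    have hCγ0 : 0 ≤ Cγ := by rw [hCγ]; positivity
    -- the operator norm error of the thresholded matrix, in terms of the rate
    have hγ : ∀ᶠ n in atTop, 4 * (2 * d * τ n) ^ (1 - q) * (M n).mgroup q (j n) ≤
        Cγ * ((M n).mgroup q (j n) * (M n).omega c a₁ a₂ q ^ (1 - q)) := by
      filter_upwards [hτ, hωpos, hbm] with n hτ hωpos hbm
      have h0 : 0 ≤ τ n := (mul_nonneg ha0.le hωpos.le).trans hτ.1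
      have h1 : 2 * d * τ n ≤ 2 * d * b' * (M n).omega c a₁ a₂ q := by
        rw [mul_assoc _ b']
        gcongr
        exact hτ.2
      have h2 : (2 * d * τ n) ^ (1 - q) ≤
          (2 * d * b') ^ (1 - q) * (M n).omega c a₁ a₂ q ^ (1 - q) := by
        rw [← Real.mul_rpow (by positivity) hωpos.le]
        exact Real.rpow_le_rpow (by positivity) h1 (by linarith [hq.2])
      have h3 := mul_le_mul_of_nonneg_right h2 (hb.le.trans hbm)
      rw [hCγ]
      linarith
    have hτC : ∀ᶠ n in atTop, 0 < τ n ∧ 4 * (C * (M n).omega c a₁ a₂ q) ≤ b * τ n := by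
      filter_upwards [hCτ, hωpos] with n h1 h2
      refine ⟨lt_of_lt_of_le (by positivity) h1, ?_⟩
      have := mul_le_mul_of_nonneg_left h1 hb.le
      have h3 : b * (4 * C / b * (M n).omega c a₁ a₂ q) = 4 * (C * (M n).omega c a₁ a₂ q) := by
        field_simp
      linarith
    -- `ω` is negligible with respect to the rate of the sparse part
    have hωρ : ∀ᶠ n in atTop, (M n).omega c a₁ a₂ q ≤ (M n).omega c a₁ a₂ q ^ (1 - q) := by
      filter_upwards [hωpos, hωle (x := 1) one_pos] with n h1 h2
      rw [one_mul] at h2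
      calc _ = (M n).omega c a₁ a₂ q ^ (1 : ℝ) := (Real.rpow_one _).symm
        _ ≤ _ := Real.rpow_le_rpow_of_exponent_ge h1 h2 (by linarith [hq.1])
    refine ⟨fun ⟨β₀, hβ₀, hpervj⟩ => ?_, fun _ _ => ?_⟩
    · -- a common factor for the strengths of the global and the local loadings in the group
      obtain ⟨β, hβ, hβb, hββ₀⟩ : ∃ β : ℝ, 0 < β ∧ β ≤ b ∧ β ≤ β₀ :=
        ⟨min b β₀, by positivity, by simp, by simp⟩
      have hsβ : 0 < √β := Real.sqrt_pos.2 hβ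
      have hmain : ∀ᶠ n in atTop, ∀ x,
          maxNorm ((M n).sampleCov x - (M n).Sig) ≤ K * (M n).eps →
          IsUnit ((D n x).blockDiag' (j n)).det ∧
          opNorm (((D n x).blockDiag' (j n))⁻¹ - ((M n).Sig.blockDiag' (j n))⁻¹) ≤
            8 * (Cγ + 2 * (C / √β) * (1 / b + d)) / b ^ 2 *
              ((M n).mgroup q (j n) * (M n).omega c a₁ a₂ q ^ (1 - q)) := by
        have hρ : Tendsto (fun n => Cγ * ((M n).mgroup q (j n) * (M n).omega c a₁ a₂ q ^ (1 - q)))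
            atTop (𝓝 0) := by simpa using hmj.const_mul Cγ
        filter_upwards [hexp, hreg, hωpos, hγ, hτC, hωρ, hbm, hpervj,
          hωle (x := 4 * C) (mul_pos hsβ hb), hρ.eventually_le_const (half_pos hb)]
          with n hexp hreg hωpos hγ hτC hωρ hbm hpervj hζ hρ x hS
        have hp := hreg.p_pos
        obtain ⟨P, Q, U, G, A, G', A', hE, hDj⟩ := hexp _ _ _ _ (hD n x) hS (j n)
        rw [hDj]
        have hB : ∀ z, β * (((M n).size (j n) : ℝ) / (M n).p * ((M n).p : ℝ) ^ a₁) * (z ⬝ᵥ z) ≤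
            ((M n).Bgroup (j n) *ᵥ z) ⬝ᵥ ((M n).Bgroup (j n) *ᵥ z) := fun z => by
          have hz := dotProduct_self_nonneg' z
          refine le_trans ?_ (le_mulVec_dotProduct_self_of_spectrum hpervj z)
          gcongr
        obtain ⟨hu, hle⟩ := hE.opNorm_inv_sub_le hreg hq.1 hq.2
          (fun i l => (hs n ⟨j n, i⟩ ⟨j n, l⟩).1) hτC.1 hτC.2 hβ hβb hB
          (by linarith) hγ hρ
        refine ⟨hu, hle.trans ?_⟩
        rw [div_mul_eq_mul_div]
        refine div_le_div_of_nonneg_right ?_ (sq_nonneg b)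
        rw [mul_assoc (8 : ℝ)]
        refine mul_le_mul_of_nonneg_left ?_ (by norm_num)
        have h1 : 1 + d * (M n).mgroup q (j n) ≤ (1 / b + d) * (M n).mgroup q (j n) := by
          have : 1 ≤ 1 / b * (M n).mgroup q (j n) := by
            rwa [one_div_mul_eq_div, one_le_div hb]
          linarith
        have hm0 : 0 ≤ (M n).mgroup q (j n) := hb.le.trans hbm
        have h2 : (M n).omega c a₁ a₂ q * (1 + d * (M n).mgroup q (j n)) ≤
            (M n).omega c a₁ a₂ q ^ (1 - q) * ((1 / b + d) * (M n).mgroup q (j n)) :=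
          mul_le_mul hωρ h1 (by positivity) (by positivity)
        have h3 := mul_le_mul_of_nonneg_left h2 (show 0 ≤ 2 * (C / √β) by positivity)
        have h4 : 2 * (C * (M n).omega c a₁ a₂ q / √β) * (1 + d * (M n).mgroup q (j n)) =
            2 * (C / √β) * ((M n).omega c a₁ a₂ q * (1 + d * (M n).mgroup q (j n))) := by ring
        rw [h4]
        linarith
      refine ⟨?_, IsBigOPOn.of_eventually_le hA ⟨_, hmain.mono fun n hn x hx => (hn x hx).2⟩⟩
      refine tendsto_of_tendsto_of_tendsto_of_le_of_le' tendsto_const_nhds hA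
        (.of_forall fun _ => zero_le) (hmain.mono fun n hn => measure_mono fun x hx => ?_)
      exact ⟨hx.1, by_contra fun hle => hx.2 (hn x (not_lt.1 hle)).1⟩
    · refine IsBigOPOn.of_eventually_le hA
        ⟨2 * (k + R) * (5 * (C / b) + 2 * C ^ 2 * (3 * d)) / b + Cγ / b, ?_⟩
      filter_upwards [hexp, hreg, hωpos, hγ, hτC, hωρ, hbm, hωle (x := 2 * C) hb]
        with n hexp hreg hωpos hγ hτC hωρ hbm hζ x hS
      obtain ⟨P, Q, U, G, A, G', A', hE, hDj⟩ := hexp _ _ _ _ (hD n x) hS (j n)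
      rw [hDj]
      refine (hE.relFrobNorm_sub_le hreg hq.1 hq.2 (fun i l => (hs n ⟨j n, i⟩ ⟨j n, l⟩).1) hτC.1
        (by linarith) hτC.2).trans ?_
      obtain ⟨h1, h2⟩ := hreg.relRate_bounds hq.1 hq.2 (j n)
      generalize (M n).relRate c a₁ a₂ q (j n) = r at h1 h2 ⊢
      have hωr : (M n).omega c a₁ a₂ q ≤ r / b := by
        rw [le_div_iff₀ hb, mul_comm]
        exact (mul_le_mul hbm hωρ hωpos.le (hb.le.trans hbm)).trans h1
      have h3 : C * (M n).omega c a₁ a₂ q ≤ C * (r / b) := by gcongr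
      have h4 : 2 * √((M n).size (j n)) * (C * (M n).omega c a₁ a₂ q) ^ 2 ≤
          2 * C ^ 2 * (3 * d * r) := by
        calc _ = 2 * C ^ 2 * (√((M n).size (j n)) * (M n).omega c a₁ a₂ q ^ 2) := by ring
          _ ≤ _ := by gcongr
      calc _ ≤ 2 * (k + R : ℝ) * (5 * (C * (r / b)) + 2 * C ^ 2 * (3 * d * r)) / b +
            Cγ * r / b := by
            refine add_le_add (by gcongr) (div_le_div_of_nonneg_right ?_ hb.le)
            exact hγ.trans (mul_le_mul_of_nonneg_left h1 hCγ0)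
        _ = _ := by ring
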